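/- Let $d\ge 1$, let $\Omega\subset\mathbb R^d$ be a bounded, connected, nonempty open set, and let $u^0\in H^1(\Omega)$. Let $\Phi(u)=\frac12\int_\Omega|Du|^2\,dx$, with one of the following two boundary conditions: homogeneous Neumann conditions, where $\mathrm{dom}(\Phi)=H^1(\Omega)$ and $V:=H^1(\Omega)$ (in this case we assume that $\partial\Omega$ is Lipschitz), or Dirichlet conditions, where $\mathrm{dom}(\Phi)=u^0+H^1_0(\Omega)$ and $V:=H^1_0(\Omega)$; outside $\mathrm{dom}(\Phi)$ one puts $\Phi=+\infty$. For $u\in H^1(\Omega)$ we write $\Delta u=g\in L^2(\Omega)$ if $\int_\Omega Du\cdot D\varphi\,dx=-\int_\Omega g\varphi\,dx$ for all $\varphi\in V$ (so that the Neumann condition is included). A *flow* starting from $u^0$ is a curve $u\in C^0([0,+\infty);H^1(\Omega))$ with $u(0)=u^0$, $u(t)\in\mathrm{dom}(\Phi)$ for all $t\ge0$, which has a time derivative $\dot u\in L^1_{\rm loc}((0,+\infty);H^1(\Omega))$ (that is, $u(t)-u(s)=\int_s^t\dot u(r)\,dr$ for $0<s\le t$) and satisfies, for a.e. $t>0$,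 $\Delta u(t)\in L^2(\Omega)$ and $$|\Delta u|\le\|\dot u\|_1,\qquad \dot u\,\Delta u=|\dot u|\,\|\dot u\|_1\qquad\text{a.e. in }\Omega .$$ For $\tau>0$, a *minimizing movement* with step $\tau$ is a sequence $(u^n)_{n\ge0}$ starting from the given $u^0$ such that, for each $n\ge1$, $u^n$ minimizes $\Phi(u)+\frac1{2\tau}\|u-u^{n-1}\|_1^2$; its affine interpolant is $\hat u_\tau(t)=u^n+(t/\tau-n)(u^{n+1}-u^n)$ for $n\tau\le t\le(n+1)\tau$. Then: 1. There is a unique flow $u$ starting from $u^0$; moreover $\dot u\in L^2((t,+\infty);H^1(\Omega))$ for every $t>0$. 2. For every $\tau>0$ there is a minimizing movement with step $\tau$, and, for any choice of minimizing movements, $\hat u_\tau\to u$ in $H^1(\Omega)$ as $\tau\to0$, locally uniformly in $t\in(0,+\infty)$. 3. The semi-norm of the speed $\|D\dot u(t)\|_2$ is non-increasing in time: up to a null set of times, $\|D\dot u(t)\|_2\le\|D\dot u(s)\|_2$ whenever $0<s\le t$. -/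

import Mathlib

open MeasureTheory Set Filter Topology
open scoped ContDiff

namespace L1Flow

/-- The Euclidean space `ℝ^d`. -/
abbrev Eu (d : ℕ) : Type := EuclideanSpace ℝ (Fin d)

/-- Lebesgue measure on `Ω`. -/
noncomputable abbrev vol {d : ℕ} (Ω : Set (Eu d)) : Measure (Eu d) := volume.restrict Ω

/-- `φ ∈ C_c^∞(Ω)`. -/
structure IsTest {d : ℕ} (Ω : Set (Eu d)) (φ : Eu d → ℝ) : Prop where
  smooth : ContDiff ℝ ∞ φ
  compact : HasCompactSupport φ
  support : tsupport φ ⊆ Ω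

/-- The Hilbert space `L²(Ω) × L²(Ω; ℝ^d)`, with norm `(‖u‖₂² + ‖G‖₂²)^{1/2}`. -/
abbrev L2Pair {d : ℕ} (Ω : Set (Eu d)) : Type :=
  WithLp 2 (Lp ℝ 2 (vol Ω) × Lp (Eu d) 2 (vol Ω))

/-- `G` is the weak gradient of `u` in `Ω`:
`∫_Ω u ∂_e φ = - ∫_Ω φ G·e` for all test functions `φ` and all directions `e`. -/
def IsWeakGrad {d : ℕ} (Ω : Set (Eu d)) (u : Eu d → ℝ) (G : Eu d → Eu d) : Prop :=
  ∀ φ : Eu d → ℝ, IsTest Ω φ → ∀ e : Eu d,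
    ∫ x in Ω, u x * fderiv ℝ φ x e = - ∫ x in Ω, φ x * inner ℝ e (G x)

theorem IsTest.memLp {d : ℕ} {Ω : Set (Eu d)} {φ : Eu d → ℝ} (h : IsTest Ω φ) :
    MemLp φ 2 (vol Ω) :=
  (h.smooth.continuous.memLp_of_hasCompactSupport h.compact).restrict Ω

theorem IsTest.memLp_smul {d : ℕ} {Ω : Set (Eu d)} {φ : Eu d → ℝ} (h : IsTest Ω φ) (e : Eu d) :
    MemLp (fun x => φ x • e) 2 (vol Ω) :=
  ((h.smooth.continuous.smul continuous_const).memLp_of_hasCompactSupport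
    (h.compact.smul_right (f' := fun _ => e))).restrict Ω

theorem IsTest.memLp_fderiv {d : ℕ} {Ω : Set (Eu d)} {φ : Eu d → ℝ} (h : IsTest Ω φ) (e : Eu d) :
    MemLp (fun x => fderiv ℝ φ x e) 2 (vol Ω) :=
  (((h.smooth.continuous_fderiv (by simp)).clm_apply
    continuous_const).memLp_of_hasCompactSupport (h.compact.fderiv_apply ℝ e)).restrict Ω

/-- The weak gradient identity written through inner products of `L²`. -/
theorem isWeakGrad_iff {d : ℕ} {Ω : Set (Eu d)} (u : Lp ℝ 2 (vol Ω)) (G : Lp (Eu d) 2 (vol Ω)) :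
    IsWeakGrad Ω u G ↔ ∀ (φ : Eu d → ℝ) (h : IsTest Ω φ) (e : Eu d),
      inner ℝ ((h.memLp_fderiv e).toLp _) u = - inner ℝ ((h.memLp_smul e).toLp _) G := by
  have key : ∀ (φ : Eu d → ℝ) (h : IsTest Ω φ) (e : Eu d),
      inner ℝ ((h.memLp_fderiv e).toLp _) u = ∫ x in Ω, u x * fderiv ℝ φ x e ∧
      inner ℝ ((h.memLp_smul e).toLp _) G = ∫ x in Ω, φ x * inner ℝ e (G x) := by
    intro φ h e
    constructor
    · rw [L2.inner_def]
      apply integral_congr_ae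
      filter_upwards [(h.memLp_fderiv e).coeFn_toLp] with x hx
      rw [hx]; simp
    · rw [L2.inner_def]
      apply integral_congr_ae
      filter_upwards [(h.memLp_smul e).coeFn_toLp] with x hx
      rw [hx, real_inner_smul_left]
  constructor
  · intro H φ h e
    rw [(key φ h e).1, (key φ h e).2]; exact H φ h e
  · intro H φ h e
    rw [← (key φ h e).1, ← (key φ h e).2]; exact H φ h e

/-- The Sobolev space `H¹(Ω)`: pairs `(u, Du)` in `L²` where `Du` is the weak gradient of `u`,
with the Hilbert norm `(‖u‖₂² + ‖Du‖₂²)^{1/2}`. -/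
def H1 {d : ℕ} (Ω : Set (Eu d)) : Submodule ℝ (L2Pair Ω) where
  carrier := {p | IsWeakGrad Ω p.fst p.snd}
  zero_mem' := by
    simp only [mem_ofPred_eq, isWeakGrad_iff]
    intro φ h e; simp
  add_mem' := by
    intro p q hp hq
    simp only [mem_ofPred_eq, isWeakGrad_iff] at *
    intro φ h e
    simp only [WithLp.add_fst, WithLp.add_snd, inner_add_right]
    rw [hp φ h e, hq φ h e]; ring
  smul_mem' := by
    intro c p hp
    simp only [mem_ofPred_eq, isWeakGrad_iff] at *
    intro φ h e
    simp only [WithLp.smul_fst, WithLp.smul_snd, inner_smul_right]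
    rw [hp φ h e]; simp

theorem isClosed_H1 {d : ℕ} (Ω : Set (Eu d)) : IsClosed (H1 Ω : Set (L2Pair Ω)) := by
  have : (H1 Ω : Set (L2Pair Ω)) = ⋂ (φ : Eu d → ℝ) (h : IsTest Ω φ) (e : Eu d),
      {p | inner ℝ ((h.memLp_fderiv e).toLp _) p.fst
        = - inner ℝ ((h.memLp_smul e).toLp _) p.snd} := by
    ext p
    simp only [mem_iInter, mem_ofPred_eq]
    exact isWeakGrad_iff p.fst p.snd
  rw [this]
  refine isClosed_iInter fun φ => isClosed_iInter fun h => isClosed_iInter fun e => ?_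
  have h1 : Continuous fun p : L2Pair Ω => p.fst := continuous_fst.comp (WithLp.prod_continuous_ofLp 2 _ _)
  have h2 : Continuous fun p : L2Pair Ω => p.snd := continuous_snd.comp (WithLp.prod_continuous_ofLp 2 _ _)
  exact isClosed_eq (continuous_const.inner h1) (continuous_const.inner h2).neg

instance instCompleteSpaceH1 {d : ℕ} (Ω : Set (Eu d)) : CompleteSpace (H1 Ω) :=
  (isClosed_H1 Ω).completeSpace_coe

/-- The function underlying an element of `H¹(Ω)`. -/
noncomputable def fn {d : ℕ} {Ω : Set (Eu d)} (u : H1 Ω) : Eu d → ℝ := (u : L2Pair Ω).fst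

/-- The weak gradient `Du` of an element of `H¹(Ω)`. -/
noncomputable def grad {d : ℕ} {Ω : Set (Eu d)} (u : H1 Ω) : Eu d → Eu d := (u : L2Pair Ω).snd

/-- `‖u‖_1 = ∫_Ω |u|`. -/
noncomputable def l1norm {d : ℕ} {Ω : Set (Eu d)} (u : H1 Ω) : ℝ := ∫ x in Ω, |fn u x|

/-- `‖Du‖_2 = (∫_Ω |Du|²)^{1/2}`. -/
noncomputable def gradNorm {d : ℕ} {Ω : Set (Eu d)} (u : H1 Ω) : ℝ :=
  Real.sqrt (∫ x in Ω, ‖grad u x‖ ^ 2)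

/-- The Dirichlet energy `½ ∫_Ω |Du|²`. -/
noncomputable def energy {d : ℕ} {Ω : Set (Eu d)} (u : H1 Ω) : ℝ :=
  (1 / 2) * ∫ x in Ω, ‖grad u x‖ ^ 2

/-- `H¹_0(Ω)`: the closure of `C_c^∞(Ω)` in `H¹(Ω)`. -/
noncomputable def H10 {d : ℕ} (Ω : Set (Eu d)) : Submodule ℝ (H1 Ω) :=
  (Submodule.span ℝ {w : H1 Ω | ∃ φ, IsTest Ω φ ∧ fn w =ᵐ[vol Ω] φ}).topologicalClosure

/-- The two boundary conditions. -/
inductive BC : Type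
  | neumann
  | dirichlet

/-- The directions in which a function may be varied: all of `H¹(Ω)` for homogeneous Neumann
conditions, `H¹_0(Ω)` for Dirichlet conditions. -/
noncomputable def BC.space {d : ℕ} (bc : BC) (Ω : Set (Eu d)) : Submodule ℝ (H1 Ω) :=
  match bc with
  | .neumann => ⊤
  | .dirichlet => H10 Ω

/-- The domain of the energy: `H¹(Ω)` (Neumann), `u⁰ + H¹_0(Ω)` (Dirichlet). -/
def BC.dom {d : ℕ} {Ω : Set (Eu d)} (bc : BC) (u₀ : H1 Ω) : Set (H1 Ω) :=
  {w | w - u₀ ∈ bc.space Ω}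

/-- `Δu = g ∈ L²(Ω)` in the weak sense, with the boundary condition: `∫ Du·Dφ = -∫ g φ` for all
`φ` in `H¹(Ω)` (so that the normal derivative of `u` vanishes), resp. in `H¹_0(Ω)`. -/
def IsWeakLaplacian {d : ℕ} {Ω : Set (Eu d)} (bc : BC) (u : H1 Ω) (g : Lp ℝ 2 (vol Ω)) : Prop :=
  ∀ φ ∈ bc.space Ω, ∫ x in Ω, inner ℝ (grad u x) (grad φ x) = - ∫ x in Ω, g x * fn φ x

/-- The (open) set `Ω` has Lipschitz boundary: near each boundary point, `Ω` is the strict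
epigraph of a Lipschitz function over a hyperplane `e^⊥`. -/
def HasLipschitzBoundary {d : ℕ} (Ω : Set (Eu d)) : Prop :=
  ∀ p ∈ frontier Ω, ∃ e : Eu d, ‖e‖ = 1 ∧ ∃ (K : NNReal) (g : Eu d → ℝ), LipschitzWith K g ∧
    ∃ r > 0, ∀ x ∈ Metric.ball p r,
      (x ∈ Ω ↔ g (x - inner ℝ e x • e) < inner ℝ e x)

/-- `v = u̇ ∈ L^1_loc((0,∞); H¹(Ω))`: `u` is locally absolutely continuous on `(0,∞)` with
values in `H¹(Ω)`, with derivative `v`. -/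
def IsTimeDeriv {d : ℕ} {Ω : Set (Eu d)} (u v : ℝ → H1 Ω) : Prop :=
  ∀ s t : ℝ, 0 < s → s ≤ t → IntervalIntegrable v volume s t ∧ u t - u s = ∫ r in s..t, v r

/-- `u ∈ C^0([0,∞); H¹(Ω))`, with speed `v = u̇`, starts from `u₀` and solves
`|Δu| ≤ ‖u̇‖_1`, `u̇ Δu = |u̇| ‖u̇‖_1` a.e. in `Ω`, at a.e. time, with the boundary
condition `bc`. -/
structure IsFlow {d : ℕ} {Ω : Set (Eu d)} (bc : BC) (u₀ : H1 Ω) (u v : ℝ → H1 Ω) : Prop where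
  continuousOn : ContinuousOn u (Ici 0)
  initial : u 0 = u₀
  mem_dom : ∀ t, 0 ≤ t → u t ∈ bc.dom u₀
  timeDeriv : IsTimeDeriv u v
  equation : ∀ᵐ t ∂(volume.restrict (Ioi (0 : ℝ))), ∃ g : Lp ℝ 2 (vol Ω),
    IsWeakLaplacian bc (u t) g ∧
    (∀ᵐ x ∂(vol Ω), |g x| ≤ l1norm (v t)) ∧
    (∀ᵐ x ∂(vol Ω), fn (v t) x * g x = |fn (v t) x| * l1norm (v t))

/-- `U n`, `n ≥ 0`, is a minimizing movement with time step `τ` from `u₀`: `U (n+1)` minimizes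
`Φ(w) + ‖w - U n‖_1² / (2τ)`. Outside `bc.dom u₀` the functional is `+∞`. -/
structure IsMinMov {d : ℕ} {Ω : Set (Eu d)} (bc : BC) (u₀ : H1 Ω) (τ : ℝ) (U : ℕ → H1 Ω) :
    Prop where
  initial : U 0 = u₀
  mem_dom : ∀ n, U n ∈ bc.dom u₀
  minimal : ∀ n, ∀ w ∈ bc.dom u₀,
    energy (U (n + 1)) + l1norm (U (n + 1) - U n) ^ 2 / (2 * τ)
      ≤ energy w + l1norm (w - U n) ^ 2 / (2 * τ)

/-- The affine interpolant in time, `u^n + (t/τ - n)(u^{n+1} - u^n)` for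
`nτ ≤ t ≤ (n+1)τ`. -/
noncomputable def interp {d : ℕ} {Ω : Set (Eu d)} (τ : ℝ) (U : ℕ → H1 Ω) (t : ℝ) : H1 Ω :=
  U ⌊t / τ⌋₊ + (t / τ - (⌊t / τ⌋₊ : ℝ)) • (U (⌊t / τ⌋₊ + 1) - U ⌊t / τ⌋₊)

end L1Flow

/-! The flow is the gradient flow of the Dirichlet energy for the dissipation `‖·‖_1 ^ 2 / 2`. With
`x` the gradient of the state, `v` the velocity, `D` the gradient on `V` and `p` the `L¹` norm, the
equation says that `-D^* x` is a subgradient of `p ^ 2 / 2` at `v` (`Setting.Rel`). Hahn-Banach and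
Riesz turn this abstract relation into the pointwise equation (`exists_equation`).

Although `p` is not Hilbertian, the relation is dissipative between `x` and `D v` in `L²`
(`Rel.inner_sub_le`). Hence gradients of solutions and of implicit Euler schemes contract, and the
speed `‖D v‖` decreases. Schemes with different steps have close gradients when the initial velocity
is bounded, and such initial states are dense (`exists_rel_near`); contraction then covers all
initial data.

Convergence of states does not give convergence of velocities. For this, `p v ^ 2 / 2` is a convex
function of `x` with subgradient `-D v` (`Rel.sub_le_inner`). Testing a displacement with the
initial velocity therefore bounds from below by the square of the final speed, so a velocity is
close to its difference quotient unless the speed drops (`norm_rate_sub_slope_sq_le`). The total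
drop is bounded because the speed is monotone, so velocities are Cauchy in `L¹` on compact time
intervals, uniformly in the step. The same inequalities give the regularizing bound `‖D v‖ ≤ 2 ‖x₀‖
/ t`, which makes the velocity square integrable away from `0`.

Under Neumann conditions `D v` forgets the constants. But `v` minimizes `p` in its class modulo
constants (`Rel.isReduced`), that is, `0` is a median of `v`. The median of an `H¹` function on a
connected domain is unique (`not_le_of_isMedian`), and finite dimensional compactness of the kernel
makes `v` depend continuously on `D v` (`tendsto_of_isReduced`). Thus everything proved for `D v`
passes to `v`.

What remains is to check the abstract hypotheses: Friedrichs' inequality for Dirichlet conditions,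
and for Neumann conditions a Poincaré-Wirtinger inequality obtained by translating sets inside `Ω`.
-/

set_option linter.unusedSectionVars false

/-! ### Abstract setting: the kernel of the gradient, compactness, and minimizers of `p` modulo the
kernel. -/

namespace L1Flow

/-- A Hilbert space `V` with a "gradient" `D : V → F` satisfying a Poincaré inequality modulo its
finite dimensional kernel, and a continuous norm `p` which has at most one minimizer in each class
modulo `ker D`. -/
structure Setting (V F : Type*) [NormedAddCommGroup V] [InnerProductSpace ℝ V]
    [NormedAddCommGroup F] [InnerProductSpace ℝ F] where
  /-- the gradient -/
  D : V →L[ℝ] F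
  /-- the dissipation norm -/
  p : Seminorm ℝ V
  continuous_p : Continuous p
  eq_zero_of_p : ∀ w, p w = 0 → w = 0
  finite_ker : FiniteDimensional ℝ (LinearMap.ker D.toLinearMap)
  poincare : ∃ C, ∀ w, ∃ k, D k = 0 ∧ ‖w - k‖ ≤ C * ‖D w‖
  strict : ∀ w k, D k = 0 → (∀ k', D k' = 0 → p w ≤ p (w + k')) → p (w + k) ≤ p w → k = 0

namespace Setting

variable {V F : Type*} [NormedAddCommGroup V] [InnerProductSpace ℝ V]
  [NormedAddCommGroup F] [InnerProductSpace ℝ F] (S : Setting V F)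

/-- The kernel of the gradient. -/
abbrev ker : Submodule ℝ V := LinearMap.ker S.D.toLinearMap

instance : FiniteDimensional ℝ S.ker := S.finite_ker

theorem mem_ker {w : V} : w ∈ S.ker ↔ S.D w = 0 := by
  simp [ker]

theorem exists_p_le : ∃ c, 0 < c ∧ ∀ w, S.p w ≤ c * ‖w‖ :=
  Seminorm.bound_of_continuous_normedSpace S.p S.continuous_p

theorem exists_norm_le_of_mem_ker : ∃ c, 0 < c ∧ ∀ k ∈ S.ker, ‖k‖ ≤ c * S.p k := by
  have hcomp : IsCompact (Metric.sphere (0 : S.ker) 1) := isCompact_sphere _ _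
  rcases (Metric.sphere (0 : S.ker) 1).eq_empty_or_nonempty with he | hne
  -- The unit sphere is empty only when the kernel is trivial, so any constant serves.
  · refine ⟨1, one_pos, fun k hk => ?_⟩
    by_contra hcon
    have hk0 : k ≠ 0 := by
      rintro rfl
      simp at hcon
    have : (⟨‖k‖⁻¹ • k, S.ker.smul_mem _ hk⟩ : S.ker) ∈ Metric.sphere (0 : S.ker) 1 := by
      simp [norm_smul, hk0]
    rw [he] at this
    exact this
  · obtain ⟨k₀, hk₀, hmin⟩ := hcomp.exists_isMinOn hne
      (f := fun k : S.ker => S.p k) (S.continuous_p.comp continuous_subtype_val).continuousOn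
    have hpos : 0 < S.p k₀ := by
      refine lt_of_le_of_ne (apply_nonneg _ _) fun h => ?_
      have h0 := S.eq_zero_of_p _ h.symm
      have : ‖(k₀ : V)‖ = 1 := by simpa using hk₀
      simp [h0] at this
    refine ⟨(S.p k₀)⁻¹, by positivity, fun k hk => ?_⟩
    rcases eq_or_ne k 0 with rfl | hk0
    · simp
    have hn : 0 < ‖k‖ := norm_pos_iff.2 hk0
    have hm : (⟨‖k‖⁻¹ • k, S.ker.smul_mem _ hk⟩ : S.ker) ∈ Metric.sphere (0 : S.ker) 1 := by
      simp [norm_smul, hk0]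
    have := hmin hm
    simp only [mem_ofPred_eq, map_smul_eq_mul, norm_inv, norm_norm] at this
    rw [inv_mul_eq_div, le_div_iff₀ hpos]
    rw [inv_mul_eq_div, le_div_iff₀ hn] at this
    linarith

/-- The component of `w` orthogonal to the kernel of the gradient. -/
noncomputable def perp (w : V) : V := w - S.ker.starProjection w

theorem D_starProjection (w : V) : S.D (S.ker.starProjection w) = 0 :=
  S.mem_ker.1 (S.ker.starProjection_apply_mem w)

theorem D_perp (w : V) : S.D (S.perp w) = S.D w := by
  simp [perp, D_starProjection]

theorem perp_sub (w z : V) : S.perp (w - z) = S.perp w - S.perp z := by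
  simp only [perp, map_sub]; abel

/-- `perp w` is the shortest representative of its class modulo the kernel, so the unspecified
kernel element in `poincare` can be dropped. -/
theorem exists_norm_perp_le : ∃ C, 0 < C ∧ ∀ w, ‖S.perp w‖ ≤ C * ‖S.D w‖ := by
  obtain ⟨C, hC⟩ := S.poincare
  refine ⟨|C| + 1, by positivity, fun w => ?_⟩
  obtain ⟨k, hk, hle⟩ := hC (S.perp w)
  have horth : inner ℝ (S.perp w) k = 0 := by
    rw [real_inner_comm]
    exact S.ker.sub_starProjection_mem_orthogonal w k (S.mem_ker.2 hk)
  have h1 : ‖S.perp w‖ ≤ ‖S.perp w - k‖ := by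
    refine le_of_sq_le_sq ?_ (norm_nonneg _)
    rw [@norm_sub_sq_real]
    nlinarith [sq_nonneg ‖k‖]
  rw [D_perp] at hle
  calc _ ≤ C * ‖S.D w‖ := h1.trans hle
    _ ≤ _ := by gcongr; linarith [le_abs_self C]

/-- Poincaré controls the orthogonal part. On the finite dimensional kernel `p` is an equivalent
norm, and the kernel part has `p`-value at most `p w + p (perp w)`. -/
theorem exists_norm_le : ∃ C, 0 < C ∧ ∀ w, ‖w‖ ≤ C * (‖S.D w‖ + S.p w) := by
  obtain ⟨C, hC, hperp⟩ := S.exists_norm_perp_le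
  obtain ⟨a, ha, hp⟩ := S.exists_p_le
  obtain ⟨c, hc, hk⟩ := S.exists_norm_le_of_mem_ker
  refine ⟨C + c + c * a * C, by positivity, fun w => ?_⟩
  have h1 : w = S.perp w + S.ker.starProjection w := by simp [perp]
  have h2 := hk _ (S.ker.starProjection_apply_mem w)
  have h3 : S.p (S.ker.starProjection w) ≤ S.p w + S.p (S.perp w) := by
    have : S.ker.starProjection w = w - S.perp w := by simp [perp]
    rw [this]; exact map_sub_le_add _ _ _
  have h4 := hp (S.perp w)
  have h5 := hperp w
  have h6 : ‖w‖ ≤ ‖S.perp w‖ + ‖S.ker.starProjection w‖ := by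
    conv_lhs => rw [h1]
    exact norm_add_le _ _
  have h7 : S.p (S.perp w) ≤ a * (C * ‖S.D w‖) := h4.trans (by gcongr)
  have h8 : c * S.p (S.ker.starProjection w) ≤ c * (S.p w + a * (C * ‖S.D w‖)) := by
    gcongr; linarith
  have h9 : 0 ≤ S.p w := apply_nonneg _ _
  have h10 : 0 ≤ ‖S.D w‖ := norm_nonneg _
  have : 0 ≤ C * S.p w + c * ‖S.D w‖ + c * a * C * S.p w := by positivity
  nlinarith

/-- The orthogonal parts are Cauchy by Poincaré, and the kernel parts are bounded in a finite
dimensional space. -/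
theorem exists_tendsto_subseq [CompleteSpace V] {z : ℕ → V}
    (hD : CauchySeq fun j => S.D (z j)) {R : ℝ} (hR : ∀ j, S.p (z j) ≤ R) :
    ∃ z' : V, ∃ φ : ℕ → ℕ, StrictMono φ ∧ Tendsto (z ∘ φ) atTop (𝓝 z') := by
  obtain ⟨C, hC, hperp⟩ := S.exists_norm_perp_le
  obtain ⟨c, hc, hn⟩ := S.exists_norm_le
  have hpc : CauchySeq fun j => S.perp (z j) := by
    rw [Metric.cauchySeq_iff'] at hD ⊢
    intro ε hε
    obtain ⟨N, hN⟩ := hD (ε / C) (by positivity)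
    refine ⟨N, fun n hn => ?_⟩
    have := hN n hn
    rw [dist_eq_norm, lt_div_iff₀ hC, ← map_sub] at this
    rw [dist_eq_norm, ← perp_sub]
    exact (hperp _).trans_lt (by linarith)
  obtain ⟨h, hh⟩ := cauchySeq_tendsto_of_complete hpc
  obtain ⟨B, hB⟩ := hD.isBounded_range.exists_norm_le
  have hzb : ∀ j, ‖z j‖ ≤ c * (B + R) := fun j =>
    (hn _).trans (by gcongr; exacts [hB _ ⟨j, rfl⟩, hR j])
  have hkb : ∀ j, S.ker.orthogonalProjectionOnto (z j) ∈ Metric.closedBall (0 : S.ker) (c * (B + R)) := by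
    intro j
    rw [mem_closedBall_zero_iff]
    exact (S.ker.norm_orthogonalProjectionOnto_apply_le _).trans (hzb j)
  obtain ⟨k, -, φ, hφ, hk⟩ := tendsto_subseq_of_bounded Metric.isBounded_closedBall hkb
  refine ⟨h + k, φ, hφ, ?_⟩
  have h1 := (hh.comp hφ.tendsto_atTop).add ((continuous_subtype_val.tendsto k).comp hk)
  refine h1.congr fun j => ?_
  simp [perp]

/-- `w` minimizes `p` in its class modulo the kernel of the gradient. -/
def IsReduced (w : V) : Prop := ∀ k, S.D k = 0 → S.p w ≤ S.p (w + k)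

variable {S}

/-- Both elements minimize `p` in the same class, where `strict` allows a single minimizer. This is
how velocities are recovered from their gradients. -/
theorem IsReduced.eq_of_D_eq {w z : V} (hw : S.IsReduced w) (hz : S.IsReduced z)
    (h : S.D w = S.D z) : w = z := by
  have hk : S.D (z - w) = 0 := by simp [h]
  have := S.strict w (z - w) hk hw (by
    have := hz (w - z) (by simp [h])
    simpa using this)
  exact (sub_eq_zero.1 this).symm

theorem isReduced_of_tendsto {ι : Type*} {l : Filter ι} [l.NeBot] {z : ι → V} {w : V}
    (hz : ∀ᶠ i in l, S.IsReduced (z i)) (h : Tendsto z l (𝓝 w)) : S.IsReduced w := by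
  intro k hk
  refine le_of_tendsto_of_tendsto ((S.continuous_p.tendsto _).comp h)
    ((S.continuous_p.tendsto _).comp (h.add_const k)) ?_
  filter_upwards [hz] with i hi
  exact hi k hk

/-- Comparison with `perp w`, which lies in the same class, bounds `p w` by the gradient alone. -/
theorem exists_isReduced_norm_le (S : Setting V F) :
    ∃ C, 0 < C ∧ ∀ w, S.IsReduced w → ‖w‖ ≤ C * ‖S.D w‖ := by
  obtain ⟨C, hC, hperp⟩ := S.exists_norm_perp_le
  obtain ⟨a, ha, hp⟩ := S.exists_p_le
  obtain ⟨c, hc, hn⟩ := S.exists_norm_le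
  refine ⟨c * (1 + a * C), by positivity, fun w hw => ?_⟩
  have h1 : S.p w ≤ S.p (S.perp w) := by
    have := hw (- S.ker.starProjection w) (by simp [D_starProjection])
    simpa [perp, sub_eq_add_neg] using this
  have h2 : S.p w ≤ a * (C * ‖S.D w‖) := h1.trans ((hp _).trans (by gcongr; exact hperp w))
  calc ‖w‖ ≤ c * (‖S.D w‖ + S.p w) := hn w
    _ ≤ c * (‖S.D w‖ + a * (C * ‖S.D w‖)) := by gcongr
    _ = _ := by ring

/-- Every subsequence has a convergent further subsequence. Its limit is reduced and its gradient is
the limit of the gradients, so all these limits coincide. -/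
theorem exists_tendsto_of_isReduced [CompleteSpace V] {z : ℕ → V} (hz : ∀ j, S.IsReduced (z j))
    (hD : CauchySeq fun j => S.D (z j)) : ∃ w, Tendsto z atTop (𝓝 w) := by
  obtain ⟨C, hC, hb⟩ := S.exists_isReduced_norm_le
  obtain ⟨a, ha, hp⟩ := S.exists_p_le
  obtain ⟨B, hB⟩ := hD.isBounded_range.exists_norm_le
  have hR : ∀ j, S.p (z j) ≤ a * (C * B) := fun j =>
    (hp _).trans (by gcongr; exact (hb _ (hz j)).trans (by gcongr; exact hB _ ⟨j, rfl⟩))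
  obtain ⟨w, φ, hφ, hw⟩ := S.exists_tendsto_subseq hD hR
  refine ⟨w, tendsto_of_subseq_tendsto fun ns hns => ?_⟩
  obtain ⟨w', ψ, hψ, hw'⟩ := S.exists_tendsto_subseq (z := z ∘ ns)
    (hD.comp_tendsto hns) (fun j => hR _)
  refine ⟨ψ, ?_⟩
  have e : w' = w := by
    refine IsReduced.eq_of_D_eq (S := S) (isReduced_of_tendsto (.of_forall fun i => hz _) hw')
      (isReduced_of_tendsto (.of_forall fun i => hz _) hw) ?_
    have hξ : Tendsto (fun j => S.D (z j)) atTop (𝓝 (S.D w)) :=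
      tendsto_nhds_of_cauchySeq_of_subseq hD hφ.tendsto_atTop
        ((S.D.continuous.tendsto _).comp hw)
    exact tendsto_nhds_unique ((S.D.continuous.tendsto _).comp hw')
      (hξ.comp (hns.comp hψ.tendsto_atTop))
  rw [← e]; exact hw'

theorem tendsto_of_isReduced [CompleteSpace V] {z : ℕ → V} {w : V} (hz : ∀ j, S.IsReduced (z j))
    (hw : S.IsReduced w) (hD : Tendsto (fun j => S.D (z j)) atTop (𝓝 (S.D w))) :
    Tendsto z atTop (𝓝 w) := by
  obtain ⟨w', hw'⟩ := exists_tendsto_of_isReduced hz hD.cauchySeq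
  have : w' = w := IsReduced.eq_of_D_eq (isReduced_of_tendsto (.of_forall hz) hw') hw
    (tendsto_nhds_unique ((S.D.continuous.tendsto _).comp hw') hD)
  rwa [← this]

end Setting
end L1Flow

/-! ### The evolution law, one implicit Euler step, and density of the states with a velocity. -/

namespace L1Flow
namespace Setting

variable {V F : Type*} [NormedAddCommGroup V] [InnerProductSpace ℝ V]
  [NormedAddCommGroup F] [InnerProductSpace ℝ F] (S : Setting V F)

/-- The evolution law relating the gradient `x` of the state and the velocity `v`:
`-D^* x` is a subgradient of `p ^ 2 / 2` at `v`. -/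
structure Rel (x : F) (v : V) : Prop where
  abs_inner_le : ∀ φ, |inner ℝ x (S.D φ)| ≤ S.p v * S.p φ
  inner_eq : inner ℝ x (S.D v) = - S.p v ^ 2

variable {S}

/-- The pairing of `x` with `D (v + k)` is still `-p v ^ 2`, so `p v ^ 2 ≤ p v * p (v + k)`. -/
theorem Rel.isReduced {x : F} {v : V} (h : S.Rel x v) : S.IsReduced v := by
  intro k hk
  have h1 := h.abs_inner_le (v + k)
  rw [map_add, hk, add_zero, h.inner_eq, abs_neg, abs_of_nonneg (by positivity)] at h1
  rcases (apply_nonneg S.p v).eq_or_lt with h0 | h0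
  · rw [← h0]; exact apply_nonneg _ _
  · nlinarith

/-- Dissipativity of the evolution law. -/
theorem Rel.inner_sub_le {x x' : F} {v v' : V} (h : S.Rel x v) (h' : S.Rel x' v') :
    inner ℝ (x - x') (S.D v - S.D v') ≤ 0 := by
  have h1 := h.inner_eq
  have h2 := h'.inner_eq
  have h3 := (abs_le.1 (h.abs_inner_le v')).1
  have h4 := (abs_le.1 (h'.abs_inner_le v)).1
  simp only [inner_sub_left, inner_sub_right]
  -- The two diagonal terms and the bounds on the two cross terms add up to `-(p v - p v') ^ 2`.
  nlinarith [sq_nonneg (S.p v - S.p v')]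

/-- `p v ^ 2 / 2` is, as a function of `x`, a convex function with subgradient `-D v` at `x`. -/
theorem Rel.sub_le_inner {x x' : F} {v v' : V} (h : S.Rel x v) (h' : S.Rel x' v') :
    S.p v ^ 2 / 2 - S.p v' ^ 2 / 2 ≤ inner ℝ (S.D v) (x' - x) := by
  have h1 := h.inner_eq
  have h4 := (abs_le.1 (h'.abs_inner_le v)).1
  rw [real_inner_comm, inner_sub_left]
  nlinarith [sq_nonneg (S.p v - S.p v')]

theorem Rel.of_tendsto {ι : Type*} {l : Filter ι} [l.NeBot] {x : ι → F} {v : ι → V} {x' : F}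
    {v' : V} (h : ∀ᶠ i in l, S.Rel (x i) (v i)) (hx : Tendsto x l (𝓝 x'))
    (hv : Tendsto v l (𝓝 v')) : S.Rel x' v' := by
  have hp := (S.continuous_p.tendsto _).comp hv
  constructor
  · intro φ
    refine le_of_tendsto_of_tendsto (hx.inner tendsto_const_nhds).abs (hp.mul_const _) ?_
    filter_upwards [h] with i hi using hi.abs_inner_le φ
  · refine tendsto_nhds_unique (hx.inner ((S.D.continuous.tendsto _).comp hv))
      ((hp.pow 2).neg.congr' ?_)
    filter_upwards [h] with i hi using hi.inner_eq.symm

variable (S)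

/-- `w'` minimizes `½ ‖x₀ + D w'‖² + p (w' - w)² / (2τ)`. -/
def IsStep (x₀ : F) (τ : ℝ) (w w' : V) : Prop :=
  ∀ z, ‖x₀ + S.D w'‖ ^ 2 / 2 + S.p (w' - w) ^ 2 / (2 * τ)
    ≤ ‖x₀ + S.D z‖ ^ 2 / 2 + S.p (z - w) ^ 2 / (2 * τ)

variable {S}

theorem nonneg_of_forall_small {a b : ℝ} (h : ∀ ε, 0 < ε → ε < 1 → 0 ≤ ε * a + ε ^ 2 * b) :
    0 ≤ a := by
  by_contra! hcon
  have hb : 0 < 1 + |b| := by positivity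
  set ε := min (1 / 2) (-a / (2 * (1 + |b|))) with hε
  have h0 : 0 < ε := lt_min (by norm_num) (div_pos (by linarith) (by positivity))
  have h1 : ε < 1 := (min_le_left _ _).trans_lt (by norm_num)
  have h2 : ε * (2 * (1 + |b|)) ≤ -a := by
    rw [← le_div_iff₀ (by positivity)]; exact min_le_right _ _
  have h3 := h ε h0 h1
  have h4 : 0 ≤ a + ε * b := by
    by_contra! h5
    nlinarith
  nlinarith [le_abs_self b]

/-- Euler-Lagrange conditions without differentiating `p`: arbitrary variations use the triangle
inequality and give the bound, while variations along the increment use homogeneity and give the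
equality. -/
theorem IsStep.rel {x₀ : F} {τ : ℝ} (hτ : 0 < τ) {w w' : V} (h : S.IsStep x₀ τ w w') :
    S.Rel (x₀ + S.D w') (τ⁻¹ • (w' - w)) := by
  set x := x₀ + S.D w' with hx
  set q := S.p (w' - w) with hq
  have hq0 : 0 ≤ q := apply_nonneg _ _
  have hpv : S.p (τ⁻¹ • (w' - w)) = τ⁻¹ * q := by
    rw [map_smul_eq_mul, Real.norm_of_nonneg (by positivity)]
  have expand : ∀ (ε : ℝ) (φ : V), ‖x₀ + S.D (w' + ε • φ)‖ ^ 2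
      = ‖x‖ ^ 2 + 2 * (ε * inner ℝ x (S.D φ)) + ε ^ 2 * ‖S.D φ‖ ^ 2 := by
    intro ε φ
    rw [map_add, ← add_assoc, ← hx, @norm_add_sq_real, map_smul, inner_smul_right, norm_smul,
      mul_pow, Real.norm_eq_abs, sq_abs]
  have lower : ∀ φ, 0 ≤ inner ℝ x (S.D φ) + τ⁻¹ * q * S.p φ := by
    intro φ
    refine nonneg_of_forall_small (b := ‖S.D φ‖ ^ 2 / 2 + S.p φ ^ 2 / (2 * τ))
      fun ε hε _ => ?_
    have h1 := h (w' + ε • φ)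
    rw [expand] at h1
    have h2 : S.p (w' + ε • φ - w) ≤ q + ε * S.p φ := by
      have : w' + ε • φ - w = (w' - w) + ε • φ := by abel
      rw [this]
      refine (map_add_le_add _ _ _).trans ?_
      rw [map_smul_eq_mul, Real.norm_of_nonneg hε.le]
    have h3 : S.p (w' + ε • φ - w) ^ 2 ≤ (q + ε * S.p φ) ^ 2 := by gcongr
    have h4 : S.p (w' + ε • φ - w) ^ 2 / (2 * τ) ≤ (q + ε * S.p φ) ^ 2 / (2 * τ) := by gcongr
    have h5 : (q + ε * S.p φ) ^ 2 / (2 * τ)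
        = q ^ 2 / (2 * τ) + ε * (τ⁻¹ * q * S.p φ) + ε ^ 2 * (S.p φ ^ 2 / (2 * τ)) := by
      field_simp; ring
    nlinarith
  constructor
  · intro φ
    rw [hpv, abs_le]
    have h1 := lower φ
    have h2 := lower (-φ)
    rw [map_neg, inner_neg_right, map_neg_eq_map] at h2
    constructor <;> linarith
  · rw [hpv, map_smul, inner_smul_right]
    -- The increment is scaled by `1 + ε * s` with `s = ±1`; since `ε < 1` the factor is nonnegative
    -- and `p` scales exactly, so both signs are available.
    have key : ∀ s : ℝ, s ^ 2 = 1 → 0 ≤ s * (inner ℝ x (S.D (w' - w)) + τ⁻¹ * q ^ 2) := by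
      intro s hs
      have hs1 : |s| = 1 := by
        rw [← sq_abs] at hs; nlinarith [abs_nonneg s]
      refine nonneg_of_forall_small (b := ‖S.D (w' - w)‖ ^ 2 / 2 + q ^ 2 / (2 * τ))
        fun ε hε hε1 => ?_
      have h1 := h (w' + (ε * s) • (w' - w))
      rw [expand] at h1
      have h2 : S.p (w' + (ε * s) • (w' - w) - w) = (1 + ε * s) * q := by
        have e : w' + (ε * s) • (w' - w) - w = (1 + ε * s) • (w' - w) := by module
        have : 0 ≤ 1 + ε * s := by nlinarith [neg_abs_le s]
        rw [e, map_smul_eq_mul, Real.norm_of_nonneg this]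
      rw [h2] at h1
      have h5 : ((1 + ε * s) * q) ^ 2 / (2 * τ)
          = q ^ 2 / (2 * τ) + ε * (s * (τ⁻¹ * q ^ 2)) + ε ^ 2 * s ^ 2 * (q ^ 2 / (2 * τ)) := by
        field_simp; ring
      rw [h5, mul_pow, hs] at h1
      nlinarith
    have h1 := key 1 (by norm_num)
    have h2 := key (-1) (by norm_num)
    have h3 : inner ℝ x (S.D (w' - w)) = - (τ⁻¹ * q ^ 2) := by linarith
    rw [h3]; ring

/-- Along a minimizing sequence the gradients are Cauchy by strict convexity of the energy, and `p`
stays bounded by the penalty, so `exists_tendsto_subseq` yields a minimizer. -/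
theorem exists_isStep [CompleteSpace V] [CompleteSpace F] (x₀ : F) {τ : ℝ} (hτ : 0 < τ) (w : V) :
    ∃ w', S.IsStep x₀ τ w w' := by
  set J : V → ℝ := fun z => ‖x₀ + S.D z‖ ^ 2 / 2 + S.p (z - w) ^ 2 / (2 * τ) with hJ
  have hJ0 : ∀ z, 0 ≤ J z := fun z => by positivity
  have hJc : Continuous J := by
    have := S.D.continuous
    have := S.continuous_p.comp (continuous_id.sub (continuous_const (y := w)))
    simp only [hJ]
    exact ((by fun_prop : Continuous fun z => ‖x₀ + S.D z‖ ^ 2 / 2)).add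
      ((this.pow 2).div_const _)
  have hbdd : BddBelow (range J) := ⟨0, by rintro _ ⟨z, rfl⟩; exact hJ0 z⟩
  set m := sInf (range J) with hm
  have hmle : ∀ z, m ≤ J z := fun z => csInf_le hbdd ⟨z, rfl⟩
  have hex : ∀ j : ℕ, ∃ z, J z < m + 1 / (j + 1) := fun j => by
    obtain ⟨_, ⟨z, rfl⟩, hz⟩ := exists_lt_of_csInf_lt (range_nonempty J)
      (show m < m + 1 / ((j : ℝ) + 1) by simp only [lt_add_iff_pos_right]; positivity)
    exact ⟨z, hz⟩
  choose z hz using hex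
  have hm0 : 0 ≤ m := le_csInf (range_nonempty J) (by rintro _ ⟨z, rfl⟩; exact hJ0 z)
  -- Evaluation of `J` at the midpoint: the parallelogram law for the energy, convexity for the
  -- penalty.
  have mid : ∀ a b, ‖S.D a - S.D b‖ ^ 2 ≤ 4 * (J a + J b - 2 * m) := by
    intro a b
    have h1 := hmle ((1 / 2 : ℝ) • (a + b))
    have h2 : S.p ((1 / 2 : ℝ) • (a + b) - w) ≤ (S.p (a - w) + S.p (b - w)) / 2 := by
      have e : (1 / 2 : ℝ) • (a + b) - w = (1 / 2 : ℝ) • ((a - w) + (b - w)) := by module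
      rw [e, map_smul_eq_mul, Real.norm_of_nonneg (by norm_num)]
      linarith [map_add_le_add S.p (a - w) (b - w)]
    have h3 : S.p ((1 / 2 : ℝ) • (a + b) - w) ^ 2 ≤ (S.p (a - w) ^ 2 + S.p (b - w) ^ 2) / 2 := by
      have : S.p ((1 / 2 : ℝ) • (a + b) - w) ^ 2 ≤ ((S.p (a - w) + S.p (b - w)) / 2) ^ 2 := by
        gcongr
      nlinarith [sq_nonneg (S.p (a - w) - S.p (b - w))]
    have h4 : S.p ((1 / 2 : ℝ) • (a + b) - w) ^ 2 / (2 * τ)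
        ≤ (S.p (a - w) ^ 2 / (2 * τ) + S.p (b - w) ^ 2 / (2 * τ)) / 2 := by
      calc _ ≤ ((S.p (a - w) ^ 2 + S.p (b - w) ^ 2) / 2) / (2 * τ) := by gcongr
        _ = _ := by ring
    have h5 : ‖x₀ + S.D ((1 / 2 : ℝ) • (a + b))‖ ^ 2
        = (‖x₀ + S.D a‖ ^ 2 + ‖x₀ + S.D b‖ ^ 2) / 2 - ‖S.D a - S.D b‖ ^ 2 / 4 := by
      have e : x₀ + S.D ((1 / 2 : ℝ) • (a + b))
          = (1 / 2 : ℝ) • ((x₀ + S.D a) + (x₀ + S.D b)) := by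
        simp only [map_smul, map_add]; module
      have e2 : S.D a - S.D b = (x₀ + S.D a) - (x₀ + S.D b) := by abel
      have := parallelogram_law_with_norm ℝ (x₀ + S.D a) (x₀ + S.D b)
      rw [e, e2, norm_smul, mul_pow, Real.norm_of_nonneg (by norm_num : (0 : ℝ) ≤ 1 / 2)]
      linarith
    simp only [hJ] at h1 ⊢
    linarith
  have hcauchy : CauchySeq fun j => S.D (z j) := by
    refine cauchySeq_of_le_tendsto_0 (fun N : ℕ => Real.sqrt (8 * (1 / ((N : ℝ) + 1)))) ?_ ?_
    · intro i j N hi hj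
      rw [dist_eq_norm]
      refine Real.le_sqrt_of_sq_le ((mid _ _).trans ?_)
      have hi' : 1 / ((i : ℝ) + 1) ≤ 1 / (N + 1) := by gcongr
      have hj' : 1 / ((j : ℝ) + 1) ≤ 1 / (N + 1) := by gcongr
      linarith [hz i, hz j]
    · have := (tendsto_one_div_add_atTop_nhds_zero_nat (𝕜 := ℝ)).const_mul 8
      simpa using this.sqrt
  have hpb : ∀ j, S.p (z j) ≤ S.p w + Real.sqrt (2 * τ * (m + 1)) := by
    intro j
    have h1 : S.p (z j - w) ^ 2 / (2 * τ) ≤ m + 1 := by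
      have h2 := hz j
      have h3 : 1 / ((j : ℝ) + 1) ≤ 1 := by
        rw [div_le_one (by positivity)]; linarith [(Nat.cast_nonneg j : (0 : ℝ) ≤ j)]
      simp only [hJ] at h2
      nlinarith [sq_nonneg ‖x₀ + S.D (z j)‖]
    have h2 : S.p (z j - w) ≤ Real.sqrt (2 * τ * (m + 1)) := by
      refine Real.le_sqrt_of_sq_le ?_
      rw [div_le_iff₀ (by positivity)] at h1
      linarith
    calc S.p (z j) = S.p (w + (z j - w)) := by rw [add_sub_cancel]
      _ ≤ S.p w + S.p (z j - w) := map_add_le_add _ _ _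
      _ ≤ _ := by gcongr
  obtain ⟨z', φ, hφ, hz'⟩ := S.exists_tendsto_subseq hcauchy hpb
  refine ⟨z', fun y => le_trans ?_ (hmle y)⟩
  refine le_of_tendsto_of_tendsto ((hJc.tendsto z').comp hz')
    (g := fun i => m + 1 / (((φ i : ℕ) : ℝ) + 1)) ?_ (.of_forall fun i => (hz _).le)
  have := (tendsto_one_div_add_atTop_nhds_zero_nat (𝕜 := ℝ)).comp hφ.tendsto_atTop
  simpa using this.const_add m

/-- The functionals controlled by `p` are dense. -/
theorem exists_near_of_p [CompleteSpace V] (f : V) {η : ℝ} (hη : 0 < η) :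
    ∃ (g : V) (C : ℝ), ‖f - g‖ < η ∧ ∀ z, |inner ℝ g z| ≤ C * S.p z := by
  let W : Submodule ℝ V :=
    { carrier := {g | ∃ C, ∀ z, |inner ℝ g z| ≤ C * S.p z}
      zero_mem' := ⟨0, by simp⟩
      add_mem' := by
        rintro a b ⟨A, hA⟩ ⟨B, hB⟩
        refine ⟨A + B, fun z => ?_⟩
        rw [inner_add_left, add_mul]
        exact (abs_add_le _ _).trans (add_le_add (hA z) (hB z))
      smul_mem' := by
        rintro c a ⟨A, hA⟩
        refine ⟨|c| * A, fun z => ?_⟩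
        rw [real_inner_smul_left, abs_mul, mul_assoc]
        gcongr; exact hA z }
  have hW : Wᗮ = ⊥ := by
    rw [Submodule.eq_bot_iff]
    intro w hw
    obtain ⟨c, hc, hpc⟩ := S.exists_p_le
    by_contra hw0
    -- Hahn-Banach extends the functional with value `p w` at `w` to one dominated by `p`. It is
    -- represented by an element of `W`, hence vanishes at `w`, so `p w = 0`.
    let f₀ : V →ₗ.[ℝ] ℝ := LinearPMap.mkSpanSingleton w (S.p w) hw0
    obtain ⟨g, hg1, hg2⟩ := exists_extension_of_le_sublinear f₀ S.p
      (fun c hc x => by rw [map_smul_eq_mul, Real.norm_of_nonneg hc.le])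
      (fun x y => map_add_le_add _ _ _) (by
        rintro ⟨x, hx⟩
        obtain ⟨a, rfl⟩ := Submodule.mem_span_singleton.1 hx
        have h := LinearPMap.mkSpanSingleton'_apply w (S.p w)
          (fun c hc => by rw [(smul_eq_zero.1 hc).resolve_right hw0, map_zero, zero_smul]) a hx
        refine h.trans_le ?_
        rw [map_smul_eq_mul, smul_eq_mul]
        gcongr
        exact Real.le_norm_self a)
    have hgabs : ∀ z, |g z| ≤ S.p z := fun z => abs_le.2 ⟨by
      have := hg2 (-z)
      rw [map_neg, map_neg_eq_map] at this; linarith, hg2 z⟩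
    let G : V →L[ℝ] ℝ := g.mkContinuous c fun z => (hgabs z).trans (hpc z)
    let r := (InnerProductSpace.toDual ℝ V).symm G
    have hr : ∀ z, inner ℝ r z = g z := fun z => InnerProductSpace.toDual_symm_apply
    have h1 : inner ℝ r w = (0 : ℝ) := hw r ⟨1, fun z => by rw [hr, one_mul]; exact hgabs z⟩
    have h2 : g w = S.p w := by
      have h3 := hg1 ⟨w, Submodule.mem_span_singleton_self w⟩
      have h4 := LinearPMap.mkSpanSingleton_apply ℝ ℝ (σ := RingHom.id ℝ) hw0 (S.p w)
      exact h3.trans h4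
    rw [hr, h2] at h1
    exact hw0 (S.eq_zero_of_p _ h1)
  have hdense : f ∈ closure (W : Set V) := by
    have := (Submodule.topologicalClosure_eq_top_iff (K := W)).2 hW
    rw [← Submodule.topologicalClosure_coe, this]; trivial
  obtain ⟨g, ⟨C, hC⟩, hg⟩ := Metric.mem_closure_iff.1 hdense η hη
  exact ⟨g, C, by rwa [← dist_eq_norm], hC⟩

/-- The states at which the evolution law can be satisfied are dense. -/
theorem exists_rel_near [CompleteSpace V] [CompleteSpace F] (x₀ : F) {ε : ℝ} (hε : 0 < ε) :
    ∃ w v, ‖S.D w‖ < ε ∧ S.Rel (x₀ + S.D w) v := by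
  obtain ⟨c, hc, hn⟩ := S.exists_norm_le
  set R := c * (2 * ‖x₀‖ + ‖x₀‖) + 1 with hR
  have hR0 : 0 < R := by positivity
  -- `R` bounds the norm of the step chosen below, so replacing `D^* x₀` by `g` costs at most `ε ^ 2
  -- / 4` in the pairing with it.
  obtain ⟨g, C, hg, hC⟩ := S.exists_near_of_p (ContinuousLinearMap.adjoint S.D x₀)
    (show 0 < ε ^ 2 / (4 * R) by positivity)
  have hsmall : ∃ l, 0 < l ∧ l ≤ 1 ∧ 4 * |C| * (l * ‖x₀‖) < ε ^ 2 := by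
    set M := 4 * |C| * ‖x₀‖ + 1
    have hM : 0 < M := by positivity
    refine ⟨min 1 (ε ^ 2 / (2 * M)), by positivity, min_le_left _ _, ?_⟩
    have h1 : min 1 (ε ^ 2 / (2 * M)) * (2 * M) ≤ ε ^ 2 := by
      rw [← le_div_iff₀ (by positivity)]; exact min_le_right _ _
    have h2 : 0 < min 1 (ε ^ 2 / (2 * M)) := by positivity
    have h3 : 0 < ε ^ 2 := by positivity
    nlinarith
  obtain ⟨l, hl, hl1, hls⟩ := hsmall
  -- Comparison of the minimizer with `0` gives `p w ≤ l * ‖x₀‖` and `‖D w‖ ^ 2 ≤ -2 ⟪D^* x₀, w⟫`.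
  -- The pairing is small since `g` is controlled by `p`.
  obtain ⟨w, hw⟩ := S.exists_isStep x₀ (show 0 < l ^ 2 by positivity) 0
  refine ⟨w, _, ?_, hw.rel (by positivity)⟩
  have h0 := hw 0
  simp only [sub_zero, map_zero, add_zero, ne_eq, OfNat.ofNat_ne_zero, not_false_eq_true,
    zero_pow, zero_div] at h0
  have hp2 : S.p w ^ 2 ≤ (l * ‖x₀‖) ^ 2 := by
    have : S.p w ^ 2 / (2 * l ^ 2) ≤ ‖x₀‖ ^ 2 / 2 := by nlinarith [sq_nonneg ‖x₀ + S.D w‖]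
    rw [div_le_iff₀ (by positivity)] at this
    nlinarith
  have hp : S.p w ≤ l * ‖x₀‖ := le_of_sq_le_sq hp2 (by positivity)
  have hxw : ‖x₀ + S.D w‖ ^ 2 ≤ ‖x₀‖ ^ 2 := by
    have : 0 ≤ S.p w ^ 2 / (2 * l ^ 2) := by positivity
    linarith
  have hxw' : ‖x₀ + S.D w‖ ≤ ‖x₀‖ := le_of_sq_le_sq hxw (norm_nonneg _)
  have hDw : ‖S.D w‖ ≤ 2 * ‖x₀‖ := by
    calc ‖S.D w‖ = ‖(x₀ + S.D w) - x₀‖ := by rw [add_sub_cancel_left]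
      _ ≤ _ := (norm_sub_le _ _).trans (by linarith)
  have hwR : ‖w‖ ≤ R := by
    refine (hn w).trans ?_
    have : S.p w ≤ ‖x₀‖ := hp.trans (by nlinarith [norm_nonneg x₀])
    have : c * (‖S.D w‖ + S.p w) ≤ c * (2 * ‖x₀‖ + ‖x₀‖) := by gcongr
    linarith
  rw [@norm_add_sq_real] at hxw
  have h1 : inner ℝ x₀ (S.D w) = inner ℝ g w + inner ℝ (ContinuousLinearMap.adjoint S.D x₀ - g) w := by
    rw [inner_sub_left, ContinuousLinearMap.adjoint_inner_left]; ring
  have h2 := (abs_le.1 (hC w)).1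
  have h3 : C * S.p w ≤ |C| * (l * ‖x₀‖) := by
    gcongr; exact le_abs_self C
  have h4 := (abs_le.1 (abs_real_inner_le_norm (ContinuousLinearMap.adjoint S.D x₀ - g) w)).1
  have h5 : ‖ContinuousLinearMap.adjoint S.D x₀ - g‖ * ‖w‖ ≤ ε ^ 2 / (4 * R) * R := by
    gcongr
  have h6 : ε ^ 2 / (4 * R) * R = ε ^ 2 / 4 := by field_simp
  refine lt_of_pow_lt_pow_left₀ 2 hε.le ?_
  nlinarith

end Setting
end L1Flow

/-! ### Piecewise constant and piecewise affine functions of time; a Gronwall-type estimate for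
absolutely continuous curves. -/

namespace L1Flow

theorem stronglyMeasurable_comp_floor {E : Type*} [NormedAddCommGroup E] (τ : ℝ) (g : ℕ → E) :
    StronglyMeasurable fun t : ℝ => g ⌊t / τ⌋₊ :=
  (StronglyMeasurable.of_discrete (f := g)).comp_measurable
    (Nat.measurable_floor.comp (measurable_id.div_const τ))

theorem exists_norm_comp_floor_le {E : Type*} [NormedAddCommGroup E] {τ : ℝ} (hτ : 0 < τ) (g : ℕ → E) (T : ℝ) :
    ∃ B, ∀ t ≤ T, ‖g ⌊t / τ⌋₊‖ ≤ B := by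
  obtain ⟨B, hB⟩ := ((Finset.range (⌊T / τ⌋₊ + 1)).image fun n => ‖g n‖).bddAbove
  refine ⟨B, fun t ht => hB ?_⟩
  simp only [Finset.coe_image, mem_image, Finset.coe_range, mem_Iio]
  exact ⟨_, Nat.lt_succ_of_le (Nat.floor_le_floor (by gcongr)), rfl⟩

theorem intervalIntegrable_comp_floor {E : Type*} [NormedAddCommGroup E] {τ : ℝ} (hτ : 0 < τ) (g : ℕ → E) (a b : ℝ) :
    IntervalIntegrable (fun t : ℝ => g ⌊t / τ⌋₊) volume a b := by
  obtain ⟨B, hB⟩ := exists_norm_comp_floor_le hτ g (max a b)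
  rw [intervalIntegrable_iff]
  refine Measure.integrableOn_of_bounded (by simp [uIoc])
    (stronglyMeasurable_comp_floor τ g).aestronglyMeasurable (M := B) ?_
  filter_upwards [ae_restrict_mem measurableSet_uIoc] with t ht
  exact hB t ht.2

section Interpolation

variable {E : Type*} [NormedAddCommGroup E] [NormedSpace ℝ E]

/-- The velocity of the affine interpolant with step `τ` of a sequence. -/
noncomputable def rate (τ : ℝ) (w : ℕ → E) (t : ℝ) : E :=
  τ⁻¹ • (w (⌊t / τ⌋₊ + 1) - w ⌊t / τ⌋₊)

/-- The affine interpolant with step `τ` of a sequence. -/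
noncomputable def affineInterp (τ : ℝ) (w : ℕ → E) (t : ℝ) : E :=
  w ⌊t / τ⌋₊ + (t / τ - (⌊t / τ⌋₊ : ℝ)) • (w (⌊t / τ⌋₊ + 1) - w ⌊t / τ⌋₊)

theorem stronglyMeasurable_rate (τ : ℝ) (w : ℕ → E) : StronglyMeasurable (rate τ w) :=
  stronglyMeasurable_comp_floor τ fun n => τ⁻¹ • (w (n + 1) - w n)

theorem intervalIntegrable_rate {τ : ℝ} (hτ : 0 < τ) (w : ℕ → E) (a b : ℝ) :
    IntervalIntegrable (rate τ w) volume a b :=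
  intervalIntegrable_comp_floor hτ (fun n => τ⁻¹ • (w (n + 1) - w n)) a b

theorem floor_div_eq {τ t : ℝ} (hτ : 0 < τ) {n : ℕ} (h1 : n * τ ≤ t) (h2 : t < (n + 1) * τ) :
    ⌊t / τ⌋₊ = n := by
  rw [Nat.floor_eq_iff (div_nonneg (le_trans (by positivity) h1) hτ.le), le_div_iff₀ hτ,
    div_lt_iff₀ hτ]
  exact ⟨h1, h2⟩

theorem floor_mul_le {τ t : ℝ} (hτ : 0 < τ) (ht : 0 ≤ t) : ⌊t / τ⌋₊ * τ ≤ t := by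
  rw [← le_div_iff₀ hτ]; exact Nat.floor_le (by positivity)

theorem lt_floor_add_one_mul {τ t : ℝ} (hτ : 0 < τ) : t < (⌊t / τ⌋₊ + 1) * τ := by
  rw [← div_lt_iff₀ hτ]; exact Nat.lt_floor_add_one _

theorem integral_rate_of_mem [CompleteSpace E] {τ : ℝ} (hτ : 0 < τ) (w : ℕ → E) (n : ℕ) {t : ℝ}
    (h1 : n * τ ≤ t) (h2 : t ≤ (n + 1) * τ) :
    ∫ r in (n * τ)..t, rate τ w r = ((t - n * τ) * τ⁻¹) • (w (n + 1) - w n) := by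
  have : EqOn (rate τ w) (fun _ => τ⁻¹ • (w (n + 1) - w n)) (Ioo (n * τ) t) := by
    intro r hr
    simp only [rate]
    rw [floor_div_eq hτ hr.1.le (hr.2.trans_le h2)]
  rw [intervalIntegral.integral_congr_Ioo_of_le h1 this, intervalIntegral.integral_const, mul_smul]

theorem integral_rate_zero [CompleteSpace E] {τ : ℝ} (hτ : 0 < τ) (w : ℕ → E) {t : ℝ} (ht : 0 ≤ t) :
    ∫ r in (0 : ℝ)..t, rate τ w r = affineInterp τ w t - w 0 := by
  have node : ∀ n : ℕ, ∫ r in (0 : ℝ)..(n * τ), rate τ w r = w n - w 0 := by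
    intro n
    induction n with
    | zero => simp
    | succ n ih =>
      rw [← intervalIntegral.integral_add_adjacent_intervals
        (intervalIntegrable_rate hτ w 0 (n * τ)) (intervalIntegrable_rate hτ w _ _), ih,
        integral_rate_of_mem hτ w n (by push_cast; nlinarith) (by push_cast; exact le_rfl)]
      have : (((n + 1 : ℕ) : ℝ) * τ - n * τ) * τ⁻¹ = 1 := by
        push_cast; field_simp; ring
      rw [this, one_smul]; abel
  rw [← intervalIntegral.integral_add_adjacent_intervals
        (intervalIntegrable_rate hτ w 0 (⌊t / τ⌋₊ * τ)) (intervalIntegrable_rate hτ w _ _), node,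
        integral_rate_of_mem hτ w _ (floor_mul_le hτ ht) (lt_floor_add_one_mul hτ).le]
  have : (t - ⌊t / τ⌋₊ * τ) * τ⁻¹ = t / τ - ⌊t / τ⌋₊ := by field_simp
  rw [this, affineInterp]; abel

theorem affineInterp_sub [CompleteSpace E] {τ : ℝ} (hτ : 0 < τ) (w : ℕ → E) {s t : ℝ} (hs : 0 ≤ s) (ht : 0 ≤ t) :
    affineInterp τ w t - affineInterp τ w s = ∫ r in s..t, rate τ w r := by
  have h := intervalIntegral.integral_interval_sub_left
    (intervalIntegrable_rate hτ w 0 t) (intervalIntegrable_rate hτ w 0 s)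
  rw [integral_rate_zero hτ w hs, integral_rate_zero hτ w ht] at h
  rw [← h]; abel

theorem continuousOn_affineInterp [CompleteSpace E] {τ : ℝ} (hτ : 0 < τ) (w : ℕ → E) :
    ContinuousOn (affineInterp τ w) (Ici 0) := by
  have hc : Continuous fun t => (∫ r in (0 : ℝ)..t, rate τ w r) + w 0 :=
    (intervalIntegral.continuous_primitive (fun a b => intervalIntegrable_rate hτ w a b) 0).add_const _
  refine hc.continuousOn.congr fun t ht => ?_
  simp only
  rw [integral_rate_zero hτ w ht]; abel

@[simp] theorem affineInterp_zero (τ : ℝ) (w : ℕ → E) : affineInterp τ w 0 = w 0 := by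
  simp [affineInterp]

variable {E' : Type*} [NormedAddCommGroup E'] [NormedSpace ℝ E']

theorem map_affineInterp (L : E →L[ℝ] E') (τ : ℝ) (w : ℕ → E) (t : ℝ) :
    L (affineInterp τ w t) = affineInterp τ (fun n => L (w n)) t := by
  simp [affineInterp]

theorem map_rate (L : E →L[ℝ] E') (τ : ℝ) (w : ℕ → E) (t : ℝ) :
    L (rate τ w t) = rate τ (fun n => L (w n)) t := by
  simp [rate]

/-- Two interpolants with the same step are as close as the sequences. -/
theorem norm_affineInterp_sub_le {τ : ℝ} (hτ : 0 < τ) {w w' : ℕ → E} {B : ℝ}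
    (h : ∀ n, ‖w n - w' n‖ ≤ B) {t : ℝ} (ht : 0 ≤ t) :
    ‖affineInterp τ w t - affineInterp τ w' t‖ ≤ B := by
  set n := ⌊t / τ⌋₊
  set θ := t / τ - (n : ℝ) with hθ
  have h0 : 0 ≤ θ := sub_nonneg.2 (Nat.floor_le (by positivity))
  have h1 : θ ≤ 1 := by
    have := Nat.lt_floor_add_one (t / τ)
    rw [hθ]; linarith
  have e : affineInterp τ w t - affineInterp τ w' t
      = (1 - θ) • (w n - w' n) + θ • (w (n + 1) - w' (n + 1)) := by
    simp only [affineInterp]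
    module
  rw [e]
  refine (norm_add_le _ _).trans ?_
  rw [norm_smul, norm_smul, Real.norm_of_nonneg h0, Real.norm_of_nonneg (by linarith)]
  nlinarith [h n, h (n + 1)]

end Interpolation

section Energy

variable {E : Type*} [NormedAddCommGroup E] [InnerProductSpace ℝ E] [CompleteSpace E]

/-- A Hilbert space valued curve with derivative `g` satisfying `⟪w, g⟫ ≤ β` has
`‖w t‖² ≤ ‖w s‖² + 2 β (t - s)`. -/
theorem norm_sq_le_of_inner_deriv_le {w g : ℝ → E} {s t β : ℝ} (hst : s ≤ t)
    (hg : IntervalIntegrable g volume s t)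
    (hw : ∀ a b, s ≤ a → a ≤ b → b ≤ t → w b - w a = ∫ r in a..b, g r)
    (hle : ∀ᵐ r ∂(volume.restrict (Icc s t)), inner ℝ (w r) (g r) ≤ β) :
    ‖w t‖ ^ 2 ≤ ‖w s‖ ^ 2 + 2 * β * (t - s) := by
  have hcont : ContinuousOn w (Icc s t) := by
    have h1 := intervalIntegral.continuousOn_primitive_interval (μ := volume) (f := g)
      (a := s) (b := t) (by rw [uIcc_of_le hst]; exact (intervalIntegrable_iff_integrableOn_Icc_of_le hst).1 hg)
    rw [uIcc_of_le hst] at h1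
    refine (h1.const_add (w s)).congr fun r hr => ?_
    simp only [← hw s r le_rfl hr.1 hr.2]; abel
  have hunif := isCompact_Icc.uniformContinuousOn_of_continuous hcont
  set I := ∫ r in s..t, ‖g r‖ with hI
  have hI0 : 0 ≤ I := intervalIntegral.integral_nonneg hst fun _ _ => norm_nonneg _
  refine le_of_forall_pos_le_add fun ε hε => ?_
  -- On a fine partition `w` is replaced by its value at the right endpoint of each interval;
  -- weighted by `‖g‖`, the total error is at most `ε`.
  obtain ⟨δ, hδ, hδw⟩ := Metric.uniformContinuousOn_iff.1 hunif (ε / (2 * (I + 1))) (by positivity)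
  obtain ⟨N, hN⟩ := exists_nat_gt ((t - s) / δ)
  have hN0 : 0 < (N : ℝ) := lt_of_le_of_lt (div_nonneg (by linarith) hδ.le) hN
  set a : ℕ → ℝ := fun i => s + i * ((t - s) / N) with ha
  have hstep : 0 ≤ (t - s) / N := div_nonneg (by linarith) hN0.le
  have hstepδ : (t - s) / N < δ := by
    rw [div_lt_iff₀ hN0]; rw [div_lt_iff₀ hδ] at hN; linarith
  have ha0 : a 0 = s := by simp [ha]
  have haN : a N = t := by simp only [ha]; field_simp; ring
  have hasucc : ∀ i, a (i + 1) = a i + (t - s) / N := fun i => by simp only [ha]; push_cast; ring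
  have hale : ∀ i, a i ≤ a (i + 1) := fun i => by rw [hasucc]; linarith
  have hsa : ∀ i, s ≤ a i := fun i => by simp only [ha]; nlinarith [(Nat.cast_nonneg i : (0:ℝ) ≤ i)]
  have hat : ∀ i ≤ N, a i ≤ t := fun i hi => by
    rw [← haN]; simp only [ha]
    have : (i : ℝ) ≤ N := by exact_mod_cast hi
    nlinarith
  have hgi : ∀ i < N, IntervalIntegrable g volume (a i) (a (i + 1)) := fun i hi =>
    hg.mono_set (by
      rw [uIcc_of_le (hale i), uIcc_of_le hst]
      exact Icc_subset_Icc (hsa i) (hat _ hi))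
  have piece : ∀ i < N, ‖w (a (i + 1))‖ ^ 2 - ‖w (a i)‖ ^ 2
      ≤ ∫ r in (a i)..(a (i + 1)), (2 * β + ε / (I + 1) * ‖g r‖) := by
    intro i hi
    -- Convexity of the squared norm at the right endpoint replaces the chain rule.
    have h1 : ‖w (a (i + 1))‖ ^ 2 - ‖w (a i)‖ ^ 2
        ≤ 2 * inner ℝ (w (a (i + 1))) (w (a (i + 1)) - w (a i)) := by
      rw [inner_sub_right, real_inner_self_eq_norm_sq]
      nlinarith [abs_real_inner_le_norm (w (a (i + 1))) (w (a i)), le_abs_self (inner ℝ (w (a (i + 1))) (w (a i))),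
        sq_nonneg (‖w (a (i + 1))‖ - ‖w (a i)‖)]
    refine h1.trans ?_
    rw [hw _ _ (hsa i) (hale i) (hat _ hi)]
    have h2 : inner ℝ (w (a (i + 1))) (∫ r in (a i)..(a (i + 1)), g r)
        = ∫ r in (a i)..(a (i + 1)), inner ℝ (w (a (i + 1))) (g r) := by
      exact ((innerSL ℝ (w (a (i + 1)))).intervalIntegral_comp_comm (hgi i hi)).symm
    rw [h2, ← intervalIntegral.integral_const_mul]
    refine intervalIntegral.integral_mono_ae_restrict (hale i) ?_ ?_ ?_
    · exact (ContinuousLinearMap.integrable_comp (innerSL ℝ (w (a (i + 1)))) (hgi i hi).1 |>.const_mul 2 |> fun h =>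
        (intervalIntegrable_iff_integrableOn_Ioc_of_le (hale i)).2 h)
    · exact intervalIntegrable_const.add ((hgi i hi).norm.const_mul _)
    · have hsub : Icc (a i) (a (i + 1)) ⊆ Icc s t := Icc_subset_Icc (hsa i) (hat _ hi)
      filter_upwards [ae_restrict_of_ae_restrict_of_subset hsub hle,
        ae_restrict_mem measurableSet_Icc] with r hr hrm
      have h3 : inner ℝ (w (a (i + 1))) (g r)
          = inner ℝ (w r) (g r) + inner ℝ (w (a (i + 1)) - w r) (g r) := by
        rw [inner_sub_left]; ring
      have h4 : ‖w (a (i + 1)) - w r‖ ≤ ε / (2 * (I + 1)) := by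
        rw [← dist_eq_norm]
        refine (hδw _ ⟨hsa _, hat _ hi⟩ _ (hsub hrm) ?_).le
        rw [Real.dist_eq, abs_of_nonneg (by linarith [hrm.2])]
        have := hasucc i
        linarith [hrm.1]
      have h5 : inner ℝ (w (a (i + 1)) - w r) (g r) ≤ ε / (2 * (I + 1)) * ‖g r‖ :=
        (real_inner_le_norm _ _).trans (by gcongr)
      have h6 : ε / (I + 1) = 2 * (ε / (2 * (I + 1))) := by field_simp
      rw [h6, h3]
      linarith
  have hsum : ‖w t‖ ^ 2 - ‖w s‖ ^ 2 ≤ ∫ r in s..t, (2 * β + ε / (I + 1) * ‖g r‖) := by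
    have h1 := intervalIntegral.sum_integral_adjacent_intervals (a := a) (n := N) (μ := volume)
      (f := fun r => 2 * β + ε / (I + 1) * ‖g r‖)
      (fun i hi => intervalIntegrable_const.add ((hgi i hi).norm.const_mul _))
    rw [ha0, haN] at h1
    rw [← h1, ← ha0, ← haN, ← Finset.sum_range_sub (fun i => ‖w (a i)‖ ^ 2)]
    exact Finset.sum_le_sum fun i hi => piece i (Finset.mem_range.1 hi)
  rw [intervalIntegral.integral_add intervalIntegrable_const (hg.norm.const_mul _),
    intervalIntegral.integral_const, intervalIntegral.integral_const_mul, ← hI, smul_eq_mul] at hsum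
  have : ε / (I + 1) * I ≤ ε := by
    rw [div_mul_eq_mul_div, div_le_iff₀ (by positivity)]; nlinarith
  linarith

end Energy

/-- A function whose integrals over all intervals in `(0, ∞)` vanish is zero a.e. -/
theorem ae_eq_zero_of_forall_integral_eq_zero {E : Type*} [NormedAddCommGroup E] [NormedSpace ℝ E]
    [CompleteSpace E] {g : ℝ → E}
    (hg : ∀ s t : ℝ, 0 < s → s ≤ t → IntervalIntegrable g volume s t ∧ ∫ r in s..t, g r = 0) :
    ∀ᵐ t ∂(volume.restrict (Ioi (0 : ℝ))), g t = 0 := by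
  have key : ∀ n : ℕ, ∀ᵐ t, t ∈ Ioo (1 / ((n : ℝ) + 1)) (n + 1) → g t = 0 := by
    intro n
    have hpos : 0 < 1 / ((n : ℝ) + 1) := by positivity
    have hle : 1 / ((n : ℝ) + 1) ≤ n + 1 := by
      rw [div_le_iff₀ (by positivity)]
      nlinarith [(Nat.cast_nonneg n : (0 : ℝ) ≤ n)]
    filter_upwards [(hg _ _ hpos hle).1.ae_hasDerivAt_integral] with t ht hmem
    -- Lebesgue differentiation of a primitive that vanishes identically on the window.
    have h1 := ht (by rw [uIcc_of_le hle]; exact Ioo_subset_Icc_self hmem) (1 / ((n : ℝ) + 1))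
      (by simp)
    have h2 : (fun x => ∫ r in (1 / ((n : ℝ) + 1))..x, g r) =ᶠ[𝓝 t] fun _ => 0 := by
      filter_upwards [Ioo_mem_nhds hmem.1 hmem.2] with x hx
      exact (hg _ _ hpos hx.1.le).2
    exact h1.unique ((hasDerivAt_const t (0 : E)).congr_of_eventuallyEq h2)
  rw [ae_restrict_iff' measurableSet_Ioi]
  filter_upwards [ae_all_iff.2 key] with t ht h0
  obtain ⟨n, hn⟩ := exists_nat_gt (max t (1 / t))
  have h0' : (0 : ℝ) < t := h0
  refine ht n ⟨?_, by linarith [le_max_left t (1 / t)]⟩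
  have := (le_max_right t (1 / t)).trans_lt hn
  rw [div_lt_iff₀ h0'] at this
  rw [div_lt_iff₀ (by positivity)]
  nlinarith

end L1Flow

/-! ### A priori estimates for the implicit Euler scheme. -/

namespace L1Flow
namespace Setting

variable {V F : Type*} [NormedAddCommGroup V] [InnerProductSpace ℝ V]
  [NormedAddCommGroup F] [InnerProductSpace ℝ F] (S : Setting V F)

/-- The implicit Euler scheme with step `τ`. -/
def IsScheme (x₀ : F) (τ : ℝ) (w : ℕ → V) : Prop :=
  ∀ n, S.Rel (x₀ + S.D (w (n + 1))) (τ⁻¹ • (w (n + 1) - w n))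

theorem exists_isScheme [CompleteSpace V] [CompleteSpace F] (x₀ : F) {τ : ℝ} (hτ : 0 < τ) (a : V) :
    ∃ w : ℕ → V, w 0 = a ∧ ∀ n, S.IsStep x₀ τ (w n) (w (n + 1)) := by
  choose f hf using fun w => S.exists_isStep x₀ hτ w
  exact ⟨fun n => f^[n] a, rfl, fun n => by
    simp only [Function.iterate_succ_apply']
    exact hf _⟩

namespace IsScheme

variable {S} {x₀ : F} {τ : ℝ} {w : ℕ → V}

/-- The two states differ by `τ` times the gradient `y` of the discrete velocity, so dissipativity
reads `‖y‖ ^ 2 ≤ ⟪y, D v⟫`. -/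
theorem D_vel_norm_le_of_rel (hτ : 0 < τ) (h : S.IsScheme x₀ τ w) {n : ℕ} {v : V}
    (hv : S.Rel (x₀ + S.D (w n)) v) : ‖S.D (τ⁻¹ • (w (n + 1) - w n))‖ ≤ ‖S.D v‖ := by
  have h1 := (h n).inner_sub_le hv
  set y := S.D (τ⁻¹ • (w (n + 1) - w n)) with hy
  have e : x₀ + S.D (w (n + 1)) - (x₀ + S.D (w n)) = τ • y := by
    rw [hy, map_smul, smul_inv_smul₀ hτ.ne', map_sub]; abel
  rw [e, real_inner_smul_left, inner_sub_right, real_inner_self_eq_norm_sq] at h1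
  have h2 : ‖y‖ ^ 2 ≤ inner ℝ y (S.D v) := by
    by_contra! hcon
    nlinarith
  have h3 := h2.trans (real_inner_le_norm y (S.D v))
  rcases (norm_nonneg y).eq_or_lt with h0 | h0
  · rw [← h0]; exact norm_nonneg _
  · nlinarith

theorem D_vel_norm_antitone (hτ : 0 < τ) (h : S.IsScheme x₀ τ w) :
    Antitone fun n => ‖S.D (τ⁻¹ • (w (n + 1) - w n))‖ :=
  antitone_nat_of_succ_le fun n => h.D_vel_norm_le_of_rel hτ (h n)

/-- The subgradient inequality `Rel.sub_le_inner` between consecutive states. Thus `p v ^ 2 / 2` is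
a second Lyapunov function, whose dissipation is the squared speed. -/
theorem energy_le (hτ : 0 < τ) (h : S.IsScheme x₀ τ w) (n : ℕ) :
    S.p (τ⁻¹ • (w (n + 2) - w (n + 1))) ^ 2 / 2
      + τ * ‖S.D (τ⁻¹ • (w (n + 2) - w (n + 1)))‖ ^ 2
      ≤ S.p (τ⁻¹ • (w (n + 1) - w n)) ^ 2 / 2 := by
  have h1 := (h (n + 1)).sub_le_inner (h n)
  set y := S.D (τ⁻¹ • (w (n + 1 + 1) - w (n + 1))) with hy
  have e : x₀ + S.D (w (n + 1)) - (x₀ + S.D (w (n + 1 + 1))) = - (τ • y) := by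
    rw [hy, map_smul, smul_inv_smul₀ hτ.ne', map_sub]; abel
  rw [e, inner_neg_right, inner_smul_right, real_inner_self_eq_norm_sq] at h1
  linarith

theorem energy_add_le (hτ : 0 < τ) (h : S.IsScheme x₀ τ w) (n k : ℕ) :
    S.p (τ⁻¹ • (w (n + k + 1) - w (n + k))) ^ 2 / 2
      + k * τ * ‖S.D (τ⁻¹ • (w (n + k + 1) - w (n + k)))‖ ^ 2
      ≤ S.p (τ⁻¹ • (w (n + 1) - w n)) ^ 2 / 2 := by
  induction k with
  | zero => simp
  | succ k ih =>
    have h1 := h.energy_le hτ (n + k)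
    have h2 := h.D_vel_norm_antitone hτ (Nat.le_succ (n + k))
    simp only at h2
    have h3 : ‖S.D (τ⁻¹ • (w (n + k + 2) - w (n + k + 1)))‖ ^ 2
        ≤ ‖S.D (τ⁻¹ • (w (n + k + 1) - w (n + k)))‖ ^ 2 := by gcongr
    have h4 : k * τ * ‖S.D (τ⁻¹ • (w (n + k + 2) - w (n + k + 1)))‖ ^ 2
        ≤ k * τ * ‖S.D (τ⁻¹ • (w (n + k + 1) - w (n + k)))‖ ^ 2 := by gcongr
    have e : n + (k + 1) = n + k + 1 := by ring
    rw [e]; push_cast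
    have e2 : n + k + 1 + 1 = n + k + 2 := by ring
    rw [e2]
    linarith

/-- The drop of `p v ^ 2 / 2` over `k` steps is at least the left side, by summed dissipation, and
at most the right side, by the subgradient inequality. -/
theorem inner_D_vel_ge (hτ : 0 < τ) (h : S.IsScheme x₀ τ w) (n k : ℕ) :
    k * τ * ‖S.D (τ⁻¹ • (w (n + k + 1) - w (n + k)))‖ ^ 2
      ≤ inner ℝ (S.D (τ⁻¹ • (w (n + 1) - w n))) (S.D (w (n + k + 1)) - S.D (w (n + 1))) := by
  have h1 := h.energy_add_le hτ n k
  have h2 := (h n).sub_le_inner (h (n + k))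
  rw [add_sub_add_left_eq_sub] at h2
  linarith

theorem state_le (hτ : 0 < τ) (h : S.IsScheme x₀ τ w) (n : ℕ) :
    ‖x₀ + S.D (w (n + 1))‖ ^ 2 + 2 * τ * S.p (τ⁻¹ • (w (n + 1) - w n)) ^ 2
      ≤ ‖x₀ + S.D (w n)‖ ^ 2 := by
  have h1 := (h n).inner_eq
  set y := S.D (τ⁻¹ • (w (n + 1) - w n)) with hy
  have e : x₀ + S.D (w n) = (x₀ + S.D (w (n + 1))) - τ • y := by
    rw [hy, map_smul, smul_inv_smul₀ hτ.ne', map_sub]; abel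
  rw [e, @norm_sub_sq_real, inner_smul_right, h1]
  nlinarith [sq_nonneg ‖τ • y‖]

theorem p_vel_sq_le (hτ : 0 < τ) (h : S.IsScheme x₀ τ w) (n : ℕ) :
    ‖x₀ + S.D (w (n + 1))‖ ^ 2 + 2 * τ * (n + 1) * S.p (τ⁻¹ • (w (n + 1) - w n)) ^ 2
      ≤ ‖x₀ + S.D (w 0)‖ ^ 2 := by
  induction n with
  | zero => simpa using h.state_le hτ 0
  | succ n ih =>
    have h1 := h.state_le hτ (n + 1)
    have h2 := h.energy_le hτ n
    have h3 : S.p (τ⁻¹ • (w (n + 2) - w (n + 1))) ^ 2 ≤ S.p (τ⁻¹ • (w (n + 1) - w n)) ^ 2 := by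
      have : 0 ≤ τ * ‖S.D (τ⁻¹ • (w (n + 2) - w (n + 1)))‖ ^ 2 := by positivity
      linarith
    have h4 : 2 * τ * (n + 1) * S.p (τ⁻¹ • (w (n + 2) - w (n + 1))) ^ 2
        ≤ 2 * τ * (n + 1) * S.p (τ⁻¹ • (w (n + 1) - w n)) ^ 2 := by gcongr
    push_cast
    have e2 : n + 1 + 1 = n + 2 := by ring
    rw [e2] at h1 ⊢
    linarith

/-- Regularization in two stages: the energy controls `p v ^ 2` after the first half of the steps,
and this controls `‖D v‖ ^ 2` after the second half. -/
theorem D_vel_sq_le (hτ : 0 < τ) (h : S.IsScheme x₀ τ w) (n : ℕ) :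
    n * (n + 1) * τ ^ 2 * ‖S.D (τ⁻¹ • (w (n + 1) - w n))‖ ^ 2 ≤ ‖x₀ + S.D (w 0)‖ ^ 2 := by
  obtain ⟨m, k, hn, hk, hm⟩ : ∃ m k : ℕ, n = m + k ∧ n ≤ 2 * k ∧ n + 1 ≤ 2 * (m + 1) :=
    ⟨n / 2, n - n / 2, by omega, by omega, by omega⟩
  have h1 := h.energy_add_le hτ m k
  have h2 := h.p_vel_sq_le hτ m
  rw [hn]
  set Y := ‖S.D (τ⁻¹ • (w (m + k + 1) - w (m + k)))‖ ^ 2 with hY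
  have hY0 : 0 ≤ Y := by positivity
  have h3 : k * τ * Y ≤ S.p (τ⁻¹ • (w (m + 1) - w m)) ^ 2 / 2 := by
    have : 0 ≤ S.p (τ⁻¹ • (w (m + k + 1) - w (m + k))) ^ 2 / 2 := by positivity
    linarith
  have h4 : 4 * τ * (m + 1) * (k * τ * Y) ≤ ‖x₀ + S.D (w 0)‖ ^ 2 := by
    have : 4 * τ * (m + 1) * (k * τ * Y)
        ≤ 4 * τ * (m + 1) * (S.p (τ⁻¹ • (w (m + 1) - w m)) ^ 2 / 2) := by gcongr
    nlinarith [sq_nonneg ‖x₀ + S.D (w (m + 1))‖]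
  have hk' : ((m + k : ℕ) : ℝ) ≤ 2 * k := by rw [← hn]; exact_mod_cast hk
  have hm' : ((m + k : ℕ) : ℝ) + 1 ≤ 2 * (m + 1) := by rw [← hn]; exact_mod_cast hm
  have h5 : ((m + k : ℕ) : ℝ) * (((m + k : ℕ) : ℝ) + 1) ≤ (2 * k) * (2 * (m + 1)) := by gcongr
  calc _ ≤ (2 * k) * (2 * (m + 1)) * τ ^ 2 * Y := by gcongr
    _ = 4 * τ * (m + 1) * (k * τ * Y) := by ring
    _ ≤ _ := h4

theorem norm_rate_le (hτ : 0 < τ) (h : S.IsScheme x₀ τ w) {t : ℝ} (ht : 0 < t) :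
    ‖S.D (rate τ w t)‖ ≤ 2 * ‖x₀ + S.D (w 0)‖ / t := by
  rw [le_div_iff₀ ht]
  have hlt := lt_floor_add_one_mul (t := t) hτ
  simp only [rate]
  set n := ⌊t / τ⌋₊
  set Y := ‖S.D (τ⁻¹ • (w (n + 1) - w n))‖ with hY
  have hY0 : 0 ≤ Y := norm_nonneg _
  -- During the first step `D_vel_sq_le` is empty; there `t < τ`, and the energy bound on both
  -- endpoints suffices. Afterwards `n + 1 ≤ 2 * n`.
  rcases Nat.eq_zero_or_pos n with h0 | hpos
  · have h1 := h.state_le hτ 0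
    have h2 : ‖x₀ + S.D (w 1)‖ ≤ ‖x₀ + S.D (w 0)‖ := by
      refine le_of_sq_le_sq ?_ (norm_nonneg _)
      have : 0 ≤ 2 * τ * S.p (τ⁻¹ • (w (0 + 1) - w 0)) ^ 2 := by positivity
      simp only [zero_add] at *
      linarith
    have h3 : τ * Y = ‖(x₀ + S.D (w 1)) - (x₀ + S.D (w 0))‖ := by
      rw [hY, h0, map_smul, norm_smul, norm_inv, Real.norm_of_nonneg hτ.le, zero_add, map_sub,
        add_sub_add_left_eq_sub]
      field_simp
    have h4 := norm_sub_le (x₀ + S.D (w 1)) (x₀ + S.D (w 0))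
    rw [h0] at hlt
    simp only [Nat.cast_zero, zero_add, one_mul] at hlt
    nlinarith
  · have h1 := h.D_vel_sq_le hτ n
    have hn : (1 : ℝ) ≤ n := by exact_mod_cast hpos
    refine le_of_sq_le_sq ?_ (by positivity)
    have h2 : t ^ 2 ≤ ((n + 1) * τ) ^ 2 := by gcongr
    have h3 : ((n : ℝ) + 1) * (n + 1) ≤ 2 * (n * (n + 1)) := by nlinarith
    calc (Y * t) ^ 2 = Y ^ 2 * t ^ 2 := by ring
      _ ≤ Y ^ 2 * ((n + 1) * τ) ^ 2 := by gcongr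
      _ = (((n : ℝ) + 1) * (n + 1)) * (τ ^ 2 * Y ^ 2) := by ring
      _ ≤ (2 * (n * (n + 1))) * (τ ^ 2 * Y ^ 2) := by gcongr
      _ = 2 * (n * (n + 1) * τ ^ 2 * Y ^ 2) := by ring
      _ ≤ 2 * ‖x₀ + S.D (w 0)‖ ^ 2 := by gcongr
      _ ≤ (2 * ‖x₀ + S.D (w 0)‖) ^ 2 := by nlinarith [sq_nonneg ‖x₀ + S.D (w 0)‖]

/-- Cauchy-Schwarz in time: the dissipated energy bounds the time integral of `p v ^ 2`. Near `t =
0` this replaces the bound on the velocity, which degenerates there. -/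
theorem p_affineInterp_sub_le (hτ : 0 < τ) (h : S.IsScheme x₀ τ w) {t : ℝ} (ht : 0 ≤ t) :
    S.p (affineInterp τ w t - w 0) ≤ ‖x₀ + S.D (w 0)‖ * Real.sqrt t := by
  -- The inductive form of Cauchy-Schwarz: `s` is elapsed time, `Q` accumulated dissipation, `a`
  -- distance travelled.
  have step : ∀ a s Q σ q : ℝ, 0 ≤ a → 0 ≤ s → 0 ≤ Q → 0 ≤ σ → 0 ≤ q → a ^ 2 ≤ s * Q →
      (a + σ * q) ^ 2 ≤ (s + σ) * (Q + σ * q ^ 2) := by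
    intro a s Q σ q ha hs hQ hσ hq h1
    have h2 : 2 * a * q ≤ Q + s * q ^ 2 := by
      refine le_of_sq_le_sq ?_ (by positivity)
      have : (2 * a * q) ^ 2 ≤ 4 * (s * Q) * q ^ 2 := by
        calc (2 * a * q) ^ 2 = 4 * a ^ 2 * q ^ 2 := by ring
          _ ≤ _ := by gcongr
      nlinarith [sq_nonneg (Q - s * q ^ 2)]
    nlinarith
  have hvel : ∀ n θ, 0 ≤ θ → S.p (w n + θ • (w (n + 1) - w n) - w 0)
      ≤ S.p (w n - w 0) + θ * τ * S.p (τ⁻¹ • (w (n + 1) - w n)) := by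
    intro n θ hθ
    have e : w n + θ • (w (n + 1) - w n) - w 0
        = (w n - w 0) + (θ * τ) • (τ⁻¹ • (w (n + 1) - w n)) := by
      rw [smul_smul, mul_assoc, mul_inv_cancel₀ hτ.ne', mul_one]; abel
    rw [e]
    refine (map_add_le_add _ _ _).trans ?_
    rw [map_smul_eq_mul S.p (θ * τ), Real.norm_of_nonneg (by positivity)]
  set A := fun n => (‖x₀ + S.D (w 0)‖ ^ 2 - ‖x₀ + S.D (w n)‖ ^ 2) / 2 with hA
  have hAstep : ∀ n, A n + τ * S.p (τ⁻¹ • (w (n + 1) - w n)) ^ 2 ≤ A (n + 1) := by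
    intro n
    have := h.state_le hτ n
    simp only [hA]; linarith
  have hA0 : ∀ n, 0 ≤ A n := by
    intro n
    induction n with
    | zero => simp [hA]
    | succ n ih =>
      have := hAstep n
      have : 0 ≤ τ * S.p (τ⁻¹ • (w (n + 1) - w n)) ^ 2 := by positivity
      linarith
  have node : ∀ n : ℕ, S.p (w n - w 0) ^ 2 ≤ n * τ * A n := by
    intro n
    induction n with
    | zero => simp [hA]
    | succ n ih =>
      have h1 := hvel n 1 zero_le_one
      rw [one_smul, add_sub_cancel, one_mul] at h1
      have h2 := step _ _ _ τ (S.p (τ⁻¹ • (w (n + 1) - w n))) (apply_nonneg _ _)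
        (by positivity) (hA0 n) hτ.le (apply_nonneg _ _) ih
      calc S.p (w (n + 1) - w 0) ^ 2
          ≤ (S.p (w n - w 0) + τ * S.p (τ⁻¹ • (w (n + 1) - w n))) ^ 2 := by gcongr
        _ ≤ _ := h2
        _ ≤ (n * τ + τ) * A (n + 1) := by gcongr; exact hAstep n
        _ = _ := by push_cast; ring
  set n := ⌊t / τ⌋₊ with hn
  set θ := t / τ - (n : ℝ) with hθ
  have h0 : 0 ≤ θ := sub_nonneg.2 (Nat.floor_le (by positivity))
  have h1 : θ ≤ 1 := by
    have := Nat.lt_floor_add_one (t / τ)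
    rw [hθ]; linarith
  have hθt : n * τ + θ * τ = t := by rw [hθ]; field_simp; ring
  have h2 := hvel n θ h0
  have h3 := step _ _ _ (θ * τ) (S.p (τ⁻¹ • (w (n + 1) - w n))) (apply_nonneg _ _)
    (by positivity) (hA0 n) (by positivity) (apply_nonneg _ _) (node n)
  have h4 : A n + θ * τ * S.p (τ⁻¹ • (w (n + 1) - w n)) ^ 2 ≤ ‖x₀ + S.D (w 0)‖ ^ 2 := by
    have h5 : θ * τ * S.p (τ⁻¹ • (w (n + 1) - w n)) ^ 2
        ≤ 1 * τ * S.p (τ⁻¹ • (w (n + 1) - w n)) ^ 2 := by gcongr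
    have h6 := hAstep n
    have h7 : A (n + 1) ≤ ‖x₀ + S.D (w 0)‖ ^ 2 := by
      simp only [hA]
      nlinarith [sq_nonneg ‖x₀ + S.D (w (n + 1))‖, sq_nonneg ‖x₀ + S.D (w 0)‖]
    linarith
  refine le_of_sq_le_sq ?_ (by positivity)
  rw [mul_pow, Real.sq_sqrt ht]
  calc S.p (affineInterp τ w t - w 0) ^ 2
      ≤ (S.p (w n - w 0) + θ * τ * S.p (τ⁻¹ • (w (n + 1) - w n))) ^ 2 := by
        gcongr; exact h2
    _ ≤ _ := h3
    _ ≤ t * ‖x₀ + S.D (w 0)‖ ^ 2 := by rw [hθt]; gcongr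
    _ = _ := by ring

/-- An implicit step of a dissipative relation is a contraction. -/
theorem norm_sub_le (hτ : 0 < τ) (h : S.IsScheme x₀ τ w) {w' : ℕ → V} (h' : S.IsScheme x₀ τ w')
    (n : ℕ) : ‖S.D (w n) - S.D (w' n)‖ ≤ ‖S.D (w 0) - S.D (w' 0)‖ := by
  induction n with
  | zero => exact le_rfl
  | succ n ih =>
    refine le_trans ?_ ih
    have h1 := (h n).inner_sub_le (h' n)
    set y := S.D (τ⁻¹ • (w (n + 1) - w n)) with hy
    set y' := S.D (τ⁻¹ • (w' (n + 1) - w' n)) with hy'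
    rw [add_sub_add_left_eq_sub] at h1
    have e : S.D (w n) - S.D (w' n) = (S.D (w (n + 1)) - S.D (w' (n + 1))) - τ • (y - y') := by
      rw [hy, hy', map_smul, map_smul, smul_sub, smul_inv_smul₀ hτ.ne', smul_inv_smul₀ hτ.ne',
        map_sub, map_sub]; abel
    refine le_of_sq_le_sq ?_ (norm_nonneg _)
    rw [e, norm_sub_sq_real _ (τ • (y - y')), inner_smul_right]
    nlinarith [sq_nonneg ‖τ • (y - y')‖]

/-- Contraction fixes the gradients; the discrete velocities are reduced, so their gradients
determine them. -/
theorem unique (hτ : 0 < τ) (h : S.IsScheme x₀ τ w) {w' : ℕ → V} (h' : S.IsScheme x₀ τ w')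
    (h0 : w 0 = w' 0) : w = w' := by
  have hD : ∀ n, S.D (w n) = S.D (w' n) := fun n => by
    have := h.norm_sub_le hτ h' n
    rw [h0, sub_self, norm_zero] at this
    exact sub_eq_zero.1 (norm_le_zero_iff.1 this)
  funext n
  induction n with
  | zero => exact h0
  | succ n ih =>
    have := (h n).isReduced.eq_of_D_eq (h' n).isReduced (by simp [hD])
    have h2 := smul_right_injective V (inv_ne_zero hτ.ne') this
    rw [ih] at h2
    exact sub_left_injective h2

theorem norm_rate_antitone (hτ : 0 < τ) (h : S.IsScheme x₀ τ w) {s t : ℝ} (hst : s ≤ t) :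
    ‖S.D (rate τ w t)‖ ≤ ‖S.D (rate τ w s)‖ :=
  h.D_vel_norm_antitone hτ (Nat.floor_le_floor (by gcongr))

/-- The analogue of `inner_D_vel_ge` for the interpolant at arbitrary times. -/
theorem inner_rate_ge (hτ : 0 < τ) (h : S.IsScheme x₀ τ w) {t r : ℝ} (ht : 0 ≤ t) (hr : 0 ≤ r) :
    r * ‖S.D (rate τ w (t + r))‖ ^ 2 ≤ inner ℝ (S.D (rate τ w t))
      (S.D (affineInterp τ w (t + r)) - S.D (affineInterp τ w t)) := by
  have hN : ⌊t / τ⌋₊ ≤ ⌊(t + r) / τ⌋₊ := Nat.floor_le_floor (by gcongr; linarith)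
  obtain ⟨k, hk⟩ := Nat.exists_eq_add_of_le hN
  simp only [rate, affineInterp]
  rw [hk]
  set n := ⌊t / τ⌋₊ with hn
  have hlt := lt_floor_add_one_mul (t := t) hτ
  rw [← hn] at hlt
  have hθ : 0 ≤ (t + r) / τ - ((n + k : ℕ) : ℝ) := by
    rw [← hk]; exact sub_nonneg.2 (Nat.floor_le (by positivity))
  have hθ1 : (t + r) / τ - ((n + k : ℕ) : ℝ) ≤ 1 := by
    rw [← hk]; have := Nat.lt_floor_add_one ((t + r) / τ); linarith
  set θ := (t + r) / τ - ((n + k : ℕ) : ℝ) with hθd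
  have hθt : ((n : ℝ) + k + θ) * τ = t + r := by rw [hθd]; push_cast; field_simp; ring
  have hvel : ∀ m, S.D (w (m + 1)) - S.D (w m) = τ • S.D (τ⁻¹ • (w (m + 1) - w m)) := fun m => by
    rw [map_smul, smul_inv_smul₀ hτ.ne', map_sub]
  set y := S.D (τ⁻¹ • (w (n + 1) - w n)) with hy
  have e1 : S.D (w n + (t / τ - n) • (w (n + 1) - w n)) = S.D (w n) + (t - n * τ) • y := by
    rw [map_add, map_smul, map_sub, hvel, smul_smul]
    congr 2
    field_simp
  rcases Nat.eq_zero_or_pos k with h0 | hpos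
  · subst h0
    simp only [add_zero] at *
    have e2 : S.D (w n + θ • (w (n + 1) - w n)) = S.D (w n) + (t + r - n * τ) • y := by
      rw [map_add, map_smul, map_sub, hvel, smul_smul]
      congr 2
      rw [hθd]; field_simp
    rw [e1, e2]
    have : S.D (w n) + (t + r - n * τ) • y - (S.D (w n) + (t - n * τ) • y) = r • y := by module
    rw [this, inner_smul_right, real_inner_self_eq_norm_sq]
  · obtain ⟨j, rfl⟩ := Nat.exists_eq_add_of_le' hpos
    have h1 := h.inner_D_vel_ge hτ n j
    have h2 := h.inner_D_vel_ge hτ n (j + 1)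
    have h3 := h.D_vel_norm_antitone hτ (show n + j ≤ n + (j + 1) by omega)
    have h4 := h.D_vel_norm_antitone hτ (show n ≤ n + (j + 1) by omega)
    simp only at h3 h4
    rw [← hy] at h1 h2 h4
    have ej : n + j + 1 = n + (j + 1) := by ring
    rw [ej] at h1 h3
    set Y := ‖S.D (τ⁻¹ • (w (n + (j + 1) + 1) - w (n + (j + 1))))‖ with hY
    have h3' : Y ^ 2 ≤ ‖S.D (τ⁻¹ • (w (n + (j + 1)) - w (n + j)))‖ ^ 2 := by gcongr
    have h4' : Y ^ 2 ≤ ‖y‖ ^ 2 := by gcongr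
    -- The displacement is the rest of the current step, with velocity gradient `y`, plus a convex
    -- combination of two node displacements, each covered by `inner_D_vel_ge`.
    have e : S.D (w (n + (j + 1)) + θ • (w (n + (j + 1) + 1) - w (n + (j + 1))))
        - S.D (w n + (t / τ - n) • (w (n + 1) - w n))
        = (1 - θ) • (S.D (w (n + (j + 1))) - S.D (w (n + 1)))
          + θ • (S.D (w (n + (j + 1) + 1)) - S.D (w (n + 1))) + ((n + 1) * τ - t) • y := by
      have hv := hvel n
      rw [← hy] at hv
      have : S.D (w (n + 1)) = S.D (w n) + τ • y := by rw [← hv]; abel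
      rw [e1, map_add, map_smul, map_sub, this]
      module
    rw [e, inner_add_right, inner_add_right, inner_smul_right, inner_smul_right, inner_smul_right,
      real_inner_self_eq_norm_sq]
    have h5 : (1 - θ) * (j * τ * Y ^ 2) ≤ (1 - θ) * inner ℝ y (S.D (w (n + (j + 1))) - S.D (w (n + 1))) := by
      refine mul_le_mul_of_nonneg_left (le_trans ?_ h1) (by linarith)
      gcongr
    have h6 := mul_le_mul_of_nonneg_left h2 hθ
    have h7 : ((n + 1) * τ - t) * Y ^ 2 ≤ ((n + 1) * τ - t) * ‖y‖ ^ 2 :=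
      mul_le_mul_of_nonneg_left h4' (by linarith)
    have h8 : r * Y ^ 2 = (1 - θ) * (j * τ * Y ^ 2) + θ * (((j + 1 : ℕ) : ℝ) * τ * Y ^ 2)
        + ((n + 1) * τ - t) * Y ^ 2 := by
      have : r = (1 - θ) * (j * τ) + θ * (((j + 1 : ℕ) : ℝ) * τ) + ((n + 1) * τ - t) := by
        push_cast at hθt ⊢; linarith
      rw [this]; ring
    linarith

variable [CompleteSpace F]

/-- Difference quotients approximate the velocity as long as its norm does not drop. -/
theorem norm_rate_sub_slope_sq_le (hτ : 0 < τ) (h : S.IsScheme x₀ τ w) {t r : ℝ} (ht : 0 ≤ t)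
    (hr : 0 < r) :
    ‖S.D (rate τ w t) - r⁻¹ • (S.D (affineInterp τ w (t + r)) - S.D (affineInterp τ w t))‖ ^ 2
      ≤ 2 * (‖S.D (rate τ w t)‖ ^ 2 - ‖S.D (rate τ w (t + r))‖ ^ 2) := by
  have h1 := h.inner_rate_ge hτ ht hr.le
  set y := S.D (rate τ w t)
  set d := S.D (affineInterp τ w (t + r)) - S.D (affineInterp τ w t) with hd
  have h2 : ‖d‖ ≤ ‖y‖ * r := by
    rw [hd, map_affineInterp, map_affineInterp,
      affineInterp_sub hτ _ ht (by linarith : (0 : ℝ) ≤ t + r)]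
    have := intervalIntegral.norm_integral_le_of_norm_le_const (a := t) (b := t + r) (C := ‖y‖)
      (f := rate τ fun n => S.D (w n)) (fun s hs => by
        rw [← map_rate]
        rw [uIoc_of_le (by linarith)] at hs
        exact h.norm_rate_antitone hτ hs.1.le)
    rwa [add_sub_cancel_left, abs_of_pos hr] at this
  -- In the expanded square the slope has norm at most `‖y‖`, since the speed decreases, and its
  -- product with `y` is bounded below by the final squared speed.
  rw [@norm_sub_sq_real, inner_smul_right, norm_smul, norm_inv, Real.norm_of_nonneg hr.le]
  have h3 : r⁻¹ * ‖d‖ ≤ ‖y‖ := by rw [inv_mul_le_iff₀ hr]; linarith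
  have h4 : (r⁻¹ * ‖d‖) ^ 2 ≤ ‖y‖ ^ 2 := by gcongr
  have h5 : ‖S.D (rate τ w (t + r))‖ ^ 2 ≤ r⁻¹ * inner ℝ y d := by
    rw [le_inv_mul_iff₀ hr]; exact h1
  linarith

/-- Error estimate for two steps and a common initial state with bounded velocity. -/
theorem norm_affineInterp_sub_sq_le (hτ : 0 < τ) (h : S.IsScheme x₀ τ w) {σ : ℝ} (hσ : 0 < σ)
    {w' : ℕ → V} (h' : S.IsScheme x₀ σ w') (h0 : w 0 = w' 0) {v : V}
    (hv : S.Rel (x₀ + S.D (w 0)) v) {t : ℝ} (ht : 0 ≤ t) :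
    ‖S.D (affineInterp τ w t) - S.D (affineInterp σ w' t)‖ ^ 2
      ≤ 4 * ‖S.D v‖ ^ 2 * (τ + σ) * t := by
  set L := ‖S.D v‖ with hL
  have hy : ∀ n, ‖S.D (τ⁻¹ • (w (n + 1) - w n))‖ ≤ L := fun n =>
    (h.D_vel_norm_antitone hτ (Nat.zero_le n)).trans (h.D_vel_norm_le_of_rel hτ hv)
  have hy' : ∀ n, ‖S.D (σ⁻¹ • (w' (n + 1) - w' n))‖ ≤ L := fun n =>
    (h'.D_vel_norm_antitone hσ (Nat.zero_le n)).trans (h'.D_vel_norm_le_of_rel hσ (h0 ▸ hv))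
  -- The relation holds at the right node, not at the interpolant; the gap is at most the step times
  -- the speed bound. Dissipativity therefore holds up to an error linear in `τ + σ`.
  have lag : ∀ {ρ : ℝ} {z : ℕ → V}, 0 < ρ → (∀ n, ‖S.D (ρ⁻¹ • (z (n + 1) - z n))‖ ≤ L) → ∀ r, 0 ≤ r →
      ‖S.D (affineInterp ρ z r) - S.D (z (⌊r / ρ⌋₊ + 1))‖ ≤ ρ * L := by
    intro ρ z hρ hz r hr
    have h1 := floor_mul_le hρ hr
    have h2 := lt_floor_add_one_mul (t := r) hρ
    have h3 := hz ⌊r / ρ⌋₊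
    simp only [affineInterp]
    set n := ⌊r / ρ⌋₊
    have e : S.D (z n + (r / ρ - n) • (z (n + 1) - z n)) - S.D (z (n + 1))
        = -(((n + 1) * ρ - r) • S.D (ρ⁻¹ • (z (n + 1) - z n))) := by
      rw [← map_smul, smul_smul, ← map_neg, ← map_sub]
      congr 1
      have : ((n + 1) * ρ - r) * ρ⁻¹ = 1 - (r / ρ - n) := by field_simp; ring
      rw [this]; module
    rw [e, norm_neg, norm_smul, Real.norm_of_nonneg (by linarith)]
    gcongr; nlinarith
  have key := norm_sq_le_of_inner_deriv_le (s := 0) (t := t) (β := 2 * L * (τ * L + σ * L))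
    (w := fun r => affineInterp τ (fun n => S.D (w n)) r - affineInterp σ (fun n => S.D (w' n)) r)
    (g := fun r => rate τ (fun n => S.D (w n)) r - rate σ (fun n => S.D (w' n)) r) ht
    ((intervalIntegrable_rate hτ _ _ _).sub (intervalIntegrable_rate hσ _ _ _))
    (fun a b ha hab _ => by
      rw [intervalIntegral.integral_sub (intervalIntegrable_rate hτ _ _ _)
        (intervalIntegrable_rate hσ _ _ _), ← affineInterp_sub hτ _ ha (ha.trans hab),
        ← affineInterp_sub hσ _ ha (ha.trans hab)]
      abel)
    (by
      filter_upwards [ae_restrict_mem measurableSet_Icc] with r hr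
      simp only [← map_affineInterp, ← map_rate]
      have h1 := lag hτ hy r hr.1
      have h2 := lag hσ hy' r hr.1
      have h3 := (h ⌊r / τ⌋₊).inner_sub_le (h' ⌊r / σ⌋₊)
      rw [add_sub_add_left_eq_sub] at h3
      have h4 : ‖S.D (rate τ w r)‖ ≤ L := hy _
      have h5 : ‖S.D (rate σ w' r)‖ ≤ L := hy' _
      change inner ℝ _ (S.D (rate τ w r) - S.D (rate σ w' r)) ≤ 0 at h3
      set a := S.D (affineInterp τ w r)
      set a' := S.D (affineInterp σ w' r)
      set b := S.D (w (⌊r / τ⌋₊ + 1))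
      set b' := S.D (w' (⌊r / σ⌋₊ + 1))
      set y := S.D (rate τ w r) - S.D (rate σ w' r) with hyd
      have e : a - a' = (b - b') + ((a - b) - (a' - b')) := by abel
      rw [e, inner_add_left]
      have h6 : ‖(a - b) - (a' - b')‖ ≤ τ * L + σ * L := (_root_.norm_sub_le _ _).trans (by linarith)
      have h7 : ‖y‖ ≤ 2 * L := (_root_.norm_sub_le _ _).trans (by linarith)
      have h8 := real_inner_le_norm ((a - b) - (a' - b')) y
      have h9 : ‖(a - b) - (a' - b')‖ * ‖y‖ ≤ (τ * L + σ * L) * (2 * L) := by gcongr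
      linarith)
  simp only [affineInterp_zero, h0, sub_self, norm_zero, sub_zero] at key
  rw [map_affineInterp, map_affineInterp]
  calc _ ≤ _ := key
    _ = _ := by ring

end IsScheme
end Setting
end L1Flow

/-! ### Cauchy estimates as the step tends to zero, for states and for velocities. -/

namespace L1Flow
namespace Setting

variable {V F : Type*} [NormedAddCommGroup V] [InnerProductSpace ℝ V] [CompleteSpace V]
  [NormedAddCommGroup F] [InnerProductSpace ℝ F] [CompleteSpace F] (S : Setting V F)

/-- The gradients of the interpolants form a Cauchy family, uniformly on `[0, T]`. -/
theorem exists_forall_norm_D_affineInterp_sub_le (x₀ : F) {T ε : ℝ} (hT : 0 ≤ T) (hε : 0 < ε) :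
    ∃ η > 0, ∀ τ σ, 0 < τ → τ < η → 0 < σ → σ < η → ∀ w w' : ℕ → V,
      S.IsScheme x₀ τ w → S.IsScheme x₀ σ w' → w 0 = 0 → w' 0 = 0 → ∀ t ∈ Icc 0 T,
        ‖S.D (affineInterp τ w t) - S.D (affineInterp σ w' t)‖ ≤ ε := by
  -- Both schemes are compared with schemes from a nearby state `a` which has a velocity;
  -- contraction keeps the gradients within `ε / 4`.
  obtain ⟨a, v, ha, hv⟩ := S.exists_rel_near x₀ (show 0 < ε / 4 by positivity)
  set L := ‖S.D v‖ with hL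
  refine ⟨(ε / 2) ^ 2 / (8 * L ^ 2 * T + 1), by positivity, ?_⟩
  intro τ σ hτ hτη hσ hση w w' hw hw' h0 h0' t ht
  obtain ⟨z, hz0, hz⟩ := S.exists_isScheme x₀ hτ a
  obtain ⟨z', hz0', hz'⟩ := S.exists_isScheme x₀ hσ a
  have hzs : S.IsScheme x₀ τ z := fun n => (hz n).rel hτ
  have hzs' : S.IsScheme x₀ σ z' := fun n => (hz' n).rel hσ
  have h1 : ‖S.D (affineInterp τ w t) - S.D (affineInterp τ z t)‖ ≤ ε / 4 := by
    rw [map_affineInterp, map_affineInterp]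
    refine norm_affineInterp_sub_le hτ (fun n => (hw.norm_sub_le hτ hzs n).trans ?_) ht.1
    rw [h0, hz0]; simpa using ha.le
  have h2 : ‖S.D (affineInterp σ w' t) - S.D (affineInterp σ z' t)‖ ≤ ε / 4 := by
    rw [map_affineInterp, map_affineInterp]
    refine norm_affineInterp_sub_le hσ (fun n => (hw'.norm_sub_le hσ hzs' n).trans ?_) ht.1
    rw [h0', hz0']; simpa using ha.le
  have h3 : ‖S.D (affineInterp τ z t) - S.D (affineInterp σ z' t)‖ ≤ ε / 2 := by
    refine le_of_sq_le_sq ((hzs.norm_affineInterp_sub_sq_le hτ hσ hzs' (hz0.trans hz0'.symm)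
      (v := v) (by rwa [hz0]) ht.1).trans ?_) (by positivity)
    rw [← hL]
    rw [lt_div_iff₀ (by positivity)] at hτη hση
    have h4 : 4 * L ^ 2 * (τ + σ) * t ≤ 4 * L ^ 2 * (τ + σ) * T := by gcongr; exact ht.2
    nlinarith
  calc _ = ‖(S.D (affineInterp τ w t) - S.D (affineInterp τ z t))
        + (S.D (affineInterp τ z t) - S.D (affineInterp σ z' t))
        - (S.D (affineInterp σ w' t) - S.D (affineInterp σ z' t))‖ := by congr 1; abel
    _ ≤ _ := (norm_sub_le _ _).trans (add_le_add_left (norm_add_le _ _) _)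
    _ ≤ ε := by linarith

variable {S}

theorem IsScheme.intervalIntegrable_D_rate {τ : ℝ} (hτ : 0 < τ) (w : ℕ → V) (a b : ℝ) :
    IntervalIntegrable (fun t => S.D (rate τ w t)) volume a b := by
  simp_rw [map_rate]
  exact intervalIntegrable_rate hτ _ _ _

theorem IsScheme.intervalIntegrable_slope {τ : ℝ} (hτ : 0 < τ) (w : ℕ → V) {δ T r : ℝ}
    (hδ : 0 ≤ δ) (hδT : δ ≤ T) (hr : 0 ≤ r) :
    IntervalIntegrable (fun t => r⁻¹ • (S.D (affineInterp τ w (t + r)) - S.D (affineInterp τ w t)))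
      volume δ T := by
  apply ContinuousOn.intervalIntegrable
  rw [uIcc_of_le hδT]
  have hc := S.D.continuous.comp_continuousOn (continuousOn_affineInterp hτ w)
  have h1 : ContinuousOn (fun t => S.D (affineInterp τ w (t + r))) (Icc δ T) :=
    hc.comp (by fun_prop) fun t ht => by simp only [mem_Ici]; linarith [ht.1]
  exact (h1.sub (hc.mono fun t ht => hδ.trans ht.1)).const_smul _

/-- Young's inequality with parameter `κ` linearizes `norm_rate_sub_slope_sq_le`. The integral of
the speed drops then telescopes to an initial layer of length `r`, uniformly in the step. -/
theorem IsScheme.integral_norm_rate_sub_slope_le {x₀ : F} {τ : ℝ} {w : ℕ → V} (hτ : 0 < τ)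
    (h : S.IsScheme x₀ τ w) {δ T r κ : ℝ} (hδ : 0 < δ) (hδT : δ ≤ T) (hr : 0 < r) (hκ : 0 < κ) :
    ∫ t in δ..T, ‖S.D (rate τ w t)
        - r⁻¹ • (S.D (affineInterp τ w (t + r)) - S.D (affineInterp τ w t))‖
      ≤ κ * (T - δ) + r * (2 * ‖x₀ + S.D (w 0)‖ / δ) ^ 2 / κ := by
  set N : ℝ → ℝ := fun t => ‖S.D (rate τ w t)‖ ^ 2 with hN
  have hNi : ∀ a b, IntervalIntegrable N volume a b := fun a b => by
    have := intervalIntegrable_comp_floor hτ (fun n => ‖S.D (τ⁻¹ • (w (n + 1) - w n))‖ ^ 2) a b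
    exact this
  have hNs : ∀ a b, IntervalIntegrable (fun t => N (t + r)) volume a b := fun a b => by
    have := (hNi (a + r) (b + r)).comp_add_right r
    simpa using this
  have hle : ∀ t ∈ Icc δ T, ‖S.D (rate τ w t)
        - r⁻¹ • (S.D (affineInterp τ w (t + r)) - S.D (affineInterp τ w t))‖
      ≤ κ + κ⁻¹ * (N t - N (t + r)) := by
    intro t ht
    have h1 := h.norm_rate_sub_slope_sq_le hτ (hδ.le.trans ht.1) hr
    set a := ‖S.D (rate τ w t)
        - r⁻¹ • (S.D (affineInterp τ w (t + r)) - S.D (affineInterp τ w t))‖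
    have h2 : κ * a ≤ κ ^ 2 + (N t - N (t + r)) := by
      simp only [hN]; nlinarith [sq_nonneg (κ - a), sq_nonneg κ]
    calc a = κ⁻¹ * (κ * a) := by field_simp
      _ ≤ κ⁻¹ * (κ ^ 2 + (N t - N (t + r))) := by gcongr
      _ = _ := by field_simp
  have hmono := intervalIntegral.integral_mono_on hδT
    ((IsScheme.intervalIntegrable_D_rate hτ w _ _).sub
      (IsScheme.intervalIntegrable_slope hτ w hδ.le hδT hr.le)).norm
    (intervalIntegrable_const.add (((hNi δ T).sub (hNs δ T)).const_mul κ⁻¹)) hle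
  refine hmono.trans ?_
  rw [intervalIntegral.integral_add intervalIntegrable_const
    (((hNi δ T).sub (hNs δ T)).const_mul κ⁻¹), intervalIntegral.integral_const,
    intervalIntegral.integral_const_mul, intervalIntegral.integral_sub (hNi δ T) (hNs δ T),
    intervalIntegral.integral_comp_add_right, smul_eq_mul]
  have h1 : (∫ t in δ..T, N t) - ∫ t in (δ + r)..(T + r), N t
      = (∫ t in δ..(δ + r), N t) - ∫ t in T..(T + r), N t := by
    have e1 := intervalIntegral.integral_add_adjacent_intervals (hNi δ T) (hNi T (T + r))
    have e2 := intervalIntegral.integral_add_adjacent_intervals (hNi δ (δ + r))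
      (hNi (δ + r) (T + r))
    linarith
  have h2 : 0 ≤ ∫ t in T..(T + r), N t :=
    intervalIntegral.integral_nonneg (by linarith) fun t _ => by positivity
  have h3 : ∫ t in δ..(δ + r), N t ≤ r * (2 * ‖x₀ + S.D (w 0)‖ / δ) ^ 2 := by
    have := intervalIntegral.integral_mono_on (show δ ≤ δ + r by linarith) (hNi δ (δ + r))
      (intervalIntegrable_const (c := (2 * ‖x₀ + S.D (w 0)‖ / δ) ^ 2)) (fun t ht => by
        have ht0 : 0 < t := hδ.trans_le ht.1
        simp only [hN]
        gcongr
        exact (h.norm_rate_le hτ ht0).trans (by gcongr; exact ht.1))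
    rw [intervalIntegral.integral_const, smul_eq_mul, add_sub_cancel_left] at this
    exact this
  rw [h1, mul_comm (T - δ) κ]
  gcongr
  rw [div_eq_inv_mul]
  gcongr
  linarith

variable (S)

/-- The velocities form a Cauchy family in `L¹(δ, T)`. -/
theorem exists_forall_integral_norm_rate_sub_le (x₀ : F) {δ T ε : ℝ} (hδ : 0 < δ) (hδT : δ ≤ T)
    (hε : 0 < ε) :
    ∃ η > 0, ∀ τ σ, 0 < τ → τ < η → 0 < σ → σ < η → ∀ w w' : ℕ → V,
      S.IsScheme x₀ τ w → S.IsScheme x₀ σ w' → w 0 = 0 → w' 0 = 0 →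
        ∫ t in δ..T, ‖S.D (rate τ w t) - S.D (rate σ w' t)‖ ≤ ε := by
  set M := T - δ + 1 with hM
  have hM0 : 0 < M := by linarith
  set B := (2 * ‖x₀‖ / δ) ^ 2 with hB
  have hB0 : 0 ≤ B := by positivity
  -- With these choices each velocity is within `ε / 3` in `L¹` of its slope over time `r`, and the
  -- two slopes are within `ε / 3` of each other. The `+ 1` in `M` and in `B + 1` avoids division by
  -- zero.
  set κ := ε / (6 * M) with hκ
  have hκ0 : 0 < κ := by positivity
  set r := κ * ε / (6 * (B + 1)) with hr
  have hr0 : 0 < r := by positivity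
  obtain ⟨η, hη, H⟩ := S.exists_forall_norm_D_affineInterp_sub_le x₀ (T := T + r)
    (ε := r * ε / (6 * M)) (by linarith) (by positivity)
  refine ⟨η, hη, ?_⟩
  intro τ σ hτ hτη hσ hση w w' hw hw' h0 h0'
  have H' := H τ σ hτ hτη hσ hση w w' hw hw' h0 h0'
  have i1 := hw.integral_norm_rate_sub_slope_le hτ hδ hδT hr0 hκ0
  have i2 := hw'.integral_norm_rate_sub_slope_le hσ hδ hδT hr0 hκ0
  rw [h0, map_zero, add_zero] at i1
  rw [h0', map_zero, add_zero] at i2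
  set m := fun t => r⁻¹ • (S.D (affineInterp τ w (t + r)) - S.D (affineInterp τ w t)) with hm
  set m' := fun t => r⁻¹ • (S.D (affineInterp σ w' (t + r)) - S.D (affineInterp σ w' t)) with hm'
  have hmm : ∀ t ∈ Icc δ T, ‖m t - m' t‖ ≤ ε / (3 * M) := by
    intro t ht
    have a1 := H' t ⟨hδ.le.trans ht.1, by linarith [ht.2]⟩
    have a2 := H' (t + r) ⟨by linarith [ht.1], by linarith [ht.2]⟩
    have e : m t - m' t = r⁻¹ • ((S.D (affineInterp τ w (t + r)) - S.D (affineInterp σ w' (t + r)))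
        - (S.D (affineInterp τ w t) - S.D (affineInterp σ w' t))) := by
      simp only [hm, hm']; module
    rw [e, norm_smul, norm_inv, Real.norm_of_nonneg hr0.le, inv_mul_le_iff₀ hr0]
    calc _ ≤ r * ε / (6 * M) + r * ε / (6 * M) := (norm_sub_le _ _).trans (add_le_add a2 a1)
      _ = _ := by field_simp; ring
  have g1 := ((IsScheme.intervalIntegrable_D_rate (S := S) hτ w δ T).sub
      (IsScheme.intervalIntegrable_slope (S := S) hτ w hδ.le hδT hr0.le)).norm
  have g2 := ((IsScheme.intervalIntegrable_D_rate (S := S) hσ w' δ T).sub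
      (IsScheme.intervalIntegrable_slope (S := S) hσ w' hδ.le hδT hr0.le)).norm
  have hmono := intervalIntegral.integral_mono_on hδT
    ((IsScheme.intervalIntegrable_D_rate (S := S) hτ w δ T).sub
      (IsScheme.intervalIntegrable_D_rate (S := S) hσ w' δ T)).norm
    ((g1.add g2).add (intervalIntegrable_const (c := ε / (3 * M)))) (fun t ht => by
      have := hmm t ht
      have e : S.D (rate τ w t) - S.D (rate σ w' t)
        = (S.D (rate τ w t) - m t) - (S.D (rate σ w' t) - m' t) + (m t - m' t) := by abel
      rw [e]
      exact (norm_add_le _ _).trans (add_le_add (norm_sub_le _ _) this))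
  refine hmono.trans ?_
  rw [intervalIntegral.integral_add (g1.add g2) intervalIntegrable_const,
    intervalIntegral.integral_add g1 g2, intervalIntegral.integral_const, smul_eq_mul]
  have b1 : κ * (T - δ) ≤ ε / 6 := by
    have : κ * M = ε / 6 := by rw [hκ]; field_simp
    nlinarith
  have b2 : r * B / κ ≤ ε / 6 := by
    have : r * (B + 1) / κ = ε / 6 := by rw [hr]; field_simp
    have h3 : r * B / κ ≤ r * (B + 1) / κ := by gcongr; linarith
    linarith
  have b3 : (T - δ) * (ε / (3 * M)) ≤ ε / 3 := by
    have : M * (ε / (3 * M)) = ε / 3 := by field_simp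
    have h4 : 0 < ε / (3 * M) := by positivity
    nlinarith
  linarith

/-- A family of implicit Euler schemes starting from `0`. -/
def IsFamily (x₀ : F) (w : ℝ → ℕ → V) : Prop := ∀ τ > 0, S.IsScheme x₀ τ (w τ) ∧ w τ 0 = 0

variable {S} {x₀ : F} {w : ℝ → ℕ → V}

theorem IsFamily.norm_D_rate_le (h : S.IsFamily x₀ w) {τ t : ℝ} (hτ : 0 < τ) (ht : 0 < t) :
    ‖S.D (rate τ (w τ) t)‖ ≤ 2 * ‖x₀‖ / t := by
  have := (h τ hτ).1.norm_rate_le hτ ht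
  rwa [(h τ hτ).2, map_zero, add_zero] at this

theorem IsFamily.isReduced_rate (h : S.IsFamily x₀ w) {τ : ℝ} (hτ : 0 < τ) (t : ℝ) :
    S.IsReduced (rate τ (w τ) t) :=
  ((h τ hτ).1 _).isReduced

theorem eLpNorm_one_restrict_Ioc {E : Type*} [NormedAddCommGroup E] {f : ℝ → E} {a b : ℝ}
    (hab : a ≤ b) (hf : IntervalIntegrable f volume a b) :
    eLpNorm f 1 (volume.restrict (Ioc a b)) = ENNReal.ofReal (∫ t in a..b, ‖f t‖) := by
  rw [eLpNorm_one_eq_lintegral_enorm, intervalIntegral.integral_of_le hab,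
    ofReal_integral_norm_eq_lintegral_enorm ((intervalIntegrable_iff_integrableOn_Ioc_of_le hab).1 hf)]

/-- Along a suitable sequence of steps the velocities converge at almost every time. -/
theorem IsFamily.exists_seq_tendsto_rate (h : S.IsFamily x₀ w) :
    ∃ (τ : ℕ → ℝ) (v : ℝ → V), (∀ n, 0 < τ n) ∧ Tendsto τ atTop (𝓝 0) ∧
      ∀ᵐ t ∂(volume.restrict (Ioi (0 : ℝ))),
        Tendsto (fun n => rate (τ n) (w (τ n)) t) atTop (𝓝 (v t)) := by
  -- Summable rates on windows exhausting `(0, ∞)`, so that one sequence of steps converges almost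
  -- everywhere on all of them.
  have hex : ∀ j : ℕ, ∃ η > 0, ∀ τ σ, 0 < τ → τ < η → 0 < σ → σ < η →
      ∫ t in (1 / ((j : ℝ) + 1))..(j + 1),
        ‖S.D (rate τ (w τ) t) - S.D (rate σ (w σ) t)‖ ≤ (1 / 2) ^ j := by
    intro j
    have hle : 1 / ((j : ℝ) + 1) ≤ j + 1 := by
      rw [div_le_iff₀ (by positivity)]
      nlinarith [(Nat.cast_nonneg j : (0 : ℝ) ≤ j)]
    obtain ⟨η, hη, H⟩ := S.exists_forall_integral_norm_rate_sub_le x₀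
      (δ := 1 / ((j : ℝ) + 1)) (T := j + 1) (ε := (1 / 2) ^ j) (by positivity) hle (by positivity)
    exact ⟨η, hη, fun τ σ hτ hτη hσ hση => H τ σ hτ hτη hσ hση _ _ (h τ hτ).1 (h σ hσ).1
      (h τ hτ).2 (h σ hσ).2⟩
  choose η hη H using hex
  have hz := tendsto_one_div_add_atTop_nhds_zero_nat (𝕜 := ℝ)
  obtain ⟨φ, hφ, hφη⟩ := extraction_forall_of_eventually'
    (P := fun j k => 1 / ((k : ℝ) + 1) < η j) fun j => by
      obtain ⟨N, hN⟩ := eventually_atTop.1 (hz.eventually (gt_mem_nhds (hη j)))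
      exact ⟨N, hN⟩
  set τ : ℕ → ℝ := fun n => 1 / ((φ n : ℝ) + 1) with hτ
  have hτ0 : ∀ n, 0 < τ n := fun n => by simp only [hτ]; positivity
  have hτη : ∀ j n, j ≤ n → τ n < η j := fun j n hjn => by
    refine lt_of_le_of_lt ?_ (hφη j)
    have : (φ j : ℝ) ≤ φ n := by exact_mod_cast hφ.monotone hjn
    simp only [hτ]
    gcongr
  have hmeas : ∀ n, StronglyMeasurable fun t => S.D (rate (τ n) (w (τ n)) t) := fun n =>
    S.D.continuous.comp_stronglyMeasurable (stronglyMeasurable_rate _ _)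
  have window : ∀ k : ℕ, ∀ᵐ t, t ∈ Ioc (1 / ((k : ℝ) + 1)) (k + 1) →
      CauchySeq fun n => S.D (rate (τ n) (w (τ n)) t) := by
    intro k
    rw [← ae_restrict_iff' measurableSet_Ioc]
    have hae := Lp.ae_tendsto_of_cauchy_eLpNorm (p := 1)
      (μ := volume.restrict (Ioc (1 / ((k : ℝ) + 1)) (k + 1)))
      (f := fun n t => S.D (rate (τ (n + k)) (w (τ (n + k))) t))
      -- The factor `2` makes the required inequality strict. The shift of the index by `k` ensures
      -- that window `k` lies inside window `N + k`.
      (B := fun N => ENNReal.ofReal (2 * (1 / 2) ^ N))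
      (fun n => (hmeas _).aestronglyMeasurable) le_rfl (by
        rw [← ENNReal.ofReal_tsum_of_nonneg (fun n => by positivity)
          (summable_geometric_two.mul_left 2)]
        exact ENNReal.ofReal_ne_top) (by
        intro N n m hn hm
        have hk : 1 / (((N + k : ℕ) : ℝ) + 1) ≤ 1 / ((k : ℝ) + 1) := by
          gcongr; exact_mod_cast Nat.le_add_left k N
        have hk' : (k : ℝ) + 1 ≤ ((N + k : ℕ) : ℝ) + 1 := by
          gcongr; exact_mod_cast Nat.le_add_left k N
        have hle : 1 / (((N + k : ℕ) : ℝ) + 1) ≤ ((N + k : ℕ) : ℝ) + 1 := by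
          rw [div_le_iff₀ (by positivity)]
          nlinarith [(Nat.cast_nonneg (N + k) : (0 : ℝ) ≤ ((N + k : ℕ) : ℝ))]
        have hI := H (N + k) (τ (n + k)) (τ (m + k)) (hτ0 _) (hτη _ _ (by omega)) (hτ0 _)
          (hτη _ _ (by omega))
        refine (eLpNorm_mono_measure _
          (Measure.restrict_mono (Ioc_subset_Ioc hk hk') le_rfl)).trans_lt ?_
        have := eLpNorm_one_restrict_Ioc hle
          ((IsScheme.intervalIntegrable_D_rate (S := S) (hτ0 (n + k)) (w (τ (n + k))) _ _).sub
          (IsScheme.intervalIntegrable_D_rate (S := S) (hτ0 (m + k)) (w (τ (m + k))) _ _))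
        refine this.trans_lt ?_
        rw [ENNReal.ofReal_lt_ofReal_iff (by positivity)]
        refine hI.trans_lt ?_
        have h1 : (1 / 2 : ℝ) ^ (N + k) ≤ (1 / 2) ^ N :=
          pow_le_pow_of_le_one (by norm_num) (by norm_num) (Nat.le_add_right N k)
        have h2 : (0 : ℝ) < (1 / 2) ^ N := by positivity
        linarith)
    filter_upwards [hae] with t ht
    obtain ⟨l, hl⟩ := ht
    exact ((tendsto_add_atTop_iff_nat k).1 hl).cauchySeq
  -- Convergence of the gradients lifts to the velocities because the latter are reduced; at
  -- exceptional times the value of `limUnder` is irrelevant.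
  refine ⟨τ, fun t => limUnder atTop fun n => rate (τ n) (w (τ n)) t, hτ0,
    hz.comp hφ.tendsto_atTop, ?_⟩
  rw [ae_restrict_iff' measurableSet_Ioi]
  filter_upwards [ae_all_iff.2 window] with t ht h0
  have h0' : (0 : ℝ) < t := h0
  obtain ⟨k, hk⟩ := exists_nat_gt (max t (1 / t))
  have hc := ht k ⟨by
    have := (le_max_right t (1 / t)).trans_lt hk
    rw [div_lt_iff₀ h0'] at this
    rw [div_lt_iff₀ (by positivity)]
    nlinarith, by linarith [le_max_left t (1 / t)]⟩
  exact tendsto_nhds_limUnder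
    (exists_tendsto_of_isReduced (fun n => h.isReduced_rate (hτ0 n) t) hc)

end Setting
end L1Flow

/-! ### Passage to the limit and uniqueness for the abstract evolution. -/

namespace L1Flow
namespace Setting

variable {V F : Type*} [NormedAddCommGroup V] [InnerProductSpace ℝ V] [CompleteSpace V]
  [NormedAddCommGroup F] [InnerProductSpace ℝ F] [CompleteSpace F] {S : Setting V F}
  {x₀ : F} {w : ℝ → ℕ → V} {τ : ℕ → ℝ} {v : ℝ → V}

theorem intervalIntegrable_of_norm_le_div {E : Type*} [NormedAddCommGroup E] {g : ℝ → E} {C : ℝ}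
    (hg : AEStronglyMeasurable g (volume.restrict (Ioi (0 : ℝ))))
    (hC : ∀ᵐ t ∂(volume.restrict (Ioi (0 : ℝ))), ‖g t‖ ≤ C / t) {δ T : ℝ} (hδ : 0 < δ)
    (hδT : δ ≤ T) : IntervalIntegrable g volume δ T := by
  rw [intervalIntegrable_iff_integrableOn_Ioc_of_le hδT]
  have hsub : Ioc δ T ⊆ Ioi 0 := fun t ht => hδ.trans ht.1
  refine IntegrableOn.of_bound (by simp)
    (hg.mono_measure (Measure.restrict_mono hsub le_rfl)) (|C| / δ) ?_
  filter_upwards [ae_restrict_of_ae_restrict_of_subset hsub hC,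
    ae_restrict_mem measurableSet_Ioc] with t ht htm
  have := hδ.trans htm.1
  calc ‖g t‖ ≤ C / t := ht
    _ ≤ |C| / t := by gcongr; exact le_abs_self C
    _ ≤ |C| / δ := by gcongr; exact htm.1.le

theorem memLp_two_of_norm_le_div {E : Type*} [NormedAddCommGroup E] {g : ℝ → E} {C : ℝ}
    (hg : AEStronglyMeasurable g (volume.restrict (Ioi (0 : ℝ))))
    (hC : ∀ᵐ t ∂(volume.restrict (Ioi (0 : ℝ))), ‖g t‖ ≤ C / t) {δ : ℝ} (hδ : 0 < δ) :
    MemLp g 2 (volume.restrict (Ioi δ)) := by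
  have hsub : Ioi δ ⊆ Ioi 0 := Ioi_subset_Ioi hδ.le
  have hgδ := hg.mono_measure (Measure.restrict_mono hsub le_rfl)
  rw [memLp_two_iff_integrable_sq_norm hgδ]
  have hi : IntegrableOn (fun t : ℝ => C ^ 2 * t ^ (-2 : ℝ)) (Ioi δ) :=
    (integrableOn_Ioi_rpow_of_lt (by norm_num) hδ).const_mul _
  refine hi.mono' (hgδ.norm.pow 2) ?_
  filter_upwards [ae_restrict_of_ae_restrict_of_subset hsub hC,
    ae_restrict_mem measurableSet_Ioi] with t ht htm
  have h0 : 0 < t := hδ.trans htm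
  rw [Real.norm_of_nonneg (by positivity), Real.rpow_neg h0.le, Real.rpow_two, ← div_eq_mul_inv,
    ← div_pow]
  gcongr

namespace IsFamily

theorem aestronglyMeasurable_velocity
    (hae : ∀ᵐ t ∂(volume.restrict (Ioi (0 : ℝ))),
      Tendsto (fun n => rate (τ n) (w (τ n)) t) atTop (𝓝 (v t))) :
    AEStronglyMeasurable v (volume.restrict (Ioi (0 : ℝ))) :=
  aestronglyMeasurable_of_tendsto_ae atTop
    (fun n => (stronglyMeasurable_rate (τ n) (w (τ n))).aestronglyMeasurable) hae

theorem isReduced_velocity (h : S.IsFamily x₀ w) (hτ : ∀ n, 0 < τ n)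
    (hae : ∀ᵐ t ∂(volume.restrict (Ioi (0 : ℝ))),
      Tendsto (fun n => rate (τ n) (w (τ n)) t) atTop (𝓝 (v t))) :
    ∀ᵐ t ∂(volume.restrict (Ioi (0 : ℝ))), S.IsReduced (v t) := by
  filter_upwards [hae] with t ht
  exact isReduced_of_tendsto (.of_forall fun n => h.isReduced_rate (hτ n) t) ht

theorem norm_D_velocity_le (h : S.IsFamily x₀ w) (hτ : ∀ n, 0 < τ n)
    (hae : ∀ᵐ t ∂(volume.restrict (Ioi (0 : ℝ))),
      Tendsto (fun n => rate (τ n) (w (τ n)) t) atTop (𝓝 (v t))) :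
    ∀ᵐ t ∂(volume.restrict (Ioi (0 : ℝ))), ‖S.D (v t)‖ ≤ 2 * ‖x₀‖ / t := by
  filter_upwards [hae, ae_restrict_mem measurableSet_Ioi] with t ht h0
  exact le_of_tendsto ((S.D.continuous.tendsto _).comp ht).norm
    (.of_forall fun n => h.norm_D_rate_le (hτ n) h0)

theorem exists_norm_velocity_le (h : S.IsFamily x₀ w) (hτ : ∀ n, 0 < τ n)
    (hae : ∀ᵐ t ∂(volume.restrict (Ioi (0 : ℝ))),
      Tendsto (fun n => rate (τ n) (w (τ n)) t) atTop (𝓝 (v t))) :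
    ∃ C, ∀ᵐ t ∂(volume.restrict (Ioi (0 : ℝ))), ‖v t‖ ≤ C / t := by
  obtain ⟨C, hC, hle⟩ := S.exists_isReduced_norm_le
  refine ⟨C * (2 * ‖x₀‖), ?_⟩
  filter_upwards [h.isReduced_velocity hτ hae, h.norm_D_velocity_le hτ hae] with t h1 h2
  calc ‖v t‖ ≤ C * ‖S.D (v t)‖ := hle _ h1
    _ ≤ C * (2 * ‖x₀‖ / t) := by gcongr
    _ = _ := by ring

theorem intervalIntegrable_velocity (h : S.IsFamily x₀ w) (hτ : ∀ n, 0 < τ n)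
    (hae : ∀ᵐ t ∂(volume.restrict (Ioi (0 : ℝ))),
      Tendsto (fun n => rate (τ n) (w (τ n)) t) atTop (𝓝 (v t))) {δ T : ℝ} (hδ : 0 < δ)
    (hδT : δ ≤ T) : IntervalIntegrable v volume δ T := by
  obtain ⟨C, hC⟩ := h.exists_norm_velocity_le hτ hae
  exact intervalIntegrable_of_norm_le_div (aestronglyMeasurable_velocity hae) hC hδ hδT

/-- Dominated convergence along the selected sequence; the Cauchy property in `L¹` then extends it
to all steps. -/
theorem tendsto_integral_norm_D_rate_sub (h : S.IsFamily x₀ w) (hτ : ∀ n, 0 < τ n)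
    (hτ0 : Tendsto τ atTop (𝓝 0))
    (hae : ∀ᵐ t ∂(volume.restrict (Ioi (0 : ℝ))),
      Tendsto (fun n => rate (τ n) (w (τ n)) t) atTop (𝓝 (v t))) {δ T : ℝ} (hδ : 0 < δ)
    (hδT : δ ≤ T) :
    Tendsto (fun σ => ∫ t in δ..T, ‖S.D (rate σ (w σ) t) - S.D (v t)‖) (𝓝[>] 0) (𝓝 0) := by
  have hsub : Ioc δ T ⊆ Ioi 0 := fun t ht => hδ.trans ht.1
  have hvi := h.intervalIntegrable_velocity hτ hae hδ hδT
  have hDvi : IntervalIntegrable (fun t => S.D (v t)) volume δ T := by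
    rw [intervalIntegrable_iff_integrableOn_Ioc_of_le hδT] at hvi ⊢
    exact S.D.integrable_comp hvi
  have h1 : Tendsto (fun n => ∫ t in δ..T, ‖S.D (rate (τ n) (w (τ n)) t) - S.D (v t)‖) atTop
      (𝓝 0) := by
    have h2 := intervalIntegral.tendsto_integral_filter_of_dominated_convergence (μ := volume)
      (a := δ) (b := T) (l := atTop) (f := fun _ => (0 : ℝ))
      (F := fun n t => ‖S.D (rate (τ n) (w (τ n)) t) - S.D (v t)‖) (fun _ => 4 * ‖x₀‖ / δ)
      (.of_forall fun n => by
        have := ((IsScheme.intervalIntegrable_D_rate (S := S) (hτ n) (w (τ n)) δ T).sub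
          hDvi).norm
        rw [intervalIntegrable_iff] at this
        exact this.aestronglyMeasurable)
      (.of_forall fun n => by
        rw [uIoc_of_le hδT, ← ae_restrict_iff' measurableSet_Ioc]
        filter_upwards [ae_restrict_of_ae_restrict_of_subset hsub (h.norm_D_velocity_le hτ hae),
          ae_restrict_mem measurableSet_Ioc] with t ht htm
        have h0 := hδ.trans htm.1
        have h3 := h.norm_D_rate_le (hτ n) h0
        rw [norm_norm]
        calc _ ≤ 2 * ‖x₀‖ / t + 2 * ‖x₀‖ / t := (norm_sub_le _ _).trans (add_le_add h3 ht)
          _ = 4 * ‖x₀‖ / t := by ring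
          _ ≤ _ := by gcongr; exact htm.1.le)
      intervalIntegrable_const (by
        rw [uIoc_of_le hδT, ← ae_restrict_iff' measurableSet_Ioc]
        filter_upwards [ae_restrict_of_ae_restrict_of_subset hsub hae] with t ht
        have := ((S.D.continuous.tendsto _).comp ht).sub_const (S.D (v t))
        simpa using this.norm)
    simpa using h2
  rw [Metric.tendsto_nhds]
  intro ε hε
  obtain ⟨η, hη, H⟩ := S.exists_forall_integral_norm_rate_sub_le x₀ hδ hδT (half_pos hε)
  obtain ⟨n, hn1, hn2⟩ := ((h1.eventually (gt_mem_nhds (half_pos hε))).and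
    (hτ0.eventually (gt_mem_nhds hη))).exists
  filter_upwards [Ioo_mem_nhdsGT hη] with σ hσ
  have h3 := H σ (τ n) hσ.1 hσ.2 (hτ n) hn2 _ _ (h σ hσ.1).1 (h _ (hτ n)).1 (h σ hσ.1).2
    (h _ (hτ n)).2
  have i1 := IsScheme.intervalIntegrable_D_rate (S := S) hσ.1 (w σ) δ T
  have i2 := IsScheme.intervalIntegrable_D_rate (S := S) (hτ n) (w (τ n)) δ T
  have h4 := intervalIntegral.integral_mono_on hδT (i1.sub hDvi).norm
    ((i1.sub i2).norm.add (i2.sub hDvi).norm) (fun t _ => by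
      have := norm_add_le (S.D (rate σ (w σ) t) - S.D (rate (τ n) (w (τ n)) t))
        (S.D (rate (τ n) (w (τ n)) t) - S.D (v t))
      simpa using this)
  rw [intervalIntegral.integral_add (i1.sub i2).norm (i2.sub hDvi).norm] at h4
  rw [Real.dist_0_eq_abs, abs_of_nonneg (intervalIntegral.integral_nonneg hδT fun _ _ => norm_nonneg _)]
  linarith

/-- Convergence of gradients in `L¹` gives almost everywhere convergence along subsequences, which
lifts to `V` at each time by `tendsto_of_isReduced`. The gradient bound also dominates the reduced
velocities. -/
theorem tendsto_integral_norm_rate_sub (h : S.IsFamily x₀ w) (hτ : ∀ n, 0 < τ n)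
    (hτ0 : Tendsto τ atTop (𝓝 0))
    (hae : ∀ᵐ t ∂(volume.restrict (Ioi (0 : ℝ))),
      Tendsto (fun n => rate (τ n) (w (τ n)) t) atTop (𝓝 (v t))) {δ T : ℝ} (hδ : 0 < δ)
    (hδT : δ ≤ T) :
    Tendsto (fun σ => ∫ t in δ..T, ‖rate σ (w σ) t - v t‖) (𝓝[>] 0) (𝓝 0) := by
  have hsub : Ioc δ T ⊆ Ioi 0 := fun t ht => hδ.trans ht.1
  have hvi := h.intervalIntegrable_velocity hτ hae hδ hδT
  have hDvi : IntervalIntegrable (fun t => S.D (v t)) volume δ T := by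
    rw [intervalIntegrable_iff_integrableOn_Ioc_of_le hδT] at hvi ⊢
    exact S.D.integrable_comp hvi
  have hred := ae_restrict_of_ae_restrict_of_subset hsub (h.isReduced_velocity hτ hae)
  obtain ⟨C, hC, hle⟩ := S.exists_isReduced_norm_le
  refine tendsto_of_subseq_tendsto fun σ hσ => ?_
  have hσpos : ∀ᶠ n in atTop, 0 < σ n := hσ.eventually self_mem_nhdsWithin
  obtain ⟨N, hN⟩ := eventually_atTop.1 hσpos
  set ρ : ℕ → ℝ := fun n => σ (n + N) with hρ
  have hρpos : ∀ n, 0 < ρ n := fun n => hN _ (Nat.le_add_left N n)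
  have hρσ : Tendsto ρ atTop (𝓝[>] 0) := hσ.comp (tendsto_add_atTop_nat N)
  have hL := (h.tendsto_integral_norm_D_rate_sub hτ hτ0 hae hδ hδT).comp hρσ
  have hmeas : TendstoInMeasure (volume.restrict (Ioc δ T))
      (fun n t => S.D (rate (ρ n) (w (ρ n)) t)) atTop (fun t => S.D (v t)) := by
    refine tendstoInMeasure_of_tendsto_eLpNorm one_ne_zero (fun n => ?_) ?_ ?_
    · exact (S.D.continuous.comp_stronglyMeasurable
        (stronglyMeasurable_rate _ _)).aestronglyMeasurable
    · exact ((intervalIntegrable_iff_integrableOn_Ioc_of_le hδT).1 hDvi).aestronglyMeasurable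
    · have h2 := (ENNReal.continuous_ofReal.tendsto 0).comp hL
      rw [ENNReal.ofReal_zero] at h2
      refine h2.congr fun n => ?_
      exact (eLpNorm_one_restrict_Ioc hδT
        ((IsScheme.intervalIntegrable_D_rate (S := S) (hρpos n) (w (ρ n)) δ T).sub hDvi)).symm
  obtain ⟨ns, hns, hnsae⟩ := hmeas.exists_seq_tendsto_ae
  refine ⟨fun n => ns n + N, ?_⟩
  have h2 := intervalIntegral.tendsto_integral_filter_of_dominated_convergence (μ := volume)
      (a := δ) (b := T) (l := atTop) (f := fun _ => (0 : ℝ))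
      (F := fun n t => ‖rate (ρ (ns n)) (w (ρ (ns n))) t - v t‖) (fun _ => C * (4 * ‖x₀‖) / δ)
      (.of_forall fun n => by
        have := ((intervalIntegrable_rate (hρpos (ns n)) (w (ρ (ns n))) δ T).sub hvi).norm
        rw [intervalIntegrable_iff] at this
        exact this.aestronglyMeasurable)
      (.of_forall fun n => by
        rw [uIoc_of_le hδT, ← ae_restrict_iff' measurableSet_Ioc]
        filter_upwards [ae_restrict_of_ae_restrict_of_subset hsub (h.norm_D_velocity_le hτ hae),
          hred, ae_restrict_mem measurableSet_Ioc] with t ht htr htm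
        have h0 := hδ.trans htm.1
        have h3 := h.norm_D_rate_le (hρpos (ns n)) h0
        have h4 := hle _ (h.isReduced_rate (hρpos (ns n)) t)
        have h5 := hle _ htr
        rw [norm_norm]
        calc _ ≤ C * (2 * ‖x₀‖ / t) + C * (2 * ‖x₀‖ / t) :=
              (norm_sub_le _ _).trans (add_le_add (h4.trans (by gcongr)) (h5.trans (by gcongr)))
          _ = C * (4 * ‖x₀‖) / t := by ring
          _ ≤ _ := by gcongr; exact htm.1.le)
      intervalIntegrable_const (by
        rw [uIoc_of_le hδT, ← ae_restrict_iff' measurableSet_Ioc]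
        filter_upwards [hnsae, hred] with t ht htr
        have := (tendsto_of_isReduced (fun n => h.isReduced_rate (hρpos (ns n)) t) htr
          ht).sub_const (v t)
        simpa using this.norm)
  simpa using h2

/-- The interpolants form a Cauchy family, uniformly on `[0, T]`. -/
theorem uniformCauchySeqOn (h : S.IsFamily x₀ w) (hτ : ∀ n, 0 < τ n)
    (hτ0 : Tendsto τ atTop (𝓝 0))
    (hae : ∀ᵐ t ∂(volume.restrict (Ioi (0 : ℝ))),
      Tendsto (fun n => rate (τ n) (w (τ n)) t) atTop (𝓝 (v t))) {T : ℝ} (hT : 0 < T) :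
    UniformCauchySeqOn (fun σ t => affineInterp σ (w σ) t) (𝓝[>] 0) (Icc 0 T) := by
  obtain ⟨C, hC, hn⟩ := S.exists_norm_le
  obtain ⟨a, ha, hp⟩ := S.exists_p_le
  intro u hu
  obtain ⟨ε, hε, hεu⟩ := Metric.mem_uniformity_dist.1 hu
  set q := ε / (16 * C * (‖x₀‖ + 1)) with hq
  have hq0 : 0 < q := by positivity
  -- Up to time `δ` the Hölder estimate makes both interpolants small in `p`; beyond it their
  -- difference is controlled by integrating the velocities.
  set δ := min T (q ^ 2) with hδd
  have hδ : 0 < δ := lt_min hT (by positivity)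
  have hδT : δ ≤ T := min_le_left _ _
  have hsq : ∀ t, t ≤ δ → ‖x₀‖ * Real.sqrt t ≤ ε / (16 * C) := by
    intro t ht
    have h1 : Real.sqrt t ≤ q := Real.sqrt_le_iff.2 ⟨hq0.le, ht.trans (min_le_right _ _)⟩
    calc ‖x₀‖ * Real.sqrt t ≤ (‖x₀‖ + 1) * q := by gcongr; linarith
      _ = _ := by rw [hq]; field_simp
  obtain ⟨η, hη, H⟩ := S.exists_forall_norm_D_affineInterp_sub_le x₀ hT.le
    (show 0 < ε / (4 * C) by positivity)
  have hI := h.tendsto_integral_norm_rate_sub hτ hτ0 hae hδ hδT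
  have hP : ∀ᶠ σ in 𝓝[>] (0 : ℝ), (0 < σ ∧ σ < η) ∧
      ∫ t in δ..T, ‖rate σ (w σ) t - v t‖ < ε / (16 * C * a) :=
    (show ∀ᶠ σ in 𝓝[>] (0 : ℝ), 0 < σ ∧ σ < η from Ioo_mem_nhdsGT hη).and
      (hI.eventually (gt_mem_nhds (by positivity)))
  filter_upwards [hP.prod_mk hP] with ⟨σ, ρ⟩ ⟨⟨hσ, hσI⟩, hρ, hρI⟩ t ht
  refine hεu ?_
  rw [dist_eq_norm]
  simp only at hσ hσI hρ hρI ⊢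
  have hD := H σ ρ hσ.1 hσ.2 hρ.1 hρ.2 _ _ (h σ hσ.1).1 (h ρ hρ.1).1 (h σ hσ.1).2 (h ρ hρ.1).2 t ht
  rw [← map_sub] at hD
  have small : ∀ r, 0 ≤ r → r ≤ δ →
      S.p (affineInterp σ (w σ) r - affineInterp ρ (w ρ) r) ≤ ε / (8 * C) := by
    intro r hr hrδ
    have h1 := (h σ hσ.1).1.p_affineInterp_sub_le hσ.1 hr
    have h2 := (h ρ hρ.1).1.p_affineInterp_sub_le hρ.1 hr
    rw [(h σ hσ.1).2, map_zero, add_zero, sub_zero] at h1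
    rw [(h ρ hρ.1).2, map_zero, add_zero, sub_zero] at h2
    have h3 := hsq r hrδ
    calc _ ≤ _ := map_sub_le_add S.p _ _
      _ ≤ ε / (16 * C) + ε / (16 * C) := by linarith
      _ = _ := by field_simp; norm_num
  have hpd : S.p (affineInterp σ (w σ) t - affineInterp ρ (w ρ) t) ≤ ε / (4 * C) := by
    rcases le_total t δ with htδ | htδ
    · refine (small t ht.1 htδ).trans ?_
      gcongr; norm_num
    · have e : affineInterp σ (w σ) t - affineInterp ρ (w ρ) t
          = (affineInterp σ (w σ) δ - affineInterp ρ (w ρ) δ)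
            + ∫ r in δ..t, (rate σ (w σ) r - rate ρ (w ρ) r) := by
        rw [intervalIntegral.integral_sub (intervalIntegrable_rate hσ.1 _ _ _)
          (intervalIntegrable_rate hρ.1 _ _ _), ← affineInterp_sub hσ.1 _ hδ.le ht.1,
          ← affineInterp_sub hρ.1 _ hδ.le ht.1]
        abel
      have hvi := h.intervalIntegrable_velocity hτ hae hδ hδT
      have i1 := ((intervalIntegrable_rate hσ.1 (w σ) δ T).sub hvi).norm
      have i2 := ((intervalIntegrable_rate hρ.1 (w ρ) δ T).sub hvi).norm
      have hint : ‖∫ r in δ..t, (rate σ (w σ) r - rate ρ (w ρ) r)‖ ≤ ε / (8 * C * a) := by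
        have h1 := intervalIntegral.norm_integral_le_integral_norm (μ := volume) (a := δ) (b := t)
          (f := fun r => rate σ (w σ) r - rate ρ (w ρ) r) htδ
        have h2 : ∫ r in δ..t, ‖rate σ (w σ) r - rate ρ (w ρ) r‖
            ≤ ∫ r in δ..T, ‖rate σ (w σ) r - rate ρ (w ρ) r‖ :=
          intervalIntegral.integral_mono_interval le_rfl htδ ht.2 (.of_forall fun _ => norm_nonneg _)
            ((intervalIntegrable_rate hσ.1 _ _ _).sub (intervalIntegrable_rate hρ.1 _ _ _)).norm
        have h3 := intervalIntegral.integral_mono_on hδT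
          ((intervalIntegrable_rate hσ.1 (w σ) δ T).sub (intervalIntegrable_rate hρ.1 (w ρ) δ T)).norm
          (i1.add i2) (fun r _ => by
            have := norm_sub_le (rate σ (w σ) r - v r) (rate ρ (w ρ) r - v r)
            simpa using this)
        rw [intervalIntegral.integral_add i1 i2] at h3
        have h4 : ε / (16 * C * a) + ε / (16 * C * a) = ε / (8 * C * a) := by field_simp; norm_num
        linarith
      rw [e]
      calc _ ≤ _ := map_add_le_add S.p _ _
        _ ≤ ε / (8 * C) + a * (ε / (8 * C * a)) :=
          add_le_add (small δ hδ.le le_rfl) ((hp _).trans (by gcongr))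
        _ = _ := by field_simp; norm_num
  calc _ ≤ _ := hn _
    _ ≤ C * (ε / (4 * C) + ε / (4 * C)) := by gcongr
    _ = ε / 2 := by field_simp; norm_num
    _ < ε := by linarith

theorem exists_tendstoUniformlyOn (h : S.IsFamily x₀ w) (hτ : ∀ n, 0 < τ n)
    (hτ0 : Tendsto τ atTop (𝓝 0))
    (hae : ∀ᵐ t ∂(volume.restrict (Ioi (0 : ℝ))),
      Tendsto (fun n => rate (τ n) (w (τ n)) t) atTop (𝓝 (v t))) :
    ∃ W : ℝ → V, ∀ T, TendstoUniformlyOn (fun σ t => affineInterp σ (w σ) t) W (𝓝[>] 0)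
      (Icc 0 T) := by
  have hex : ∀ t : ℝ, ∃ W : V, 0 ≤ t → Tendsto (fun σ => affineInterp σ (w σ) t) (𝓝[>] 0) (𝓝 W) := by
    intro t
    by_cases ht : 0 ≤ t
    · have hc := (h.uniformCauchySeqOn hτ hτ0 hae (show 0 < t + 1 by linarith)).cauchy_map
        (x := t) ⟨ht, by linarith⟩
      obtain ⟨W, hW⟩ := CompleteSpace.complete hc
      exact ⟨W, fun _ => hW⟩
    · exact ⟨0, fun h => absurd h ht⟩
  choose W hW using hex
  refine ⟨W, fun T => ?_⟩
  have hT : 0 < max T 1 := lt_max_of_lt_right one_pos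
  exact ((h.uniformCauchySeqOn hτ hτ0 hae hT).tendstoUniformlyOn_of_tendsto
    fun t ht => hW t ht.1).mono (Icc_subset_Icc_right (le_max_left _ _))

end IsFamily

/-- The evolution in the abstract setting. -/
structure IsEvolution (S : Setting V F) (x₀ : F) (W v : ℝ → V) : Prop where
  continuousOn : ContinuousOn W (Ici 0)
  initial : W 0 = 0
  integral : ∀ s t : ℝ, 0 < s → s ≤ t →
    IntervalIntegrable v volume s t ∧ W t - W s = ∫ r in s..t, v r
  rel : ∀ᵐ t ∂(volume.restrict (Ioi (0 : ℝ))), S.Rel (x₀ + S.D (W t)) (v t)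

/-- Locally uniform convergence gives the limit curve, `L¹` convergence of rates identifies its
derivative, and almost everywhere convergence passes to the limit in `Rel` and in the monotonicity
of the speed. -/
theorem IsFamily.exists_isEvolution (h : S.IsFamily x₀ w) :
    ∃ W v : ℝ → V, S.IsEvolution x₀ W v ∧ (∀ t > 0, MemLp v 2 (volume.restrict (Ioi t))) ∧
      (∀ T, TendstoUniformlyOn (fun σ t => affineInterp σ (w σ) t) W (𝓝[>] 0) (Icc 0 T)) ∧
      ∃ N : Set ℝ, volume N = 0 ∧ AntitoneOn (fun t => ‖S.D (v t)‖) (Ioi 0 \ N) := by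
  obtain ⟨τ, v, hτ, hτ0, hae⟩ := h.exists_seq_tendsto_rate
  obtain ⟨W, hW⟩ := h.exists_tendstoUniformlyOn hτ hτ0 hae
  have hτ0' : Tendsto τ atTop (𝓝[>] 0) :=
    tendsto_nhdsWithin_iff.2 ⟨hτ0, .of_forall hτ⟩
  have hpt : ∀ t, 0 ≤ t → Tendsto (fun σ => affineInterp σ (w σ) t) (𝓝[>] 0) (𝓝 (W t)) :=
    fun t ht => (hW t).tendsto_at ⟨ht, le_rfl⟩
  refine ⟨W, v, ⟨?_, ?_, ?_, ?_⟩, ?_, hW, ?_⟩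
  · intro t ht
    have hc : ContinuousOn W (Icc 0 (t + 1)) := by
      refine (hW (t + 1)).continuousOn (Eventually.frequently ?_)
      filter_upwards [self_mem_nhdsWithin] with σ hσ
      exact (continuousOn_affineInterp hσ (w σ)).mono Icc_subset_Ici_self
    refine (hc t ⟨ht, by linarith⟩).mono_of_mem_nhdsWithin ?_
    rw [← Ici_inter_Iic]
    exact inter_mem_nhdsWithin _ (Iic_mem_nhds (by linarith))
  · refine tendsto_nhds_unique (hpt 0 le_rfl) (tendsto_const_nhds.congr' ?_)
    filter_upwards [self_mem_nhdsWithin] with σ hσ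
    rw [affineInterp_zero, (h σ hσ).2]
  · intro s t hs hst
    have hvi := h.intervalIntegrable_velocity hτ hae hs hst
    refine ⟨hvi, ?_⟩
    have h1 := (hpt t (hs.le.trans hst)).sub (hpt s hs.le)
    have h2 := h.tendsto_integral_norm_rate_sub hτ hτ0 hae hs hst
    have h3 : Tendsto (fun σ => ∫ r in s..t, rate σ (w σ) r) (𝓝[>] 0) (𝓝 (∫ r in s..t, v r)) := by
      rw [tendsto_iff_norm_sub_tendsto_zero]
      refine squeeze_zero' (.of_forall fun _ => norm_nonneg _) ?_ h2
      filter_upwards [self_mem_nhdsWithin] with σ hσ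
      rw [← intervalIntegral.integral_sub (intervalIntegrable_rate hσ _ _ _) hvi]
      exact intervalIntegral.norm_integral_le_integral_norm hst
    refine tendsto_nhds_unique h1 (h3.congr' ?_)
    filter_upwards [self_mem_nhdsWithin] with σ hσ
    exact (affineInterp_sub hσ _ hs.le (hs.le.trans hst)).symm
  · filter_upwards [hae, ae_restrict_mem measurableSet_Ioi] with t ht h0
    have h0' : (0 : ℝ) < t := h0
    refine Rel.of_tendsto (l := atTop)
      (x := fun n => x₀ + S.D (w (τ n) (⌊t / τ n⌋₊ + 1))) (v := fun n => rate (τ n) (w (τ n)) t)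
      (.of_forall fun n => (h (τ n) (hτ n)).1 _) (Tendsto.const_add _ ?_) ht
    have h1 := (S.D.continuous.tendsto _).comp ((hpt t h0'.le).comp hτ0')
    -- The relation holds at the right node, whose distance to the interpolant is at most `τ` times
    -- the speed at time `t`.
    have h2 : Tendsto (fun n => S.D (w (τ n) (⌊t / τ n⌋₊ + 1))
        - S.D (affineInterp (τ n) (w (τ n)) t)) atTop (𝓝 0) := by
      refine squeeze_zero_norm (a := fun n => τ n * (2 * ‖x₀‖ / t)) (fun n => ?_) (by
        simpa using hτ0.mul_const (2 * ‖x₀‖ / t))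
      have h3 := floor_mul_le (hτ n) h0'.le
      have h4 := lt_floor_add_one_mul (t := t) (hτ n)
      have h5 := h.norm_D_rate_le (hτ n) h0'
      have hn0 := (hτ n).ne'
      rw [← map_sub]
      have e : w (τ n) (⌊t / τ n⌋₊ + 1) - affineInterp (τ n) (w (τ n)) t
          = ((⌊t / τ n⌋₊ + 1) * τ n - t) • rate (τ n) (w (τ n)) t := by
        simp only [affineInterp, rate, smul_smul]
        have : ((⌊t / τ n⌋₊ + 1) * τ n - t) * (τ n)⁻¹ = 1 - (t / τ n - ⌊t / τ n⌋₊) := by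
          field_simp; ring
        rw [this]; module
      rw [e, map_smul, norm_smul, Real.norm_of_nonneg (by linarith)]
      gcongr
      · exact (hτ n).le
      · nlinarith
    have h3 := h2.add h1
    simpa using h3
  · intro t ht
    obtain ⟨C, hC⟩ := h.exists_norm_velocity_le hτ hae
    exact memLp_two_of_norm_le_div (aestronglyMeasurable_velocity hae) hC ht
  · rw [ae_restrict_iff' measurableSet_Ioi] at hae
    refine ⟨_, hae, fun s hs t ht hst => ?_⟩
    have h1 : ∀ r ∈ Ioi (0 : ℝ) \ {a | ¬(a ∈ Ioi (0 : ℝ) →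
        Tendsto (fun n => rate (τ n) (w (τ n)) a) atTop (𝓝 (v a)))},
        Tendsto (fun n => rate (τ n) (w (τ n)) r) atTop (𝓝 (v r)) := by
      intro r hr
      by_contra hcon
      exact hr.2 fun h => hcon (h hr.1)
    refine le_of_tendsto_of_tendsto' ((S.D.continuous.tendsto _).comp (h1 t ht)).norm
      ((S.D.continuous.tendsto _).comp (h1 s hs)).norm fun n => ?_
    exact (h (τ n) (hτ n)).1.norm_rate_antitone (hτ n) hst

/-- Dissipativity makes the gradient difference non-increasing, and it tends to `0` at time `0`. The
velocities then have equal gradients and, being reduced, agree almost everywhere. -/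
theorem IsEvolution.eqOn {W v W' v' : ℝ → V} (h : S.IsEvolution x₀ W v)
    (h' : S.IsEvolution x₀ W' v') : EqOn W' W (Ici 0) := by
  set Z := fun t => S.D (W' t) - S.D (W t) with hZ
  have hvi : ∀ s t : ℝ, 0 < s → s ≤ t → IntervalIntegrable (fun r => S.D (v' r) - S.D (v r))
      volume s t := fun s t hs hst => by
    have h1 := (h.integral s t hs hst).1
    have h2 := (h'.integral s t hs hst).1
    rw [intervalIntegrable_iff_integrableOn_Ioc_of_le hst] at *
    exact (S.D.integrable_comp h2).sub (S.D.integrable_comp h1)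
  have hint : ∀ s t : ℝ, 0 < s → s ≤ t → Z t - Z s = ∫ r in s..t, (S.D (v' r) - S.D (v r)) := by
    intro s t hs hst
    have h1 := h.integral s t hs hst
    have h2 := h'.integral s t hs hst
    have e : (fun r => S.D (v' r) - S.D (v r)) = fun r => S.D (v' r - v r) := by
      funext r; rw [map_sub]
    rw [e, S.D.intervalIntegral_comp_comm (h2.1.sub h1.1),
      intervalIntegral.integral_sub h2.1 h1.1, ← h1.2, ← h2.2]
    simp only [hZ, map_sub]; abel
  have hmono : ∀ s t : ℝ, 0 < s → s ≤ t → ‖Z t‖ ≤ ‖Z s‖ := by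
    intro s t hs hst
    have hsub : Icc s t ⊆ Ioi 0 := fun r hr => hs.trans_le hr.1
    have := norm_sq_le_of_inner_deriv_le (w := Z) (β := 0) hst (hvi s t hs hst)
      (fun a b ha hab _ => hint a b (hs.trans_le ha) hab) (by
        filter_upwards [ae_restrict_of_ae_restrict_of_subset hsub h.rel,
          ae_restrict_of_ae_restrict_of_subset hsub h'.rel] with r h1 h2
        have := h2.inner_sub_le h1
        rwa [add_sub_add_left_eq_sub] at this)
    simp only [mul_zero, zero_mul, add_zero] at this
    exact le_of_sq_le_sq this (norm_nonneg _)
  have hZ0 : Tendsto (fun s => ‖Z s‖) (𝓝[>] 0) (𝓝 0) := by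
    have h1 := (h.continuousOn 0 self_mem_Ici).mono_left (nhdsWithin_mono 0 Ioi_subset_Ici_self)
    have h2 := (h'.continuousOn 0 self_mem_Ici).mono_left (nhdsWithin_mono 0 Ioi_subset_Ici_self)
    have h3 := ((S.D.continuous.tendsto _).comp h2).sub ((S.D.continuous.tendsto _).comp h1)
    rw [h.initial, h'.initial, sub_self] at h3
    simpa using h3.norm
  have hZt : ∀ t, 0 < t → Z t = 0 := by
    intro t ht
    refine norm_le_zero_iff.1 (ge_of_tendsto hZ0 ?_)
    filter_upwards [Ioo_mem_nhdsGT ht] with s hs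
    exact hmono s t hs.1 hs.2.le
  have hv : ∀ᵐ t ∂(volume.restrict (Ioi (0 : ℝ))), v' t = v t := by
    have h1 := ae_eq_zero_of_forall_integral_eq_zero (g := fun r => S.D (v' r) - S.D (v r))
      fun s t hs hst => ⟨hvi s t hs hst, by
        rw [← hint s t hs hst, hZt s hs, hZt t (hs.trans_le hst), sub_zero]⟩
    filter_upwards [h1, h.rel, h'.rel] with t ht h2 h3
    exact h3.isReduced.eq_of_D_eq h2.isReduced (sub_eq_zero.1 ht)
  have hconst : ∀ s t : ℝ, 0 < s → s ≤ t → W' t - W t = W' s - W s := by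
    intro s t hs hst
    have h1 := (h.integral s t hs hst).2
    have h2 := (h'.integral s t hs hst).2
    have h3 : ∫ r in s..t, v' r = ∫ r in s..t, v r := by
      apply intervalIntegral.integral_congr_ae
      rw [uIoc_of_le hst]
      rw [ae_restrict_iff' measurableSet_Ioi] at hv
      filter_upwards [hv] with r hr hm using hr (hs.trans hm.1)
    rw [h3, ← h1] at h2
    rw [sub_eq_sub_iff_sub_eq_sub]; exact h2
  intro t ht
  rcases (show (0 : ℝ) ≤ t from ht).eq_or_lt with rfl | h0
  · rw [h.initial, h'.initial]
  · have h1 := (h.continuousOn 0 self_mem_Ici).mono_left (nhdsWithin_mono 0 Ioi_subset_Ici_self)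
    have h2 := (h'.continuousOn 0 self_mem_Ici).mono_left (nhdsWithin_mono 0 Ioi_subset_Ici_self)
    have h3 := h2.sub h1
    rw [h.initial, h'.initial, sub_self] at h3
    refine sub_eq_zero.1 (tendsto_nhds_unique (tendsto_const_nhds.congr' ?_) h3)
    filter_upwards [Ioo_mem_nhdsGT h0] with s hs
    exact hconst s t hs.1 hs.2.le

end Setting
end L1Flow

/-! ### Transfer to an affine space `u₀ + V` inside a larger Hilbert space. -/

namespace L1Flow
namespace Setting

variable {H F : Type*} [NormedAddCommGroup H] [InnerProductSpace ℝ H] [CompleteSpace H]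
  [NormedAddCommGroup F] [InnerProductSpace ℝ F] [CompleteSpace F]
  {V : Submodule ℝ H} [CompleteSpace V]

/-- The evolution in `u₀ + V`, for a closed subspace `V` of a Hilbert space. -/
structure IsFlowIn (S : Setting V F) (G : H →L[ℝ] F) (u₀ : H) (u v : ℝ → H) : Prop where
  continuousOn : ContinuousOn u (Ici 0)
  initial : u 0 = u₀
  mem : ∀ t, 0 ≤ t → u t - u₀ ∈ V
  integral : ∀ s t : ℝ, 0 < s → s ≤ t →
    IntervalIntegrable v volume s t ∧ u t - u s = ∫ r in s..t, v r
  rel : ∀ᵐ t ∂(volume.restrict (Ioi (0 : ℝ))), ∀ z : V, (z : H) = v t → S.Rel (G (u t)) z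

/-- Minimizing movements in `u₀ + V`. -/
structure IsMinMovIn (V : Submodule ℝ H) (G : H →L[ℝ] F) (q : Seminorm ℝ H) (u₀ : H) (τ : ℝ)
    (U : ℕ → H) : Prop where
  initial : U 0 = u₀
  mem : ∀ n, U n - u₀ ∈ V
  minimal : ∀ n z, z - u₀ ∈ V →
    ‖G (U (n + 1))‖ ^ 2 / 2 + q (U (n + 1) - U n) ^ 2 / (2 * τ)
      ≤ ‖G z‖ ^ 2 / 2 + q (z - U n) ^ 2 / (2 * τ)

variable {S : Setting V F} {G : H →L[ℝ] F} {q : Seminorm ℝ H} {u₀ : H}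

theorem rel_iff (hD : ∀ w : V, S.D w = G w) (hp : ∀ w : V, S.p w = q w) {x : F} {z : V} :
    S.Rel x z ↔ (∀ φ ∈ V, |inner ℝ x (G φ)| ≤ q z * q φ) ∧ inner ℝ x (G z) = - q z ^ 2 := by
  constructor
  · intro h
    refine ⟨fun φ hφ => ?_, ?_⟩
    · simpa only [hD, hp] using h.abs_inner_le ⟨φ, hφ⟩
    · simpa only [hD, hp] using h.inner_eq
  · rintro ⟨h1, h2⟩
    refine ⟨fun φ => ?_, ?_⟩
    · rw [hD, hp, hp]; exact h1 φ φ.2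
    · rw [hD, hp]; exact h2

theorem IsMinMovIn.isStep (hD : ∀ w : V, S.D w = G w) (hp : ∀ w : V, S.p w = q w) {τ : ℝ}
    {U : ℕ → H} (h : IsMinMovIn V G q u₀ τ U) (n : ℕ) :
    S.IsStep (G u₀) τ ⟨U n - u₀, h.mem n⟩ ⟨U (n + 1) - u₀, h.mem (n + 1)⟩ := by
  intro z
  have h1 := h.minimal n (u₀ + z) (by rw [add_sub_cancel_left]; exact z.2)
  simp only [map_add] at h1
  simp only [hD, hp, map_sub, Submodule.coe_sub, add_sub_cancel, sub_sub_sub_cancel_right]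
  rw [sub_sub_eq_add_sub, add_comm (z : H) u₀]
  exact h1

theorem isMinMovIn_of_isStep (hD : ∀ w : V, S.D w = G w) (hp : ∀ w : V, S.p w = q w) {τ : ℝ}
    {w : ℕ → V} (h0 : w 0 = 0) (h : ∀ n, S.IsStep (G u₀) τ (w n) (w (n + 1))) :
    IsMinMovIn V G q u₀ τ fun n => u₀ + w n := by
  refine ⟨by simp [h0], fun n => by rw [add_sub_cancel_left]; exact (w n).2, fun n z hz => ?_⟩
  have h1 := h n ⟨z - u₀, hz⟩
  simp only [hD, hp, map_sub, Submodule.coe_sub, add_sub_cancel] at h1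
  rw [sub_sub] at h1
  simp only [map_add, add_sub_add_left_eq_sub]
  exact h1

theorem IsFlowIn.exists_isEvolution (hD : ∀ w : V, S.D w = G w) {u v : ℝ → H}
    (hf : S.IsFlowIn G u₀ u v) :
    ∃ W v' : ℝ → V, S.IsEvolution (G u₀) W v' ∧ ∀ t, 0 ≤ t → (W t : H) = u t - u₀ := by
  set P := V.orthogonalProjectionOnto with hP
  have hWc : ∀ t, 0 ≤ t → (P (u t - u₀) : H) = u t - u₀ := fun t ht =>
    Submodule.starProjection_eq_self_iff.2 (hf.mem t ht)
  -- The relation in `IsFlowIn` is conditional on `v t ∈ V`. Membership follows almost everywhere: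
  -- increments of `u` lie in `V`, so the part of `v` orthogonal to `V` integrates to zero over
  -- every interval.
  have hvc : ∀ᵐ t ∂(volume.restrict (Ioi (0 : ℝ))), (P (v t) : H) = v t := by
    have h1 := ae_eq_zero_of_forall_integral_eq_zero
      (g := fun t => v t - V.starProjection (v t)) fun s t hs hst => by
        obtain ⟨h1, h2⟩ := hf.integral s t hs hst
        have h3 : IntervalIntegrable (fun r => V.starProjection (v r)) volume s t := by
          rw [intervalIntegrable_iff_integrableOn_Ioc_of_le hst] at h1 ⊢
          exact V.starProjection.integrable_comp h1
        refine ⟨h1.sub h3, ?_⟩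
        rw [intervalIntegral.integral_sub h1 h3,
          V.starProjection.intervalIntegral_comp_comm h1, ← h2, sub_eq_zero, eq_comm]
        refine Submodule.starProjection_eq_self_iff.2 ?_
        have := V.sub_mem (hf.mem t (hs.le.trans hst)) (hf.mem s hs.le)
        rwa [sub_sub_sub_cancel_right] at this
    filter_upwards [h1] with t ht
    exact (sub_eq_zero.1 ht).symm
  refine ⟨fun t => P (u t - u₀), fun t => P (v t), ⟨?_, ?_, ?_, ?_⟩, hWc⟩
  · exact P.continuous.comp_continuousOn (hf.continuousOn.sub continuousOn_const)
  · simp [hf.initial]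
  · intro s t hs hst
    obtain ⟨h1, h2⟩ := hf.integral s t hs hst
    refine ⟨?_, ?_⟩
    · rw [intervalIntegrable_iff_integrableOn_Ioc_of_le hst] at h1 ⊢
      exact P.integrable_comp h1
    · rw [P.intervalIntegral_comp_comm h1, ← h2]
      simp only [← map_sub, sub_sub_sub_cancel_right]
  · filter_upwards [hf.rel, hvc, ae_restrict_mem measurableSet_Ioi] with t ht h1 h0
    rw [hD, ← map_add, hWc t (le_of_lt h0), add_sub_cancel]
    exact ht _ h1

theorem IsEvolution.isFlowIn (hD : ∀ w : V, S.D w = G w) {W v : ℝ → V}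
    (hev : S.IsEvolution (G u₀) W v) :
    S.IsFlowIn G u₀ (fun t => u₀ + W t) (fun t => v t) := by
  refine ⟨?_, ?_, ?_, ?_, ?_⟩
  · exact continuousOn_const.add (continuous_subtype_val.comp_continuousOn hev.continuousOn)
  · simp [hev.initial]
  · intro t _
    rw [add_sub_cancel_left]; exact (W t).2
  · intro s t hs hst
    obtain ⟨h1, h2⟩ := hev.integral s t hs hst
    refine ⟨?_, ?_⟩
    · rw [intervalIntegrable_iff_integrableOn_Ioc_of_le hst] at h1 ⊢
      exact V.subtypeL.integrable_comp h1
    · have h3 := V.subtypeL.intervalIntegral_comp_comm h1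
      simp only [Submodule.subtypeL_apply] at h3
      rw [h3, ← h2, Submodule.coe_sub, add_sub_add_left_eq_sub]
  · filter_upwards [hev.rel] with t ht z hz
    rw [hD, ← map_add] at ht
    rwa [Subtype.ext hz]

theorem exists_flowIn (hD : ∀ w : V, S.D w = G w) (hp : ∀ w : V, S.p w = q w) (u₀ : H) :
    ∃ u v : ℝ → H,
      (S.IsFlowIn G u₀ u v ∧ (∀ t, v t ∈ V) ∧ ∀ t > 0, MemLp v 2 (volume.restrict (Ioi t))) ∧
      (∀ u' v' : ℝ → H, S.IsFlowIn G u₀ u' v' → EqOn u' u (Ici 0)) ∧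
      (∀ τ > 0, ∃ U : ℕ → H, IsMinMovIn V G q u₀ τ U) ∧
      (∀ U : ℝ → ℕ → H, (∀ τ > 0, IsMinMovIn V G q u₀ τ (U τ)) →
        TendstoLocallyUniformlyOn (fun τ t => affineInterp τ (U τ) t) u (𝓝[>] 0) (Ioi 0)) ∧
      (∃ N : Set ℝ, volume N = 0 ∧ AntitoneOn (fun t => ‖G (v t)‖) (Ioi 0 \ N)) := by
  have hex : ∀ τ : ℝ, ∃ w : ℕ → V, 0 < τ →
      w 0 = 0 ∧ ∀ n, S.IsStep (G u₀) τ (w n) (w (n + 1)) := by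
    intro τ
    by_cases hτ : 0 < τ
    · obtain ⟨w, hw⟩ := S.exists_isScheme (G u₀) hτ 0
      exact ⟨w, fun _ => hw⟩
    -- A default value for nonpositive steps, never used.
    · exact ⟨0, fun h => absurd h hτ⟩
  choose w hw using hex
  have hfam : S.IsFamily (G u₀) w := fun τ hτ =>
    ⟨fun n => ((hw τ hτ).2 n).rel hτ, (hw τ hτ).1⟩
  obtain ⟨W, v, hev, hmem, hconv, N, hN, hanti⟩ := hfam.exists_isEvolution
  refine ⟨fun t => u₀ + W t, fun t => v t, ⟨hev.isFlowIn hD, fun t => (v t).2, fun t ht => ?_⟩,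
    ?_, ?_, ?_, ?_⟩
  · exact V.subtypeL.comp_memLp' (hmem t ht)
  · intro u' v' hf t ht
    obtain ⟨W', v'', hev', hW'⟩ := hf.exists_isEvolution hD
    have h1 := hev.eqOn hev' ht
    have h2 := hW' t ht
    rw [h1] at h2
    simp only
    rw [h2, add_sub_cancel]
  · intro τ hτ
    exact ⟨_, isMinMovIn_of_isStep hD hp (hw τ hτ).1 (hw τ hτ).2⟩
  · intro U hU
    rw [tendstoLocallyUniformlyOn_iff_forall_isCompact isOpen_Ioi]
    intro K hK hKc
    obtain ⟨T, hT⟩ := hKc.bddAbove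
    have h1 := (hconv T).mono (show K ⊆ Icc 0 T from fun t ht => ⟨le_of_lt (hK ht), hT ht⟩)
    rw [Metric.tendstoUniformlyOn_iff] at h1 ⊢
    intro ε hε
    filter_upwards [h1 ε hε, self_mem_nhdsWithin] with τ hτ hτ0 t ht
    -- Minimizing movements are unique, so any choice coincides with the family whose limit is
    -- known.
    have huniq := (hfam τ hτ0).1.unique hτ0 (w' := fun n => ⟨U τ n - u₀, (hU τ hτ0).mem n⟩)
      (fun n => ((hU τ hτ0).isStep hD hp n).rel hτ0)
      (by rw [(hfam τ hτ0).2]; exact Subtype.ext (by simp [(hU τ hτ0).initial]))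
    have hn : ∀ n, U τ n = u₀ + w τ n := fun n => by
      rw [huniq]; simp
    have e : affineInterp τ (U τ) t = u₀ + (affineInterp τ (w τ) t : V) := by
      simp only [affineInterp, hn, Submodule.coe_add, Submodule.coe_smul,
        Submodule.coe_sub, add_sub_add_left_eq_sub, add_assoc]
    rw [e, dist_add_left]
    exact hτ t ht
  · refine ⟨N, hN, ?_⟩
    simpa only [← hD] using hanti

end Setting
end L1Flow

/-! ### The space `H¹(Ω)` and the `L¹` norm as an instance of the abstract setting. -/

namespace L1Flow

variable {d : ℕ} {Ω : Set (Eu d)}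

/-- The inclusion `H¹(Ω) → L²(Ω)`. -/
noncomputable def fnL (Ω : Set (Eu d)) : H1 Ω →L[ℝ] Lp ℝ 2 (vol Ω) :=
  (ContinuousLinearMap.fst ℝ (Lp ℝ 2 (vol Ω)) (Lp (Eu d) 2 (vol Ω))).comp
    ((WithLp.prodContinuousLinearEquiv 2 ℝ (Lp ℝ 2 (vol Ω)) (Lp (Eu d) 2 (vol Ω))).toContinuousLinearMap.comp
      (H1 Ω).subtypeL)

/-- The weak gradient `H¹(Ω) → L²(Ω; ℝ^d)`. -/
noncomputable def gradL (Ω : Set (Eu d)) : H1 Ω →L[ℝ] Lp (Eu d) 2 (vol Ω) :=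
  (ContinuousLinearMap.snd ℝ (Lp ℝ 2 (vol Ω)) (Lp (Eu d) 2 (vol Ω))).comp
    ((WithLp.prodContinuousLinearEquiv 2 ℝ (Lp ℝ 2 (vol Ω)) (Lp (Eu d) 2 (vol Ω))).toContinuousLinearMap.comp
      (H1 Ω).subtypeL)

theorem fn_eq (u : H1 Ω) : fn u = fnL Ω u := rfl

theorem norm_sq_eq (u : H1 Ω) : ‖u‖ ^ 2 = ‖fnL Ω u‖ ^ 2 + ‖gradL Ω u‖ ^ 2 :=
  WithLp.prod_norm_sq_eq_of_L2 (u : L2Pair Ω)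

theorem isWeakGrad (u : H1 Ω) : IsWeakGrad Ω (fn u) (grad u) := u.2

theorem inner_gradL (u v : H1 Ω) :
    inner ℝ (gradL Ω u) (gradL Ω v) = ∫ x in Ω, inner ℝ (grad u x) (grad v x) := L2.inner_def _ _

theorem norm_gradL_sq (u : H1 Ω) : ‖gradL Ω u‖ ^ 2 = ∫ x in Ω, ‖grad u x‖ ^ 2 := by
  rw [← real_inner_self_eq_norm_sq, inner_gradL]
  simp only [real_inner_self_eq_norm_sq]

theorem energy_eq (u : H1 Ω) : energy u = ‖gradL Ω u‖ ^ 2 / 2 := by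
  rw [energy, norm_gradL_sq]; ring

theorem gradNorm_eq (u : H1 Ω) : gradNorm u = ‖gradL Ω u‖ := by
  rw [gradNorm, ← norm_gradL_sq, Real.sqrt_sq (norm_nonneg _)]

/-- Uniqueness of the weak gradient: when the function vanishes, its weak gradient integrates to
zero against every test function. -/
theorem ext_of_fnL {u v : H1 Ω} (hΩ : IsOpen Ω) (h : fnL Ω u = fnL Ω v) : u = v := by
  rw [← sub_eq_zero]
  set w := u - v with hw
  have h0 : fnL Ω w = 0 := by rw [hw, map_sub, h, sub_self]
  have hg : gradL Ω w = 0 := by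
    have hloc : LocallyIntegrableOn (gradL Ω w : Eu d → Eu d) Ω volume := by
      intro x hx
      obtain ⟨K, hKc, hK, hKΩ⟩ := exists_compact_subset hΩ hx
      refine ⟨K, mem_nhdsWithin_of_mem_nhds (mem_interior_iff_mem_nhds.1 hK), ?_⟩
      have hm : MemLp (gradL Ω w : Eu d → Eu d) 2 (volume.restrict K) :=
        (Lp.memLp (gradL Ω w)).mono_measure (Measure.restrict_mono hKΩ le_rfl)
      have : IsFiniteMeasure (volume.restrict K) := ⟨by simpa using hKc.measure_lt_top⟩
      exact hm.integrable one_le_two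
    have hae := hΩ.ae_eq_zero_of_integral_contDiff_smul_eq_zero hloc (fun φ h1 h2 h3 => by
      have ht : IsTest Ω φ := ⟨h1, h2, h3⟩
      have hint : Integrable (fun x => φ x • (gradL Ω w : Eu d → Eu d) x) volume := by
        have h4 : MemLp (fun x => φ x • (gradL Ω w : Eu d → Eu d) x) 1 (vol Ω) :=
          (Lp.memLp (gradL Ω w)).smul (p := 2) (q := 2) ht.memLp
        have h5 := memLp_one_iff_integrable.1 h4
        refine (integrableOn_iff_integrable_of_support_subset ?_).1 h5
        exact (Function.support_smul_subset_left _ _).trans ((subset_tsupport φ).trans h3)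
      refine ext_inner_left ℝ fun e => ?_
      rw [inner_zero_right, ← integral_inner hint]
      have h6 := isWeakGrad w φ ht e
      have h7 : ∫ x in Ω, fn w x * fderiv ℝ φ x e = 0 := by
        have : (fn w : Eu d → ℝ) =ᵐ[vol Ω] 0 := by
          rw [fn_eq, h0]; exact Lp.coeFn_zero _ _ _
        rw [← integral_zero (Eu d) ℝ (μ := vol Ω)]
        apply integral_congr_ae
        filter_upwards [this] with x hx
        rw [hx]; simp
      rw [h7, zero_eq_neg] at h6
      rw [← h6, setIntegral_eq_integral_of_forall_compl_eq_zero]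
      · congr 1; funext x; rw [inner_smul_right]; rfl
      · intro x hx
        rw [image_eq_zero_of_notMem_tsupport fun h => hx (h3 h), zero_mul])
    rw [Lp.eq_zero_iff_ae_eq_zero]
    have := (ae_restrict_iff' hΩ.measurableSet).2 hae
    exact this
  have : ‖w‖ ^ 2 = 0 := by rw [norm_sq_eq, h0, hg]; simp
  simpa using this

theorem fnL_injective (hΩ : IsOpen Ω) : Function.Injective (fnL Ω) := fun _ _ h => ext_of_fnL hΩ h

theorem isFiniteMeasure_vol (hb : Bornology.IsBounded Ω) : IsFiniteMeasure (vol Ω) :=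
  ⟨by simpa using hb.measure_lt_top⟩

/-- `∫ |f|` for `f ∈ L²(Ω)`, as a seminorm. -/
noncomputable def l1Seminorm (hb : Bornology.IsBounded Ω) : Seminorm ℝ (Lp ℝ 2 (vol Ω)) :=
  have := isFiniteMeasure_vol hb
  have hi : ∀ f : Lp ℝ 2 (vol Ω), Integrable f (vol Ω) := fun f => (Lp.memLp f).integrable one_le_two
  Seminorm.of (fun f => ∫ x in Ω, |f x|)
    (fun f g => by
      rw [← integral_add (hi f).abs (hi g).abs]
      refine integral_mono_ae (hi (f + g)).abs ((hi f).abs.add (hi g).abs) ?_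
      filter_upwards [Lp.coeFn_add f g] with x hx
      rw [hx]; exact abs_add_le _ _)
    (fun c f => by
      rw [← integral_const_mul]
      apply integral_congr_ae
      filter_upwards [Lp.coeFn_smul c f] with x hx
      rw [hx]; simp [abs_mul])

theorem l1Seminorm_apply (hb : Bornology.IsBounded Ω) (f : Lp ℝ 2 (vol Ω)) :
    l1Seminorm hb f = ∫ x in Ω, |f x| := rfl

theorem exists_l1Seminorm_le (hb : Bornology.IsBounded Ω) :
    ∃ c, 0 < c ∧ ∀ f : Lp ℝ 2 (vol Ω), l1Seminorm hb f ≤ c * ‖f‖ := by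
  have := isFiniteMeasure_vol hb
  have h1 : MemLp (fun _ : Eu d => (1 : ℝ)) 2 (vol Ω) := memLp_const 1
  refine ⟨‖h1.toLp‖ + 1, by positivity, fun f => ?_⟩
  have hf : MemLp (fun x => |f x|) 2 (vol Ω) := (Lp.memLp f).abs
  have h2 : l1Seminorm hb f = inner ℝ (h1.toLp) (hf.toLp) := by
    rw [l1Seminorm_apply, L2.inner_def]
    apply integral_congr_ae
    filter_upwards [h1.coeFn_toLp, hf.coeFn_toLp] with x hx1 hx2
    rw [hx1, hx2]; simp
  have h3 : ‖hf.toLp‖ = ‖f‖ := by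
    rw [Lp.norm_toLp, Lp.norm_def]
    congr 1
    exact eLpNorm_congr_norm_ae (.of_forall fun x => by simp)
  rw [h2]
  refine (real_inner_le_norm _ _).trans ?_
  rw [h3]
  gcongr; linarith

theorem eq_zero_of_l1Seminorm (hb : Bornology.IsBounded Ω) {f : Lp ℝ 2 (vol Ω)}
    (h : l1Seminorm hb f = 0) : f = 0 := by
  have := isFiniteMeasure_vol hb
  rw [l1Seminorm_apply, integral_eq_zero_iff_of_nonneg (fun x => abs_nonneg _)
    ((Lp.memLp f).integrable one_le_two).abs] at h
  rw [Lp.eq_zero_iff_ae_eq_zero]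
  filter_upwards [h] with x hx
  simpa using hx

theorem continuous_l1Seminorm (hb : Bornology.IsBounded Ω) : Continuous (l1Seminorm hb) := by
  obtain ⟨c, hc, h⟩ := exists_l1Seminorm_le hb
  refine (LipschitzWith.of_dist_le_mul (K := ⟨c, hc.le⟩) fun f g => ?_).continuous
  rw [Real.dist_eq, dist_eq_norm]
  exact (abs_sub_map_le_sub _ _ _).trans (h _)

/-- The `L¹` norm on `H¹(Ω)`, as a seminorm. -/
noncomputable def l1 (hb : Bornology.IsBounded Ω) : Seminorm ℝ (H1 Ω) :=
  (l1Seminorm hb).comp (fnL Ω).toLinearMap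

theorem isClosed_space (bc : BC) (Ω : Set (Eu d)) : IsClosed (bc.space Ω : Set (H1 Ω)) := by
  cases bc with
  | neumann => exact isClosed_univ
  | dirichlet => exact Submodule.isClosed_topologicalClosure _

instance (bc : BC) : CompleteSpace (bc.space Ω) := (isClosed_space bc Ω).completeSpace_coe

/-- Data for `Setting` on `bc.space Ω`, given a Poincaré inequality and uniqueness of medians. -/
noncomputable def setting (bc : BC) (ho : IsOpen Ω) (hb : Bornology.IsBounded Ω)
    (hfin : FiniteDimensional ℝ (LinearMap.ker ((gradL Ω).comp (bc.space Ω).subtypeL).toLinearMap))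
    (hpoin : ∃ C, ∀ w : bc.space Ω, ∃ k : bc.space Ω, gradL Ω k = 0 ∧ ‖w - k‖ ≤ C * ‖gradL Ω w‖)
    (hstrict : ∀ w k : bc.space Ω, gradL Ω k = 0 →
      (∀ k' : bc.space Ω, gradL Ω k' = 0 → l1norm (w : H1 Ω) ≤ l1norm ((w : H1 Ω) + (k' : H1 Ω))) →
      l1norm ((w : H1 Ω) + (k : H1 Ω)) ≤ l1norm (w : H1 Ω) → k = 0) :
    Setting (bc.space Ω) (Lp (Eu d) 2 (vol Ω)) where
  D := (gradL Ω).comp (bc.space Ω).subtypeL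
  p := (l1 hb).comp (bc.space Ω).subtype
  continuous_p := (continuous_l1Seminorm hb).comp ((fnL Ω).continuous.comp continuous_subtype_val)
  eq_zero_of_p := fun w hw => by
    have h1 : fnL Ω w = 0 := eq_zero_of_l1Seminorm hb hw
    exact Subtype.ext (ext_of_fnL ho (by rw [h1]; simp))
  finite_ker := hfin
  poincare := hpoin
  strict := hstrict

end L1Flow

/-! ### Duality between `L¹` and `L^∞`: the abstract relation is the pointwise equation. -/

namespace L1Flow

variable {d : ℕ} {Ω : Set (Eu d)}

theorem inner_eq_integral_mul (g f : Lp ℝ 2 (vol Ω)) : inner ℝ g f = ∫ x in Ω, g x * f x := by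
  rw [L2.inner_def]
  congr 1; funext x; simp [mul_comm]

theorem integrable_mul_of_L2 (g f : Lp ℝ 2 (vol Ω)) : Integrable (fun x => g x * f x) (vol Ω) := by
  have := L2.integrable_inner (𝕜 := ℝ) f g
  simpa using this

/-- A function in `L²` which is bounded by `M` in the dual of `L¹` is bounded by `M`. -/
theorem ae_le_of_integral_mul_le (hb : Bornology.IsBounded Ω) {g : Lp ℝ 2 (vol Ω)} {M : ℝ}
    (h : ∀ f : Lp ℝ 2 (vol Ω), ∫ x in Ω, g x * f x ≤ M * l1Seminorm hb f) :
    ∀ᵐ x ∂(vol Ω), g x ≤ M := by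
  have := isFiniteMeasure_vol hb
  -- Testing with the excess `(g - M)⁺` turns the hypothesis into `∫ ((g - M)⁺) ^ 2 ≤ 0`.
  have hm : MemLp (fun x => max (g x - M) 0) 2 (vol Ω) :=
    ((Lp.memLp g).sub (memLp_const M)).pos_part
  have h1 := h (hm.toLp _)
  have e1 : ∫ x in Ω, g x * (hm.toLp _ : Lp ℝ 2 (vol Ω)) x = ∫ x in Ω, g x * max (g x - M) 0 := by
    apply integral_congr_ae
    filter_upwards [hm.coeFn_toLp] with x hx
    rw [hx]
  have e2 : l1Seminorm hb (hm.toLp _) = ∫ x in Ω, max (g x - M) 0 := by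
    rw [l1Seminorm_apply]
    apply integral_congr_ae
    filter_upwards [hm.coeFn_toLp] with x hx
    rw [hx, abs_of_nonneg (le_max_right _ _)]
  have i1 : Integrable (fun x => g x * max (g x - M) 0) (vol Ω) := by
    refine (integrable_mul_of_L2 g (hm.toLp _)).congr ?_
    filter_upwards [hm.coeFn_toLp] with x hx
    rw [hx]
  have i2 : Integrable (fun x => M * max (g x - M) 0) (vol Ω) :=
    (hm.integrable one_le_two).const_mul M
  rw [e1, e2, ← integral_const_mul, ← sub_nonpos, ← integral_sub i1 i2] at h1
  have e3 : (fun x => g x * max (g x - M) 0 - M * max (g x - M) 0)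
      = fun x => max (g x - M) 0 ^ 2 := by
    funext x
    rcases le_total (g x - M) 0 with h | h
    · simp [max_eq_right h]
    · rw [max_eq_left h]; ring
  rw [e3] at h1
  have i3 : Integrable (fun x => max (g x - M) 0 ^ 2) (vol Ω) := by
    rw [← e3]; exact i1.sub i2
  have h2 : ∫ x in Ω, max (g x - M) 0 ^ 2 = 0 :=
    le_antisymm h1 (integral_nonneg fun x => sq_nonneg _)
  rw [integral_eq_zero_iff_of_nonneg (fun x => sq_nonneg _) i3] at h2
  filter_upwards [h2] with x hx
  have : max (g x - M) 0 = 0 := by simpa using hx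
  linarith [le_max_left (g x - M) 0]

theorem abs_le_of_integral_mul_le (hb : Bornology.IsBounded Ω) {g : Lp ℝ 2 (vol Ω)} {M : ℝ}
    (h : ∀ f : Lp ℝ 2 (vol Ω), ∫ x in Ω, g x * f x ≤ M * l1Seminorm hb f) :
    ∀ᵐ x ∂(vol Ω), |g x| ≤ M := by
  have h1 := ae_le_of_integral_mul_le hb h
  have h2 := ae_le_of_integral_mul_le hb (g := -g) (M := M) fun f => by
    have := h (-f)
    rw [map_neg_eq_map] at this
    rwa [← inner_eq_integral_mul, inner_neg_left, ← inner_neg_right, inner_eq_integral_mul]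
  filter_upwards [h1, h2, Lp.coeFn_neg g] with x hx1 hx2 hx3
  rw [hx3, Pi.neg_apply] at hx2
  exact abs_le.2 ⟨by linarith, hx1⟩

theorem integral_mul_le_of_abs_le (hb : Bornology.IsBounded Ω) {g : Lp ℝ 2 (vol Ω)} {M : ℝ}
    (hg : ∀ᵐ x ∂(vol Ω), |g x| ≤ M) (f : Lp ℝ 2 (vol Ω)) :
    |∫ x in Ω, g x * f x| ≤ M * l1Seminorm hb f := by
  have := isFiniteMeasure_vol hb
  rw [l1Seminorm_apply, ← integral_const_mul]
  refine (abs_integral_le_integral_abs).trans (integral_mono_ae (integrable_mul_of_L2 g f).abs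
    (((Lp.memLp f).integrable one_le_two).abs.const_mul M) ?_)
  filter_upwards [hg] with x hx
  simp only [abs_mul]
  gcongr

/-- A linear form dominated by `M` times the `L¹` norm is represented by a function bounded by
`M`. -/
theorem exists_integral_mul_eq (hb : Bornology.IsBounded Ω) {V : Type*} [AddCommGroup V]
    [Module ℝ V] {j : V →ₗ[ℝ] Lp ℝ 2 (vol Ω)} (hj : Function.Injective j) {l : V →ₗ[ℝ] ℝ} {M : ℝ}
    (hM : 0 ≤ M) (h : ∀ φ, |l φ| ≤ M * l1Seminorm hb (j φ)) :
    ∃ g : Lp ℝ 2 (vol Ω), (∀ φ, ∫ x in Ω, g x * j φ x = l φ) ∧ ∀ᵐ x ∂(vol Ω), |g x| ≤ M := by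
  let e := LinearEquiv.ofInjective j hj
  -- Hahn-Banach extends the form to `L²` with the same `L¹` bound, Riesz represents it in `L²`, and
  -- the bound forces the representative into `L^∞`.
  let f₀ : Lp ℝ 2 (vol Ω) →ₗ.[ℝ] ℝ := ⟨LinearMap.range j, l ∘ₗ e.symm.toLinearMap⟩
  have hf₀ : ∀ φ : V, f₀ ⟨j φ, LinearMap.mem_range_self j φ⟩ = l φ := by
    intro φ
    change l (e.symm ⟨j φ, _⟩) = l φ
    congr 1
    exact e.symm_apply_apply φ
  obtain ⟨G, hG1, hG2⟩ := exists_extension_of_le_sublinear f₀ (fun f => M * l1Seminorm hb f)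
    (fun c hc x => by
      simp only [map_smul_eq_mul, Real.norm_of_nonneg hc.le]; ring)
    (fun x y => by
      simp only [← mul_add]
      exact mul_le_mul_of_nonneg_left (map_add_le_add _ _ _) hM)
    (by
      rintro ⟨_, ⟨φ, rfl⟩⟩
      rw [hf₀]
      exact (le_abs_self _).trans (h φ))
  obtain ⟨c, hc, hle⟩ := exists_l1Seminorm_le hb
  have hGabs : ∀ f, |G f| ≤ M * l1Seminorm hb f := fun f => abs_le.2 ⟨by
    have := hG2 (-f)
    rw [map_neg] at this
    simp only [map_neg_eq_map] at this
    linarith, hG2 f⟩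
  let G' : Lp ℝ 2 (vol Ω) →L[ℝ] ℝ := G.mkContinuous (M * c) fun f =>
    (hGabs f).trans (by rw [mul_assoc]; gcongr; exact hle f)
  let g := (InnerProductSpace.toDual ℝ (Lp ℝ 2 (vol Ω))).symm G'
  have hg : ∀ f : Lp ℝ 2 (vol Ω), ∫ x in Ω, g x * f x = G f := fun f => by
    rw [← inner_eq_integral_mul]
    exact InnerProductSpace.toDual_symm_apply
  refine ⟨g, fun φ => ?_, abs_le_of_integral_mul_le hb fun f => by rw [hg]; exact hG2 f⟩
  rw [hg, ← hf₀]
  exact hG1 ⟨j φ, LinearMap.mem_range_self j φ⟩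

theorem l1norm_nonneg (u : H1 Ω) : 0 ≤ l1norm u := integral_nonneg fun _ => abs_nonneg _

theorem abs_inner_le_of_equation (hb : Bornology.IsBounded Ω) {bc : BC} {u v : H1 Ω}
    {g : Lp ℝ 2 (vol Ω)} (h1 : IsWeakLaplacian bc u g)
    (h2 : ∀ᵐ x ∂(vol Ω), |g x| ≤ l1norm v) {φ : H1 Ω} (hφ : φ ∈ bc.space Ω) :
    |inner ℝ (gradL Ω u) (gradL Ω φ)| ≤ l1norm v * l1norm φ := by
  rw [inner_gradL, h1 φ hφ, abs_neg]
  exact integral_mul_le_of_abs_le hb h2 (fnL Ω φ)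

theorem inner_eq_of_equation {bc : BC} {u v : H1 Ω}
    {g : Lp ℝ 2 (vol Ω)} (h1 : IsWeakLaplacian bc u g) (hv : v ∈ bc.space Ω)
    (h3 : ∀ᵐ x ∂(vol Ω), fn v x * g x = |fn v x| * l1norm v) :
    inner ℝ (gradL Ω u) (gradL Ω v) = - l1norm v ^ 2 := by
  rw [inner_gradL, h1 v hv]
  have : ∫ x in Ω, g x * fn v x = ∫ x in Ω, l1norm v * |fn v x| := by
    apply integral_congr_ae
    filter_upwards [h3] with x hx
    rw [mul_comm, hx, mul_comm]
  rw [this, integral_const_mul, sq]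
  rfl

/-- The dual bound produces the Laplacian `g` with `|g| ≤ l1norm v`. The equality case of Hölder's
inequality gives the pointwise alignment: `|v| * l1norm v - v * g` is nonnegative with zero
integral. -/
theorem exists_equation (ho : IsOpen Ω) (hb : Bornology.IsBounded Ω) {N : Submodule ℝ (H1 Ω)}
    {u v : H1 Ω} (hv : v ∈ N)
    (h1 : ∀ φ ∈ N, |inner ℝ (gradL Ω u) (gradL Ω φ)| ≤ l1norm v * l1norm φ)
    (h2 : inner ℝ (gradL Ω u) (gradL Ω v) = - l1norm v ^ 2) :
    ∃ g : Lp ℝ 2 (vol Ω),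
      (∀ φ ∈ N, ∫ x in Ω, inner ℝ (grad u x) (grad φ x) = - ∫ x in Ω, g x * fn φ x) ∧
      (∀ᵐ x ∂(vol Ω), |g x| ≤ l1norm v) ∧
      (∀ᵐ x ∂(vol Ω), fn v x * g x = |fn v x| * l1norm v) := by
  have := isFiniteMeasure_vol hb
  obtain ⟨g, hg1, hg2⟩ := exists_integral_mul_eq hb
    (j := (fnL Ω).toLinearMap ∘ₗ N.subtype)
    (l := -((innerSL ℝ (gradL Ω u)).toLinearMap ∘ₗ (gradL Ω).toLinearMap ∘ₗ N.subtype))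
    ((fnL_injective ho).comp Subtype.val_injective) (l1norm_nonneg v) (fun φ => by
      change |-(inner ℝ (gradL Ω u) (gradL Ω (φ : H1 Ω)))| ≤ _
      rw [abs_neg]
      exact h1 φ φ.2)
  have hg : ∀ φ ∈ N, ∫ x in Ω, g x * fn φ x = - inner ℝ (gradL Ω u) (gradL Ω φ) :=
    fun φ hφ => hg1 ⟨φ, hφ⟩
  refine ⟨g, fun φ hφ => by rw [hg φ hφ, neg_neg, inner_gradL], hg2, ?_⟩
  have h3 := hg v hv
  rw [h2, neg_neg] at h3
  have i1 : Integrable (fun x => |fn v x| * l1norm v) (vol Ω) :=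
    ((Lp.memLp (fnL Ω v)).integrable one_le_two).abs.mul_const _
  have i2 : Integrable (fun x => g x * fn v x) (vol Ω) := integrable_mul_of_L2 g (fnL Ω v)
  have h4 : ∫ x in Ω, (|fn v x| * l1norm v - g x * fn v x) = 0 := by
    rw [integral_sub i1 i2, h3, integral_mul_const]
    change l1norm v * l1norm v - l1norm v ^ 2 = 0
    ring
  rw [integral_eq_zero_iff_of_nonneg_ae] at h4
  · filter_upwards [h4] with x hx
    simp only [Pi.zero_apply] at hx
    linarith [mul_comm (g x) (fn v x)]
  · filter_upwards [hg2] with x hx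
    simp only [Pi.zero_apply, sub_nonneg]
    calc g x * fn v x ≤ |g x * fn v x| := le_abs_self _
      _ = |fn v x| * |g x| := by rw [abs_mul, mul_comm]
      _ ≤ _ := by gcongr
  · exact i1.sub i2

theorem IsMinMov.isMinMovIn (hb : Bornology.IsBounded Ω) {bc : BC} {u₀ : H1 Ω} {τ : ℝ}
    {U : ℕ → H1 Ω} (h : IsMinMov bc u₀ τ U) :
    Setting.IsMinMovIn (bc.space Ω) (gradL Ω) (l1 hb) u₀ τ U := by
  refine ⟨h.initial, h.mem_dom, fun n z hz => ?_⟩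
  have h1 := h.minimal n z hz
  rwa [energy_eq, energy_eq] at h1

theorem isMinMov_of_isMinMovIn (hb : Bornology.IsBounded Ω) {bc : BC} {u₀ : H1 Ω} {τ : ℝ}
    {U : ℕ → H1 Ω} (h : Setting.IsMinMovIn (bc.space Ω) (gradL Ω) (l1 hb) u₀ τ U) :
    IsMinMov bc u₀ τ U := by
  refine ⟨h.initial, h.mem, fun n z hz => ?_⟩
  rw [energy_eq, energy_eq]
  exact h.minimal n z hz

variable {bc : BC} {S : Setting (bc.space Ω) (Lp (Eu d) 2 (vol Ω))}

theorem IsFlow.isFlowIn (hb : Bornology.IsBounded Ω) (hD : ∀ w : bc.space Ω, S.D w = gradL Ω w)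
    (hp : ∀ w : bc.space Ω, S.p w = l1 hb w) {u₀ : H1 Ω} {u v : ℝ → H1 Ω}
    (h : IsFlow bc u₀ u v) : S.IsFlowIn (gradL Ω) u₀ u v := by
  refine ⟨h.continuousOn, h.initial, h.mem_dom, h.timeDeriv, ?_⟩
  filter_upwards [h.equation] with t ht z hz
  obtain ⟨g, h1, h2, h3⟩ := ht
  have hv : v t ∈ bc.space Ω := hz ▸ z.2
  refine (Setting.rel_iff hD hp).2 ?_
  rw [hz]
  exact ⟨fun φ hφ => abs_inner_le_of_equation hb h1 h2 hφ, inner_eq_of_equation h1 hv h3⟩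

theorem isFlow_of_isFlowIn (ho : IsOpen Ω) (hb : Bornology.IsBounded Ω)
    (hD : ∀ w : bc.space Ω, S.D w = gradL Ω w)
    (hp : ∀ w : bc.space Ω, S.p w = l1 hb w) {u₀ : H1 Ω} {u v : ℝ → H1 Ω}
    (h : S.IsFlowIn (gradL Ω) u₀ u v) (hv : ∀ t, v t ∈ bc.space Ω) : IsFlow bc u₀ u v := by
  refine ⟨h.continuousOn, h.initial, h.mem, h.integral, ?_⟩
  filter_upwards [h.rel] with t ht
  have h0 := (Setting.rel_iff hD hp).1 (ht ⟨v t, hv t⟩ rfl)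
  exact exists_equation ho hb (hv t) h0.1 h0.2

theorem exists_flow (ho : IsOpen Ω) (hb : Bornology.IsBounded Ω)
    (hD : ∀ w : bc.space Ω, S.D w = gradL Ω w)
    (hp : ∀ w : bc.space Ω, S.p w = l1 hb w) (u₀ : H1 Ω) :
    ∃ u v : ℝ → H1 Ω,
      (IsFlow bc u₀ u v ∧ ∀ t > 0, MemLp v 2 (volume.restrict (Ioi t))) ∧
      (∀ u' v' : ℝ → H1 Ω, IsFlow bc u₀ u' v' → EqOn u' u (Ici 0)) ∧
      (∀ τ > 0, ∃ U : ℕ → H1 Ω, IsMinMov bc u₀ τ U) ∧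
      (∀ U : ℝ → ℕ → H1 Ω, (∀ τ > 0, IsMinMov bc u₀ τ (U τ)) →
        TendstoLocallyUniformlyOn (fun τ t => interp τ (U τ) t) u (𝓝[>] 0) (Ioi 0)) ∧
      (∃ N : Set ℝ, volume N = 0 ∧ AntitoneOn (fun t => gradNorm (v t)) (Ioi 0 \ N)) := by
  obtain ⟨u, v, ⟨h1, hv, h2⟩, h3, h4, h5, N, hN, h6⟩ := Setting.exists_flowIn hD hp u₀
  refine ⟨u, v, ⟨isFlow_of_isFlowIn ho hb hD hp h1 hv, h2⟩,
    fun u' v' h => h3 u' v' (h.isFlowIn hb hD hp),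
    fun τ hτ => (h4 τ hτ).imp fun U hU => isMinMov_of_isMinMovIn hb hU,
    fun U hU => h5 U fun τ hτ => (hU τ hτ).isMinMovIn hb, N, hN, ?_⟩
  simpa only [gradNorm_eq] using h6

end L1Flow

/-! ### Dirichlet conditions: Friedrichs' inequality. -/

namespace L1Flow

variable {d : ℕ} {Ω : Set (Eu d)}

theorem IsTest.zero : IsTest Ω (0 : Eu d → ℝ) :=
  ⟨contDiff_zero_fun, HasCompactSupport.zero, by simp⟩

theorem IsTest.add {φ ψ : Eu d → ℝ} (hφ : IsTest Ω φ) (hψ : IsTest Ω ψ) : IsTest Ω (φ + ψ) :=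
  ⟨hφ.smooth.add hψ.smooth, hφ.compact.add hψ.compact,
    (tsupport_add φ ψ).trans (union_subset hφ.support hψ.support)⟩

theorem IsTest.mul_left {φ : Eu d → ℝ} (hφ : IsTest Ω φ) {f : Eu d → ℝ} (hf : ContDiff ℝ ∞ f) :
    IsTest Ω (fun x => f x * φ x) :=
  ⟨hf.mul hφ.smooth, hφ.compact.mul_left, (tsupport_mul_subset_right).trans hφ.support⟩

theorem IsTest.const_smul {φ : Eu d → ℝ} (hφ : IsTest Ω φ) (c : ℝ) : IsTest Ω (c • φ) :=
  hφ.mul_left (f := fun _ => c) contDiff_const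

theorem IsTest.integral_eq {φ : Eu d → ℝ} (hφ : IsTest Ω φ) (f : Eu d → ℝ) :
    ∫ x in Ω, f x * φ x = ∫ x, f x * φ x :=
  setIntegral_eq_integral_of_forall_compl_eq_zero fun x hx => by
    rw [image_eq_zero_of_notMem_tsupport fun h => hx (hφ.support h), mul_zero]

/-- The weak gradient is tested with `⟪e, x⟫ φ`. Integration by parts gives `∫ ∂_e(⟪e, x⟫ φ) φ = ½ ∫
φ ^ 2`, which Cauchy-Schwarz bounds by `R ‖φ‖ ‖Dw‖`. -/
theorem norm_fnL_le_of_test {e : Eu d} (he : ‖e‖ = 1) {R : ℝ} (hR : ∀ x ∈ Ω, ‖x‖ ≤ R)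
    (ho : IsOpen Ω) (hR0 : 0 ≤ R) {w : H1 Ω} {φ : Eu d → ℝ} (hφ : IsTest Ω φ)
    (hw : fn w =ᵐ[vol Ω] φ) : ‖fnL Ω w‖ ≤ 2 * R * ‖gradL Ω w‖ := by
  have hψ : IsTest Ω (fun x => inner ℝ e x * φ x) := hφ.mul_left (contDiff_const.inner ℝ contDiff_id)
  have hφd : Differentiable ℝ φ := hφ.smooth.differentiable (by simp)
  have hψd : Differentiable ℝ (fun x => inner ℝ e x * φ x) := hψ.smooth.differentiable (by simp)
  have hder : ∀ x, fderiv ℝ (fun x => inner ℝ e x * φ x) x e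
      = φ x + inner ℝ e x * fderiv ℝ φ x e := by
    intro x
    have h1 : HasFDerivAt (fun x : Eu d => inner ℝ e x) (innerSL ℝ e) x := (innerSL ℝ e).hasFDerivAt
    have h2 : HasFDerivAt (fun x => inner ℝ e x * φ x) _ x := h1.mul (hφd x).hasFDerivAt
    rw [h2.fderiv]
    simp [he]; ring
  have hφdc : Continuous fun x => fderiv ℝ φ x e :=
    (hφ.smooth.continuous_fderiv (by simp)).clm_apply continuous_const
  have hint : ∀ f : Eu d → ℝ, Continuous f → Integrable (fun x => f x * φ x) volume := fun f hf =>
    (hf.mul hφ.smooth.continuous).integrable_of_hasCompactSupport hφ.compact.mul_left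
  have i1 : Integrable (fun x => φ x * φ x) volume := hint _ hφ.smooth.continuous
  have i2 : Integrable (fun x => (inner ℝ e x * fderiv ℝ φ x e) * φ x) volume :=
    hint _ ((continuous_const.inner continuous_id).mul hφdc)
  have hparts : ∫ x, (inner ℝ e x * φ x) * fderiv ℝ φ x e
      = - ∫ x, fderiv ℝ (fun x => inner ℝ e x * φ x) x e * φ x := by
    refine integral_mul_fderiv_eq_neg_fderiv_mul_of_integrable ?_ ?_ ?_ (fun x _ => hψd x)
      fun x _ => hφd x
    · refine (i1.add i2).congr (.of_forall fun x => ?_)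
      simp only [hder, Pi.add_apply]; ring
    · refine i2.congr (.of_forall fun x => ?_)
      simp only; ring
    · refine (hint (fun x => inner ℝ e x * φ x) hψ.smooth.continuous)
  have e1 : ∫ x, (inner ℝ e x * φ x) * fderiv ℝ φ x e
      = ∫ x, (inner ℝ e x * fderiv ℝ φ x e) * φ x := by
    congr 1; funext x; ring
  have e2 : ∫ x, fderiv ℝ (fun x => inner ℝ e x * φ x) x e * φ x
      = (∫ x, φ x * φ x) + ∫ x, (inner ℝ e x * fderiv ℝ φ x e) * φ x := by
    rw [← integral_add i1 i2]
    congr 1; funext x; rw [hder]; ring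
  rw [e1] at hparts
  have hweak := (isWeakGrad_iff (fnL Ω w) (gradL Ω w)).1 (isWeakGrad w) _ hψ e
  have e3 : inner ℝ ((hψ.memLp_fderiv e).toLp _) (fnL Ω w)
      = ∫ x, fderiv ℝ (fun x => inner ℝ e x * φ x) x e * φ x := by
    rw [← hφ.integral_eq, L2.inner_def]
    apply integral_congr_ae
    filter_upwards [(hψ.memLp_fderiv e).coeFn_toLp, hw] with x hx hx2
    rw [fn_eq] at hx2
    rw [hx, hx2]; simp [mul_comm]
  have e4 : ‖fnL Ω w‖ ^ 2 = ∫ x, φ x * φ x := by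
    rw [← real_inner_self_eq_norm_sq, L2.inner_def, ← hφ.integral_eq]
    apply integral_congr_ae
    filter_upwards [hw] with x hx2
    rw [fn_eq] at hx2
    rw [hx2]; simp [sq]
  have e5 : ‖(hψ.memLp_smul e).toLp _‖ ≤ R * ‖fnL Ω w‖ := by
    apply Lp.norm_le_mul_norm_of_ae_le_mul
    filter_upwards [(hψ.memLp_smul e).coeFn_toLp, hw, ae_restrict_mem ho.measurableSet]
      with x hx hx2 hxΩ
    rw [fn_eq] at hx2
    rw [hx, hx2, norm_smul, he, mul_one, norm_mul]
    gcongr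
    exact (norm_inner_le_norm e x).trans (by rw [he, one_mul]; exact hR x hxΩ)
  have e6 := (neg_le_abs _).trans (abs_real_inner_le_norm ((hψ.memLp_smul e).toLp _) (gradL Ω w))
  rw [← hweak, e3] at e6
  have e7 : ‖fnL Ω w‖ ^ 2 ≤ 2 * (R * ‖fnL Ω w‖ * ‖gradL Ω w‖) := by
    have := mul_le_mul_of_nonneg_right e5 (norm_nonneg (gradL Ω w))
    linarith
  rcases (norm_nonneg (fnL Ω w)).eq_or_lt with h0 | h0
  · rw [← h0]; positivity
  · refine le_of_mul_le_mul_left ?_ h0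
    linarith [sq ‖fnL Ω w‖]

/-- Friedrichs' inequality. -/
theorem norm_fnL_le_of_mem_H10 {e : Eu d} (he : ‖e‖ = 1) {R : ℝ} (hR : ∀ x ∈ Ω, ‖x‖ ≤ R)
    (ho : IsOpen Ω) (hR0 : 0 ≤ R) {w : H1 Ω} (hw : w ∈ H10 Ω) :
    ‖fnL Ω w‖ ≤ 2 * R * ‖gradL Ω w‖ := by
  have hcl : IsClosed {w : H1 Ω | ‖fnL Ω w‖ ≤ 2 * R * ‖gradL Ω w‖} :=
    isClosed_le (fnL Ω).continuous.norm (continuous_const.mul (gradL Ω).continuous.norm)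
  have hsub : ∀ w ∈ Submodule.span ℝ {w : H1 Ω | ∃ φ, IsTest Ω φ ∧ fn w =ᵐ[vol Ω] φ},
      ∃ φ, IsTest Ω φ ∧ fn w =ᵐ[vol Ω] φ := by
    intro w hw
    induction hw using Submodule.span_induction with
    | mem x h => exact h
    | zero =>
      refine ⟨0, IsTest.zero, ?_⟩
      rw [fn_eq, map_zero]; exact Lp.coeFn_zero _ _ _
    | add x y _ _ hx hy =>
      obtain ⟨φ, h1, h2⟩ := hx
      obtain ⟨ψ, h3, h4⟩ := hy
      refine ⟨φ + ψ, h1.add h3, ?_⟩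
      rw [fn_eq, map_add]
      exact (Lp.coeFn_add _ _).trans (h2.add h4)
    | smul c x _ hx =>
      obtain ⟨φ, h1, h2⟩ := hx
      refine ⟨c • φ, h1.const_smul c, ?_⟩
      rw [fn_eq, map_smul]
      exact (Lp.coeFn_smul _ _).trans (h2.const_smul c)
  refine closure_minimal (fun w hw => ?_) hcl hw
  obtain ⟨φ, h1, h2⟩ := hsub w hw
  exact norm_fnL_le_of_test he hR ho hR0 h1 h2

theorem norm_le_of_norm_fnL_le {w : H1 Ω} {C : ℝ} (hC : 0 ≤ C)
    (h : ‖fnL Ω w‖ ≤ C * ‖gradL Ω w‖) : ‖w‖ ≤ (C + 1) * ‖gradL Ω w‖ := by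
  refine le_of_sq_le_sq ?_ (by positivity)
  rw [norm_sq_eq]
  nlinarith [norm_nonneg (fnL Ω w), norm_nonneg (gradL Ω w), sq_nonneg (‖gradL Ω w‖),
    mul_nonneg hC (sq_nonneg (‖gradL Ω w‖))]

/-- Friedrichs' inequality makes the kernel of the gradient trivial, so finite dimension and
`strict` are immediate. -/
theorem exists_dirichlet_setting (hd : 1 ≤ d) (ho : IsOpen Ω) (hb : Bornology.IsBounded Ω) :
    ∃ S : Setting (BC.dirichlet.space Ω) (Lp (Eu d) 2 (vol Ω)),
      (∀ w : BC.dirichlet.space Ω, S.D w = gradL Ω w) ∧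
      ∀ w : BC.dirichlet.space Ω, S.p w = l1 hb w := by
  obtain ⟨R, hR⟩ := hb.exists_norm_le
  have he : ‖(EuclideanSpace.single (⟨0, hd⟩ : Fin d) (1 : ℝ) : Eu d)‖ = 1 := by simp
  have hP : ∀ w ∈ BC.dirichlet.space Ω, ‖fnL Ω w‖ ≤ 2 * max R 0 * ‖gradL Ω w‖ := fun w hw =>
    norm_fnL_le_of_mem_H10 he (fun x hx => (hR x hx).trans (le_max_left _ _)) ho
      (le_max_right _ _) hw
  have hker : ∀ w : BC.dirichlet.space Ω, gradL Ω w = 0 → w = 0 := fun w hw => by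
    have h1 := hP w w.2
    rw [hw, norm_zero, mul_zero, norm_le_zero_iff] at h1
    exact Subtype.ext (ext_of_fnL ho (by rw [h1]; simp))
  refine ⟨setting .dirichlet ho hb ?_ ⟨2 * max R 0 + 1, fun w => ⟨0, by simp, ?_⟩⟩
    (fun w k hk _ _ => hker k hk), fun _ => rfl, fun _ => rfl⟩
  · have : LinearMap.ker ((gradL Ω).comp (BC.dirichlet.space Ω).subtypeL).toLinearMap = ⊥ :=
      (Submodule.eq_bot_iff _).2 fun w hw => hker w hw
    rw [this]; infer_instance
  · rw [sub_zero]
    exact norm_le_of_norm_fnL_le (by positivity) (hP w w.2)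

end L1Flow

/-! ### Translations of `H¹` functions. -/

namespace L1Flow

variable {d : ℕ} {Ω A : Set (Eu d)}

theorem locallyIntegrableOn_of_memLp {E : Type*} [NormedAddCommGroup E] {f : Eu d → E}
    (hA : IsOpen A) (hf : MemLp f 2 (vol A)) : LocallyIntegrableOn f A volume := by
  intro x hx
  obtain ⟨K, hKc, hK, hKΩ⟩ := exists_compact_subset hA hx
  refine ⟨K, mem_nhdsWithin_of_mem_nhds (mem_interior_iff_mem_nhds.1 hK), ?_⟩
  have hm : MemLp f 2 (volume.restrict K) := hf.mono_measure (Measure.restrict_mono hKΩ le_rfl)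
  have : IsFiniteMeasure (volume.restrict K) := ⟨by simpa using hKc.measure_lt_top⟩
  exact hm.integrable one_le_two

/-- The test functions, as a subspace of `L²`. -/
def tests (A : Set (Eu d)) : Submodule ℝ (Lp ℝ 2 (vol A)) where
  carrier := {g | ∃ φ, IsTest A φ ∧ g =ᵐ[vol A] φ}
  zero_mem' := ⟨0, IsTest.zero, Lp.coeFn_zero _ _ _⟩
  add_mem' := by
    rintro f g ⟨φ, h1, h2⟩ ⟨ψ, h3, h4⟩
    exact ⟨φ + ψ, h1.add h3, (Lp.coeFn_add _ _).trans (h2.add h4)⟩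
  smul_mem' := by
    rintro c f ⟨φ, h1, h2⟩
    exact ⟨c • φ, h1.const_smul c, (Lp.coeFn_smul _ _).trans (h2.const_smul c)⟩

theorem dense_tests (hA : IsOpen A) : Dense (tests A : Set (Lp ℝ 2 (vol A))) := by
  rw [Submodule.dense_iff_topologicalClosure_eq_top, Submodule.topologicalClosure_eq_top_iff,
    Submodule.eq_bot_iff]
  intro f hf
  have h := hA.ae_eq_zero_of_integral_contDiff_smul_eq_zero
    (locallyIntegrableOn_of_memLp hA (Lp.memLp f)) (fun φ h1 h2 h3 => by
      have ht : IsTest A φ := ⟨h1, h2, h3⟩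
      have h4 := (Submodule.mem_orthogonal _ _).1 hf (ht.memLp.toLp φ) ⟨φ, ht, ht.memLp.coeFn_toLp⟩
      rw [L2.inner_def] at h4
      rw [← h4]
      have h5 := ht.integral_eq f
      have h6 : ∫ x, φ x • f x = ∫ x, f x * φ x := by congr 1; funext x; exact mul_comm _ _
      rw [h6, ← h5]
      apply integral_congr_ae
      filter_upwards [ht.memLp.coeFn_toLp] with x hx
      rw [hx]; simp)
  rw [Lp.eq_zero_iff_ae_eq_zero]
  exact (ae_restrict_iff' hA.measurableSet).2 h

/-- `L²` duality against a dense set; it allows translation estimates without smoothing the `H¹`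
function. -/
theorem norm_le_of_forall_test (hA : IsOpen A) {f : Lp ℝ 2 (vol A)} {M : ℝ} (hM : 0 ≤ M)
    (h : ∀ φ, (hφ : IsTest A φ) → |∫ x in A, f x * φ x| ≤ M * ‖hφ.memLp.toLp φ‖) : ‖f‖ ≤ M := by
  have hcl : IsClosed {g : Lp ℝ 2 (vol A) | inner ℝ f g ≤ M * ‖g‖} :=
    isClosed_le (continuous_const.inner continuous_id) (continuous_const.mul continuous_norm)
  have h1 : ∀ g : Lp ℝ 2 (vol A), inner ℝ f g ≤ M * ‖g‖ := by
    intro g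
    refine closure_minimal (s := (tests A : Set (Lp ℝ 2 (vol A)))) ?_ hcl (dense_tests hA g)
    rintro g ⟨φ, hφ, hg⟩
    have e : g = hφ.memLp.toLp φ := Lp.ext (hg.trans hφ.memLp.coeFn_toLp.symm)
    have e2 : inner ℝ f g = ∫ x in A, f x * φ x := by
      rw [inner_eq_integral_mul]
      apply integral_congr_ae
      filter_upwards [hg] with x hx
      rw [hx]
    change inner ℝ f g ≤ M * ‖g‖
    rw [e2]
    refine (le_abs_self _).trans ((h φ hφ).trans_eq ?_)
    rw [← e]
  have h2 := h1 f
  rw [real_inner_self_eq_norm_mul_norm] at h2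
  rcases (norm_nonneg f).eq_or_lt with h0 | h0
  · exact h0.symm.trans_le hM
  · exact le_of_mul_le_mul_right h2 h0

theorem hasDerivAt_integral_translate {f : Eu d → ℝ} (hf : Integrable f (vol Ω)) {φ : Eu d → ℝ}
    (h1 : ContDiff ℝ ∞ φ) (h2 : HasCompactSupport φ) (h : Eu d) (s : ℝ) :
    HasDerivAt (fun s : ℝ => ∫ y in Ω, f y * φ (y - s • h))
      (- ∫ y in Ω, f y * fderiv ℝ φ (y - s • h) h) s := by
  have hc : Continuous fun x => fderiv ℝ φ x h :=
    (h1.continuous_fderiv (by simp)).clm_apply continuous_const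
  obtain ⟨C, hC⟩ := (h2.fderiv_apply ℝ h).exists_bound_of_continuous hc
  obtain ⟨C0, hC0⟩ := h2.exists_bound_of_continuous h1.continuous
  have hcs : ∀ s : ℝ, Continuous fun y : Eu d => y - s • h := fun s =>
    continuous_id.sub continuous_const
  rw [← integral_neg]
  refine (hasDerivAt_integral_of_dominated_loc_of_deriv_le (s := univ)
    (F' := fun s y => - (f y * fderiv ℝ φ (y - s • h) h)) (bound := fun y => ‖f y‖ * C)
    univ_mem ?_ ?_ ?_ ?_ ?_ ?_).2
  · exact .of_forall fun s => hf.aestronglyMeasurable.mul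
      (h1.continuous.comp (hcs s)).aestronglyMeasurable
  · exact hf.mul_bdd (c := C0) (h1.continuous.comp (hcs s)).aestronglyMeasurable
      (.of_forall fun x => hC0 _)
  · exact (hf.aestronglyMeasurable.mul (hc.comp (hcs s)).aestronglyMeasurable).neg
  · refine .of_forall fun y s _ => ?_
    rw [norm_neg, norm_mul]
    gcongr
    exact hC _
  · exact hf.norm.mul_const C
  · refine .of_forall fun y s _ => ?_
    have h3 : HasDerivAt (fun s : ℝ => y - s • h) (-h) s := by
      simpa using ((hasDerivAt_id s).smul_const h).const_sub y
    have h4 := ((h1.differentiable (by simp)).differentiableAt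
      (x := y - s • h)).hasFDerivAt.comp_hasDerivAt s h3
    have h5 := h4.const_mul (f y)
    simpa using h5

theorem integral_translate {f φ : Eu d → ℝ} (hφ : tsupport φ ⊆ A) {h : Eu d}
    (hA : ∀ x ∈ A, x + h ∈ Ω) :
    ∫ y in Ω, f y * φ (y - h) = ∫ x in A, f (x + h) * φ x := by
  have h0 : ∀ x ∉ A, φ x = 0 := fun x hx => image_eq_zero_of_notMem_tsupport fun h => hx (hφ h)
  rw [setIntegral_eq_integral_of_forall_compl_eq_zero, setIntegral_eq_integral_of_forall_compl_eq_zero,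
    ← integral_add_right_eq_self _ h]
  · simp
  · intro x hx; rw [h0 x hx, mul_zero]
  · intro y hy
    rw [h0, mul_zero]
    intro h1
    exact hy (by simpa using hA _ h1)

theorem IsTest.translate {φ : Eu d → ℝ} (hφ : IsTest A φ) {h : Eu d} (hA : ∀ x ∈ A, x + h ∈ Ω) :
    IsTest Ω (fun y => φ (y - h)) := by
  have e : tsupport (fun y => φ (y - h)) = (fun y => y - h) ⁻¹' tsupport φ :=
    tsupport_comp_eq_preimage φ (Homeomorph.subRight h)
  refine ⟨hφ.smooth.comp (contDiff_id.sub contDiff_const), ?_, ?_⟩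
  · exact hφ.compact.comp_homeomorph (Homeomorph.subRight h)
  · rw [e]
    intro y hy
    simpa using hA _ (hφ.support hy)

theorem norm_toLp_sq {φ : Eu d → ℝ} (hφ : MemLp φ 2 (vol A)) :
    ‖hφ.toLp φ‖ ^ 2 = ∫ x in A, φ x ^ 2 := by
  rw [← real_inner_self_eq_norm_sq, inner_eq_integral_mul]
  apply integral_congr_ae
  filter_upwards [hφ.coeFn_toLp] with x hx
  rw [hx, sq]

/-- The translation is moved to the test function and differentiated along the segment. The
derivative is an integral of the weak gradient against a translated test function, still supported
in `Ω`. -/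
theorem abs_integral_translate_sub_le (hb : Bornology.IsBounded Ω) {h : Eu d}
    (hA : ∀ x ∈ A, ∀ s ∈ Icc (0 : ℝ) 1, x + s • h ∈ Ω) (u : H1 Ω) {φ : Eu d → ℝ}
    (hφ : IsTest A φ) :
    |(∫ x in A, fn u (x + h) * φ x) - ∫ x in A, fn u x * φ x|
      ≤ ‖h‖ * ‖gradL Ω u‖ * ‖hφ.memLp.toLp φ‖ := by
  have := isFiniteMeasure_vol hb
  have hf : Integrable (fn u) (vol Ω) := (Lp.memLp (fnL Ω u)).integrable one_le_two
  have hder := fun s => hasDerivAt_integral_translate hf hφ.smooth hφ.compact h s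
  have key := norm_image_sub_le_of_norm_deriv_le_segment_01'
    (C := ‖h‖ * ‖gradL Ω u‖ * ‖hφ.memLp.toLp φ‖)
    (fun s _ => (hder s).hasDerivWithinAt) (fun s hs => ?_)
  · have e1 := integral_translate (f := fn u) hφ.support (h := (1 : ℝ) • h)
      (fun x hx => hA x hx 1 (by simp))
    have e0 := integral_translate (f := fn u) hφ.support (h := (0 : ℝ) • h)
      (fun x hx => hA x hx 0 (by simp))
    rw [e1, e0, Real.norm_eq_abs] at key
    simpa using key
  · have hψ := hφ.translate (h := s • h) (fun x hx => hA x hx s ⟨hs.1, hs.2.le⟩)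
    have hw := (isWeakGrad_iff (fnL Ω u) (gradL Ω u)).1 (isWeakGrad u) _ hψ h
    have hfd : ∀ y, fderiv ℝ (fun y => φ (y - s • h)) y h = fderiv ℝ φ (y - s • h) h := fun y => by
      rw [fderiv_comp_sub]
    have e : ∫ y in Ω, fn u y * fderiv ℝ φ (y - s • h) h
        = inner ℝ ((hψ.memLp_fderiv h).toLp _) (fnL Ω u) := by
      rw [L2.inner_def]
      apply integral_congr_ae
      filter_upwards [(hψ.memLp_fderiv h).coeFn_toLp] with x hx
      rw [hx, hfd, fn_eq]; simp
    rw [norm_neg, e, hw, norm_neg]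
    refine (norm_inner_le_norm _ _).trans ?_
    have e2 : ‖(hψ.memLp_smul h).toLp _‖ ≤ ‖h‖ * ‖hψ.memLp.toLp _‖ := by
      apply Lp.norm_le_mul_norm_of_ae_le_mul
      filter_upwards [(hψ.memLp_smul h).coeFn_toLp, hψ.memLp.coeFn_toLp] with x hx hx2
      rw [hx, hx2, norm_smul, mul_comm]
    have e3 : ‖hψ.memLp.toLp _‖ = ‖hφ.memLp.toLp φ‖ := by
      rw [← sq_eq_sq₀ (norm_nonneg _) (norm_nonneg _), norm_toLp_sq, norm_toLp_sq]
      simp only [sq]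
      rw [hψ.integral_eq, hφ.integral_eq]
      exact integral_sub_right_eq_self (fun x => φ x * φ x) (s • h)
    rw [e3] at e2
    calc _ ≤ ‖h‖ * ‖hφ.memLp.toLp φ‖ * ‖gradL Ω u‖ := by gcongr
      _ = _ := by ring

theorem memLp_translate {E : Type*} [NormedAddCommGroup E] {f : Eu d → E} {h : Eu d}
    (hf : MemLp f 2 (vol Ω)) (hA : ∀ x ∈ A, x + h ∈ Ω) :
    MemLp (fun x => f (x + h)) 2 (vol A) := by
  have hmp := (measurePreserving_add_right (volume : Measure (Eu d)) h).restrict_preimage_emb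
    (measurableEmbedding_addRight h) Ω
  exact (hf.comp_measurePreserving hmp).mono_measure (Measure.restrict_mono hA le_rfl)

theorem memLp_translate_sub {h : Eu d} (hA0 : A ⊆ Ω) (hA1 : ∀ x ∈ A, x + h ∈ Ω) (u : H1 Ω) :
    MemLp (fun x => fn u (x + h) - fn u x) 2 (vol A) :=
  (memLp_translate (Lp.memLp (fnL Ω u)) hA1).sub
    ((Lp.memLp (fnL Ω u)).mono_measure (Measure.restrict_mono hA0 le_rfl))

theorem integral_translate_sub_sq_le (hb : Bornology.IsBounded Ω) (hAo : IsOpen A)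
    {h : Eu d} (hA : ∀ x ∈ A, ∀ s ∈ Icc (0 : ℝ) 1, x + s • h ∈ Ω) (u : H1 Ω) :
    ∫ x in A, (fn u (x + h) - fn u x) ^ 2 ≤ ‖h‖ ^ 2 * ‖gradL Ω u‖ ^ 2 := by
  have hA1 : ∀ x ∈ A, x + h ∈ Ω := fun x hx => by simpa using hA x hx 1 (by simp)
  have hA0 : A ⊆ Ω := fun x hx => by simpa using hA x hx 0 (by simp)
  have m0 : MemLp (fn u) 2 (vol A) :=
    (Lp.memLp (fnL Ω u)).mono_measure (Measure.restrict_mono hA0 le_rfl)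
  have m1 : MemLp (fun x => fn u (x + h)) 2 (vol A) := memLp_translate (Lp.memLp (fnL Ω u)) hA1
  have m := memLp_translate_sub hA0 hA1 u
  have hn : ‖m.toLp _‖ ≤ ‖h‖ * ‖gradL Ω u‖ := by
    refine norm_le_of_forall_test hAo (by positivity) fun φ hφ => ?_
    have e : ∫ x in A, (m.toLp _ : Lp ℝ 2 (vol A)) x * φ x
        = (∫ x in A, fn u (x + h) * φ x) - ∫ x in A, fn u x * φ x := by
      rw [← integral_sub]
      · apply integral_congr_ae
        filter_upwards [m.coeFn_toLp] with x hx
        rw [hx]; ring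
      · exact m1.integrable_mul hφ.memLp
      · exact m0.integrable_mul hφ.memLp
    rw [e]
    exact abs_integral_translate_sub_le hb hA u hφ
  rw [← norm_toLp_sq m, ← mul_pow]
  gcongr

theorem lintegral_translate_sub_sq_le (hb : Bornology.IsBounded Ω) (hAo : IsOpen A)
    {h : Eu d} (hA : ∀ x ∈ A, ∀ s ∈ Icc (0 : ℝ) 1, x + s • h ∈ Ω) (u : H1 Ω) :
    ∫⁻ x in A, ENNReal.ofReal ((fn u (x + h) - fn u x) ^ 2)
      ≤ ENNReal.ofReal (‖h‖ ^ 2 * ‖gradL Ω u‖ ^ 2) := by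
  rw [← ofReal_integral_eq_lintegral_ofReal _ (.of_forall fun x => sq_nonneg _)]
  · exact ENNReal.ofReal_le_ofReal (integral_translate_sub_sq_le hb hAo hA u)
  · exact (memLp_translate_sub (fun x hx => by simpa using hA x hx 0 (by simp))
      (fun x hx => by simpa using hA x hx 1 (by simp)) u).integrable_sq

end L1Flow

/-! ### Propagation of `L²` control through `Ω` and the Poincaré-Wirtinger inequality. -/

namespace L1Flow

variable {d : ℕ} {Ω A A' B : Set (Eu d)}

/-- The `L²` norm on `A` is controlled by the norm of the gradient and the `L²` norm on `B`. -/
def Controlled (Ω B A : Set (Eu d)) : Prop :=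
  ∃ C : NNReal, ∀ u : H1 Ω, ∫⁻ x in A, ENNReal.ofReal (fn u x ^ 2)
    ≤ C * (ENNReal.ofReal (‖gradL Ω u‖ ^ 2) + ∫⁻ x in B, ENNReal.ofReal (fn u x ^ 2))

theorem measurable_fn (u : H1 Ω) : Measurable (fn u) := (Lp.stronglyMeasurable (fnL Ω u)).measurable

theorem Controlled.mono (h : Controlled Ω B A') (hA : A ⊆ A') : Controlled Ω B A := by
  obtain ⟨C, hC⟩ := h
  exact ⟨C, fun u => (lintegral_mono_set hA).trans (hC u)⟩

theorem Controlled.refl (Ω B : Set (Eu d)) : Controlled Ω B B :=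
  ⟨1, fun u => by rw [ENNReal.coe_one, one_mul]; exact le_add_self⟩

theorem Controlled.union (h : Controlled Ω B A) (h' : Controlled Ω B A') :
    Controlled Ω B (A ∪ A') := by
  obtain ⟨C, hC⟩ := h
  obtain ⟨C', hC'⟩ := h'
  refine ⟨C + C', fun u => (lintegral_union_le _ _ _).trans ?_⟩
  rw [ENNReal.coe_add, add_mul]
  exact add_le_add (hC u) (hC' u)

theorem Controlled.trans (h : Controlled Ω B A') (h' : Controlled Ω A' A) : Controlled Ω B A := by
  obtain ⟨C, hC⟩ := h
  obtain ⟨C', hC'⟩ := h'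
  refine ⟨C' * (1 + C), fun u => (hC' u).trans ?_⟩
  rw [ENNReal.coe_mul, mul_assoc]
  gcongr
  rw [ENNReal.coe_add, add_mul, ENNReal.coe_one, one_mul]
  exact add_le_add le_self_add (hC u)

/-- A set is controlled by its translate as long as the segments between them stay in `Ω`. -/
theorem controlled_of_translate (hb : Bornology.IsBounded Ω) (hAo : IsOpen A) {h : Eu d}
    (hA : ∀ x ∈ A, ∀ s ∈ Icc (0 : ℝ) 1, x + s • h ∈ Ω) (hA' : ∀ x ∈ A, x + h ∈ A') :
    Controlled Ω A' A := by
  refine ⟨2 * (‖h‖₊ ^ 2 + 1), fun u => ?_⟩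
  have hm := measurable_fn u
  have hm1 : Measurable fun x => fn u (x + h) := hm.comp (measurable_add_const h)
  have e1 : ∫⁻ x in A, ENNReal.ofReal (fn u (x + h) ^ 2)
      ≤ ∫⁻ x in A', ENNReal.ofReal (fn u x ^ 2) := by
    rw [(measurePreserving_add_right (volume : Measure (Eu d)) h).setLIntegral_comp_emb
      (measurableEmbedding_addRight h) (fun x => ENNReal.ofReal (fn u x ^ 2)) A]
    exact lintegral_mono_set (image_subset_iff.2 hA')
  calc ∫⁻ x in A, ENNReal.ofReal (fn u x ^ 2)
      ≤ ∫⁻ x in A, 2 * (ENNReal.ofReal ((fn u (x + h) - fn u x) ^ 2)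
          + ENNReal.ofReal (fn u (x + h) ^ 2)) := by
        refine lintegral_mono fun x => ?_
        have : 2 * (ENNReal.ofReal ((fn u (x + h) - fn u x) ^ 2) + ENNReal.ofReal (fn u (x + h) ^ 2))
            = ENNReal.ofReal (2 * ((fn u (x + h) - fn u x) ^ 2 + fn u (x + h) ^ 2)) := by
          rw [ENNReal.ofReal_mul (by simp), ENNReal.ofReal_add (sq_nonneg _) (sq_nonneg _),
            ENNReal.ofReal_ofNat]
        rw [this]
        apply ENNReal.ofReal_le_ofReal
        nlinarith [sq_nonneg (fn u (x + h) - fn u x - fn u (x + h)), sq_nonneg (2 * fn u (x + h) - fn u x)]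
    _ = 2 * ((∫⁻ x in A, ENNReal.ofReal ((fn u (x + h) - fn u x) ^ 2))
          + ∫⁻ x in A, ENNReal.ofReal (fn u (x + h) ^ 2)) := by
        rw [lintegral_const_mul' _ _ (by simp), lintegral_add_left]
        exact ((hm1.sub hm).pow_const 2).ennreal_ofReal
    _ ≤ 2 * (ENNReal.ofReal (‖h‖ ^ 2 * ‖gradL Ω u‖ ^ 2)
          + ∫⁻ x in A', ENNReal.ofReal (fn u x ^ 2)) := by
        gcongr
        exact lintegral_translate_sub_sq_le hb hAo hA u
    _ ≤ _ := by
        rw [ENNReal.coe_mul, mul_assoc]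
        have e2 : ENNReal.ofReal (‖h‖ ^ 2 * ‖gradL Ω u‖ ^ 2)
            = ((‖h‖₊ ^ 2 : NNReal) : ENNReal) * ENNReal.ofReal (‖gradL Ω u‖ ^ 2) := by
          rw [ENNReal.ofReal_mul (sq_nonneg _)]
          congr 1
          rw [← coe_nnnorm, ← NNReal.coe_pow, ENNReal.ofReal_coe_nnreal]
        rw [e2, ENNReal.coe_add, ENNReal.coe_one, ENNReal.coe_ofNat]
        gcongr
        rw [add_mul, one_mul, mul_add]
        calc _ ≤ ((‖h‖₊ ^ 2 : NNReal) : ENNReal) * ENNReal.ofReal (‖gradL Ω u‖ ^ 2)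
              + (ENNReal.ofReal (‖gradL Ω u‖ ^ 2) + ∫⁻ x in A', ENNReal.ofReal (fn u x ^ 2)) := by
              gcongr; exact le_add_self
          _ ≤ _ := by gcongr; exact le_self_add

/-- The set of centres of controlled balls is open and relatively closed in `Ω`, since a small ball
can be translated to any nearby centre; connectedness concludes. -/
theorem exists_controlled_ball (ho : IsOpen Ω) (hb : Bornology.IsBounded Ω)
    (hc : IsPreconnected Ω) {x₀ : Eu d} {r₀ : ℝ} (hr₀ : 0 < r₀) (h₀ : x₀ ∈ Ω) {x : Eu d}
    (hx : x ∈ Ω) : ∃ r > 0, Controlled Ω (Metric.ball x₀ r₀) (Metric.ball x r) := by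
  set G : Set (Eu d) := {x | ∃ r > 0, Controlled Ω (Metric.ball x₀ r₀) (Metric.ball x r)} with hG
  have hGo : IsOpen G := by
    rw [Metric.isOpen_iff]
    rintro x ⟨r, hr, h⟩
    refine ⟨r, hr, fun y hy => ⟨r - dist y x, sub_pos.2 hy, h.mono ?_⟩⟩
    exact Metric.ball_subset_ball' (by linarith)
  refine hc.subset_of_closure_inter_subset hGo ⟨x₀, h₀, r₀, hr₀, Controlled.refl _ _⟩ ?_ hx
  rintro x ⟨hxc, hxΩ⟩
  obtain ⟨R, hR, hRΩ⟩ := Metric.isOpen_iff.1 ho x hxΩ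
  obtain ⟨y, ⟨r, hr, h⟩, hy⟩ := Metric.mem_closure_iff.1 hxc (R / 2) (by positivity)
  refine ⟨min r (R / 2), by positivity, h.trans ?_⟩
  refine controlled_of_translate hb Metric.isOpen_ball (h := y - x) (fun z hz s hs => hRΩ ?_)
    (fun z hz => ?_)
  · rw [Metric.mem_ball, dist_eq_norm] at hz ⊢
    have h1 : ‖y - x‖ < R / 2 := by rwa [← dist_eq_norm, dist_comm]
    have h2 : ‖s • (y - x)‖ ≤ ‖y - x‖ := by
      rw [norm_smul, Real.norm_of_nonneg hs.1]
      exact mul_le_of_le_one_left (norm_nonneg _) hs.2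
    have h3 := norm_add_le (z - x) (s • (y - x))
    rw [show z + s • (y - x) - x = (z - x) + s • (y - x) by abel]
    have := min_le_right r (R / 2)
    linarith
  · rw [Metric.mem_ball, dist_eq_norm] at hz ⊢
    rw [show z + (y - x) - y = z - x by abel]
    exact hz.trans_le (min_le_left _ _)

theorem controlled_of_isCompact (ho : IsOpen Ω) (hb : Bornology.IsBounded Ω)
    (hc : IsPreconnected Ω) {x₀ : Eu d} {r₀ : ℝ} (hr₀ : 0 < r₀) (h₀ : x₀ ∈ Ω) {K : Set (Eu d)}
    (hK : IsCompact K) (hKΩ : K ⊆ Ω) : Controlled Ω (Metric.ball x₀ r₀) K := by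
  refine hK.induction_on (p := Controlled Ω (Metric.ball x₀ r₀))
    ((Controlled.refl _ _).mono (empty_subset _)) (fun s t hst h => h.mono hst)
    (fun s t => Controlled.union) fun x hx => ?_
  obtain ⟨r, hr, h⟩ := exists_controlled_ball ho hb hc hr₀ h₀ (hKΩ hx)
  exact ⟨_, mem_nhdsWithin_of_mem_nhds (Metric.ball_mem_nhds x hr), h⟩

/-- Near a boundary point, `Ω` is pushed inwards along `e` into a compact subset of `Ω`, which is
controlled. The closure of `Ω` is covered by finitely many neighbourhoods. -/
theorem controlled_univ (ho : IsOpen Ω) (hb : Bornology.IsBounded Ω)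
    (hc : IsPreconnected Ω) (hL : HasLipschitzBoundary Ω) {x₀ : Eu d} {r₀ : ℝ} (hr₀ : 0 < r₀)
    (h₀ : x₀ ∈ Ω) : Controlled Ω (Metric.ball x₀ r₀) Ω := by
  have key : Controlled Ω (Metric.ball x₀ r₀) (Ω ∩ closure Ω) := by
    refine hb.isCompact_closure.induction_on (p := fun t => Controlled Ω (Metric.ball x₀ r₀) (Ω ∩ t))
      ((Controlled.refl _ _).mono (by simp)) (fun s t hst h => h.mono (inter_subset_inter_right _ hst))
      (fun s t hs ht => by rw [inter_union_distrib_left]; exact hs.union ht) fun p hp => ?_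
    by_cases hpΩ : p ∈ Ω
    · obtain ⟨r, hr, h⟩ := exists_controlled_ball ho hb hc hr₀ h₀ hpΩ
      exact ⟨_, mem_nhdsWithin_of_mem_nhds (Metric.ball_mem_nhds p hr), h.mono inter_subset_right⟩
    obtain ⟨e, he, K, g, hg, r, hr, hgr⟩ := hL p ⟨hp, by rwa [ho.interior_eq]⟩
    refine ⟨_, mem_nhdsWithin_of_mem_nhds (Metric.ball_mem_nhds p (show 0 < r / 3 by positivity)), ?_⟩
    have hin : Continuous fun y : Eu d => (inner ℝ e y : ℝ) := continuous_const.inner continuous_id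
    set f : Eu d → ℝ := fun y => g (y - (inner ℝ e y : ℝ) • e) with hf
    have hfc : Continuous f := hg.continuous.comp (continuous_id.sub (hin.smul continuous_const))
    have hfs : ∀ (x : Eu d) (s : ℝ), f (x + s • e) = f x ∧ inner ℝ e (x + s • e) = inner ℝ e x + s := by
      intro x s
      have : inner ℝ e (x + s • e) = inner ℝ e x + s := by
        rw [inner_add_right, inner_smul_right, real_inner_self_eq_norm_sq, he]; simp
      refine ⟨?_, this⟩
      simp only [hf]
      rw [this, add_smul, add_sub_add_right_eq_sub]
    -- Points within `r / 3` of `p`, moved by `(r / 3) • e`, stay within `2 * r / 3` of `p` and end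
    -- at height at least `r / 3` above the graph.
    have hKc : IsCompact (Metric.closedBall p (2 * r / 3) ∩ {y | f y + r / 3 ≤ inner ℝ e y}) :=
      (isCompact_closedBall p _).inter_right (isClosed_le (hfc.add continuous_const) hin)
    refine (controlled_of_isCompact ho hb hc hr₀ h₀ hKc ?_).trans
      (controlled_of_translate hb (ho.inter Metric.isOpen_ball) (h := (r / 3) • e) ?_ ?_)
    · rintro y ⟨hy1, hy2⟩
      rw [Metric.mem_closedBall] at hy1
      refine (hgr y (by rw [Metric.mem_ball]; linarith)).2 ?_
      change f y < _
      rw [mem_ofPred_eq] at hy2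
      linarith
    · rintro x ⟨hx1, hx2⟩ s hs
      rw [Metric.mem_ball, dist_eq_norm] at hx2
      have h1 := (hgr x (by rw [Metric.mem_ball, dist_eq_norm]; linarith)).1 hx1
      rw [smul_smul]
      have h2 : ‖(s * (r / 3)) • e‖ ≤ r / 3 := by
        rw [norm_smul, he, mul_one, Real.norm_of_nonneg (mul_nonneg hs.1 (by positivity))]
        exact mul_le_of_le_one_left (by positivity) hs.2
      refine (hgr _ ?_).2 ?_
      · rw [Metric.mem_ball, dist_eq_norm, add_sub_right_comm]
        have := norm_add_le (x - p) ((s * (r / 3)) • e)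
        linarith
      · change f _ < _
        rw [(hfs _ _).1, (hfs _ _).2]
        have : 0 ≤ s * (r / 3) := mul_nonneg hs.1 (by positivity)
        have h3 : f x < inner ℝ e x := h1
        linarith
    · rintro x ⟨hx1, hx2⟩
      rw [Metric.mem_ball, dist_eq_norm] at hx2
      have h1 : f x < inner ℝ e x := (hgr x (by rw [Metric.mem_ball, dist_eq_norm]; linarith)).1 hx1
      refine ⟨?_, ?_⟩
      · rw [Metric.mem_closedBall, dist_eq_norm, add_sub_right_comm]
        have := norm_add_le (x - p) ((r / 3) • e)
        have h2 : ‖(r / 3) • e‖ = r / 3 := by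
          rw [norm_smul, he, mul_one, Real.norm_of_nonneg (by positivity)]
        linarith
      · rw [mem_ofPred_eq, (hfs _ _).1, (hfs _ _).2]
        linarith
  exact key.mono fun x hx => ⟨hx, subset_closure hx⟩

theorem lintegral_ball_lintegral_ball_sub_sq_le {f : Eu d → ℝ} (hm : Measurable f) {x₀ : Eu d}
    {r : ℝ} {N : ENNReal} (h : ∀ z ∈ Metric.ball (0 : Eu d) (2 * r),
      ∫⁻ x in Metric.ball x₀ r, ENNReal.ofReal ((f (x + z) - f x) ^ 2) ≤ N) :
    ∫⁻ y in Metric.ball x₀ r, ∫⁻ x in Metric.ball x₀ r, ENNReal.ofReal ((f y - f x) ^ 2)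
      ≤ N * volume (Metric.ball (0 : Eu d) (2 * r)) := by
  have hF : Measurable (Function.uncurry fun y x => ENNReal.ofReal ((f y - f x) ^ 2)) :=
    (((hm.comp measurable_fst).sub (hm.comp measurable_snd)).pow_const 2).ennreal_ofReal
  have hF' : Measurable (Function.uncurry fun x h => ENNReal.ofReal ((f (x + h) - f x) ^ 2)) :=
    (((hm.comp (measurable_fst.add measurable_snd)).sub
      (hm.comp measurable_fst)).pow_const 2).ennreal_ofReal
  have h1 : ∀ x ∈ Metric.ball x₀ r, ∫⁻ y in Metric.ball x₀ r, ENNReal.ofReal ((f y - f x) ^ 2)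
      ≤ ∫⁻ h in Metric.ball (0 : Eu d) (2 * r), ENNReal.ofReal ((f (x + h) - f x) ^ 2) := by
    intro x hx
    rw [← lintegral_indicator measurableSet_ball, ← lintegral_indicator measurableSet_ball,
      ← lintegral_add_left_eq_self _ x]
    refine lintegral_mono fun h => ?_
    by_cases h1 : x + h ∈ Metric.ball x₀ r
    · have : h ∈ Metric.ball (0 : Eu d) (2 * r) := by
        rw [Metric.mem_ball, dist_eq_norm] at h1 hx
        rw [mem_ball_zero_iff]
        have := norm_sub_le (x + h - x₀) (x - x₀)
        rw [show x + h - x₀ - (x - x₀) = h by abel] at this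
        linarith
      rw [indicator_of_mem h1, indicator_of_mem this]
    · rw [indicator_of_notMem h1]; exact zero_le
  rw [lintegral_lintegral_swap hF.aemeasurable]
  refine (setLIntegral_mono' measurableSet_ball h1).trans ?_
  rw [lintegral_lintegral_swap hF'.aemeasurable, ← setLIntegral_const]
  exact setLIntegral_mono' measurableSet_ball h

/-- The double integral of `(u y - u x) ^ 2` over the ball is an integral of translation estimates
over displacements shorter than `2 * r`; the radius `3 * r` leaves room for these. -/
theorem exists_lintegral_ball_sub_sq_le (hb : Bornology.IsBounded Ω) {x₀ : Eu d} {r : ℝ}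
    (hr : 0 < r) (h : Metric.ball x₀ (3 * r) ⊆ Ω) :
    ∃ C : NNReal, ∀ u : H1 Ω, ∃ c : ℝ,
      ∫⁻ x in Metric.ball x₀ r, ENNReal.ofReal ((fn u x - c) ^ 2)
        ≤ C * ENNReal.ofReal (‖gradL Ω u‖ ^ 2) := by
  have hv0 : volume (Metric.ball x₀ r) ≠ 0 := (Metric.measure_ball_pos volume x₀ hr).ne'
  have hvt : volume (Metric.ball x₀ r) ≠ ⊤ := measure_ball_lt_top.ne
  have hvt' : volume (Metric.ball (0 : Eu d) (2 * r)) ≠ ⊤ := measure_ball_lt_top.ne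
  obtain ⟨c₀, hc₀⟩ : ∃ c : NNReal, (c : ENNReal) = _ := ⟨_, ENNReal.coe_toNNReal
    (ENNReal.div_ne_top (ENNReal.mul_ne_top hvt' (ENNReal.ofReal_ne_top (r := (2 * r) ^ 2))) hv0)⟩
  refine ⟨c₀, fun u => ?_⟩
  rw [hc₀]
  have hm := measurable_fn u
  have hF : Measurable (Function.uncurry fun y x => ENNReal.ofReal ((fn u y - fn u x) ^ 2)) :=
    (((hm.comp measurable_fst).sub (hm.comp measurable_snd)).pow_const 2).ennreal_ofReal
  have h2 := lintegral_ball_lintegral_ball_sub_sq_le hm (x₀ := x₀) (r := r)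
    (N := ENNReal.ofReal ((2 * r) ^ 2 * ‖gradL Ω u‖ ^ 2)) fun z hz => by
      rw [mem_ball_zero_iff] at hz
      refine (lintegral_translate_sub_sq_le hb Metric.isOpen_ball (fun x hx s hs => h ?_)
        u).trans ?_
      · rw [Metric.mem_ball, dist_eq_norm] at hx
        rw [Metric.mem_ball, dist_eq_norm, add_sub_right_comm]
        have h2 : ‖s • z‖ ≤ ‖z‖ := by
          rw [norm_smul, Real.norm_of_nonneg hs.1]
          exact mul_le_of_le_one_left (norm_nonneg _) hs.2
        have := norm_add_le (x - x₀) (s • z)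
        linarith
      · gcongr
  -- Some `y` does at least as well as the average, so the constant can be the value `u y` instead
  -- of the mean of `u`.
  obtain ⟨y, -, hy⟩ := exists_le_setLAverage (μ := volume) hv0 hvt
    (Measurable.lintegral_prod_right (ν := volume.restrict (Metric.ball x₀ r)) hF).aemeasurable
  refine ⟨fn u y, ?_⟩
  have h3 : ∀ x, (fn u x - fn u y) ^ 2 = (fn u y - fn u x) ^ 2 := fun x => by ring
  simp only [h3]
  refine hy.trans ?_
  rw [setLAverage_eq]
  refine (ENNReal.div_le_div_right h2 _).trans_eq ?_
  rw [ENNReal.ofReal_mul (sq_nonneg _), ENNReal.div_eq_inv_mul, ENNReal.div_eq_inv_mul]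
  ring

theorem isWeakGrad_one (Ω : Set (Eu d)) : IsWeakGrad Ω (fun _ => 1) (fun _ => 0) := by
  intro φ hφ e
  have hc : Continuous fun x => fderiv ℝ φ x e :=
    (hφ.smooth.continuous_fderiv (by simp)).clm_apply continuous_const
  have h1 := integral_mul_fderiv_eq_neg_fderiv_mul_of_integrable (μ := volume)
    (f := fun _ : Eu d => (1 : ℝ)) (g := φ) (v := e) (by simp)
    (by simpa using hc.integrable_of_hasCompactSupport (hφ.compact.fderiv_apply ℝ e))
    (by simpa using hφ.smooth.continuous.integrable_of_hasCompactSupport hφ.compact)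
    (fun x _ => differentiableAt_const _)
    (fun x _ => (hφ.smooth.differentiable (by simp)).differentiableAt)
  have h2 : ∫ x in Ω, (1 : ℝ) * fderiv ℝ φ x e = ∫ x, (1 : ℝ) * fderiv ℝ φ x e :=
    setIntegral_eq_integral_of_forall_compl_eq_zero fun x hx => by
      rw [one_mul]
      have h3 : x ∉ tsupport (fderiv ℝ φ) := fun h => hx (hφ.support (tsupport_fderiv_subset ℝ h))
      rw [image_eq_zero_of_notMem_tsupport h3]; rfl
  rw [h2, h1]
  simp

theorem exists_fn_eq_of_isWeakGrad_zero {f : Eu d → ℝ} (hm : MemLp f 2 (vol Ω))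
    (hf : IsWeakGrad Ω f fun _ => 0) : ∃ k : H1 Ω, fn k =ᵐ[vol Ω] f ∧ gradL Ω k = 0 := by
  refine ⟨⟨WithLp.toLp 2 (hm.toLp _, 0), ?_⟩, hm.coeFn_toLp, rfl⟩
  intro φ hφ e
  have h1 := hf φ hφ e
  have e1 : ∫ x in Ω, (hm.toLp _ : Lp ℝ 2 (vol Ω)) x * fderiv ℝ φ x e
      = ∫ x in Ω, f x * fderiv ℝ φ x e := by
    apply integral_congr_ae
    filter_upwards [hm.coeFn_toLp] with x hx
    rw [hx]
  have e2 : ∫ x in Ω, φ x * inner ℝ e ((0 : Lp (Eu d) 2 (vol Ω)) x)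
      = ∫ x in Ω, φ x * inner ℝ e (0 : Eu d) := by
    apply integral_congr_ae
    filter_upwards [Lp.coeFn_zero (Eu d) 2 (vol Ω)] with x hx
    rw [hx]; rfl
  exact e1.trans (h1.trans (congrArg Neg.neg e2.symm))

theorem exists_one (hb : Bornology.IsBounded Ω) :
    ∃ k : H1 Ω, fn k =ᵐ[vol Ω] (fun _ => 1) ∧ gradL Ω k = 0 :=
  have := isFiniteMeasure_vol hb
  exists_fn_eq_of_isWeakGrad_zero (memLp_const 1) (isWeakGrad_one Ω)

theorem ofReal_norm_fnL_sq (u : H1 Ω) :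
    ENNReal.ofReal (‖fnL Ω u‖ ^ 2) = ∫⁻ x in Ω, ENNReal.ofReal (fn u x ^ 2) := by
  have hm : MemLp (fn u) 2 (vol Ω) := Lp.memLp (fnL Ω u)
  rw [← ofReal_integral_eq_lintegral_ofReal hm.integrable_sq (.of_forall fun x => sq_nonneg _),
    ← norm_toLp_sq hm]
  congr 3
  exact (Lp.toLp_coeFn (fnL Ω u) hm).symm

/-- The Poincaré-Wirtinger inequality. -/
theorem exists_norm_fnL_sub_le (ho : IsOpen Ω) (hb : Bornology.IsBounded Ω) (hc : IsConnected Ω)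
    (hL : HasLipschitzBoundary Ω) {k : H1 Ω} (hk : fn k =ᵐ[vol Ω] (fun _ => 1))
    (hk' : gradL Ω k = 0) :
    ∃ C, 0 ≤ C ∧ ∀ u : H1 Ω, ∃ c : ℝ, ‖fnL Ω (u - c • k)‖ ≤ C * ‖gradL Ω u‖ := by
  obtain ⟨x₀, h₀⟩ := hc.nonempty
  obtain ⟨R, hR, hRΩ⟩ := Metric.isOpen_iff.1 ho x₀ h₀
  have hr : 0 < R / 3 := by positivity
  have h3 : Metric.ball x₀ (3 * (R / 3)) ⊆ Ω := by rwa [mul_div_cancel₀ _ (by norm_num)]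
  have hBΩ : Metric.ball x₀ (R / 3) ⊆ Ω := (Metric.ball_subset_ball (by linarith)).trans hRΩ
  obtain ⟨C, hC⟩ := exists_lintegral_ball_sub_sq_le hb hr h3
  obtain ⟨C', hC'⟩ := controlled_univ ho hb hc.isPreconnected hL hr h₀
  refine ⟨Real.sqrt (C' * (1 + C)), Real.sqrt_nonneg _, fun u => ?_⟩
  obtain ⟨c, hc⟩ := hC u
  refine ⟨c, ?_⟩
  have hg : gradL Ω (u - c • k) = gradL Ω u := by rw [map_sub, map_smul, hk', smul_zero, sub_zero]
  have hfn : fn (u - c • k) =ᵐ[vol Ω] fun x => fn u x - c := by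
    rw [fn_eq, map_sub, map_smul]
    filter_upwards [Lp.coeFn_sub (fnL Ω u) (c • fnL Ω k), Lp.coeFn_smul c (fnL Ω k), hk]
      with x h1 h2 h3
    rw [fn_eq] at h3
    rw [h1, Pi.sub_apply, h2, Pi.smul_apply, h3, fn_eq]; simp
  have h1 := hC' (u - c • k)
  rw [hg, ← ofReal_norm_fnL_sq] at h1
  have h2 : ∫⁻ x in Metric.ball x₀ (R / 3), ENNReal.ofReal (fn (u - c • k) x ^ 2)
      = ∫⁻ x in Metric.ball x₀ (R / 3), ENNReal.ofReal ((fn u x - c) ^ 2) := by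
    apply lintegral_congr_ae
    filter_upwards [ae_restrict_of_ae_restrict_of_subset hBΩ hfn] with x hx
    rw [hx]
  rw [h2] at h1
  have h4 : ENNReal.ofReal (‖fnL Ω (u - c • k)‖ ^ 2)
      ≤ ENNReal.ofReal (C' * (1 + C) * ‖gradL Ω u‖ ^ 2) := by
    refine h1.trans ((mul_le_mul_right (add_le_add_right hc _) _).trans_eq ?_)
    rw [ENNReal.ofReal_mul (by positivity), ENNReal.ofReal_mul (by positivity),
      ENNReal.ofReal_add (by simp) (by positivity), ENNReal.ofReal_coe_nnreal,
      ENNReal.ofReal_coe_nnreal, ENNReal.ofReal_one]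
    ring
  rw [ENNReal.ofReal_le_ofReal_iff (by positivity)] at h4
  refine le_of_sq_le_sq ?_ (by positivity)
  rwa [mul_pow, Real.sq_sqrt (by positivity)]

end L1Flow

/-! ### Neumann conditions: uniqueness of the median. -/

namespace L1Flow

variable {d : ℕ} {Ω A : Set (Eu d)}

theorem ae_translate {P : Eu d → Prop} (hΩ : ∀ᵐ x ∂(vol Ω), P x) {h : Eu d}
    (hA : ∀ x ∈ A, x + h ∈ Ω) : ∀ᵐ x ∂(vol A), P (x + h) := by
  have hmp := (measurePreserving_add_right (volume : Measure (Eu d)) h).restrict_preimage_emb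
    (measurableEmbedding_addRight h) Ω
  exact ae_restrict_of_ae_restrict_of_subset hA (hmp.quasiMeasurePreserving.ae hΩ)

/-- If `f` jumps only where `w` jumps by at least `c`, then `f` has zero weak gradient. -/
theorem isWeakGrad_zero_of_abs_sub_le (ho : IsOpen Ω) (hb : Bornology.IsBounded Ω) (w : H1 Ω)
    {f : Eu d → ℝ} (hf : MemLp f 2 (vol Ω)) {c : ℝ} (hc : 0 ≤ c) {N : Set (Eu d)}
    (hN : ∀ᵐ x ∂(vol Ω), x ∈ N)
    (hfw : ∀ x ∈ N, ∀ y ∈ N, |f x - f y| ≤ c * (fn w x - fn w y) ^ 2) :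
    IsWeakGrad Ω f fun _ => 0 := by
  have := isFiniteMeasure_vol hb
  intro φ hφ e
  have hfi : Integrable f (vol Ω) := hf.integrable one_le_two
  obtain ⟨δ, hδ, hδΩ⟩ := hφ.compact.isCompact.exists_thickening_subset_open ho hφ.support
  set A := Metric.thickening (δ / 2) (tsupport φ) with hA
  have hφA : tsupport φ ⊆ A := Metric.self_subset_thickening (by positivity) _
  have hAo : IsOpen A := Metric.isOpen_thickening
  obtain ⟨M, hM⟩ := hφ.compact.exists_bound_of_continuous hφ.smooth.continuous
  have hM0 : 0 ≤ M := (norm_nonneg _).trans (hM 0)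
  have hsweep : ∀ h : Eu d, ‖h‖ < δ / 2 → ∀ x ∈ A, x + h ∈ Ω := fun h hh x hx => by
    refine hδΩ ?_
    obtain ⟨z, hz, hxz⟩ := Metric.mem_thickening_iff.1 hx
    refine Metric.mem_thickening_iff.2 ⟨z, hz, ?_⟩
    rw [dist_eq_norm] at hxz ⊢
    have := norm_add_le (x - z) h
    rw [add_sub_right_comm]
    linarith
  have hAΩ : A ⊆ Ω := fun x hx => by simpa using hsweep 0 (by simpa using hδ) x hx
  -- The jumps of `f` are bounded by squared increments of `w`, whose integral is of second order in
  -- `h`. So the translated integral has derivative `0`, and that derivative is also the weak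
  -- gradient pairing.
  have key : ∀ h : Eu d, ‖h‖ < δ / 2 → |(∫ y in Ω, f y * φ (y - h)) - ∫ y in Ω, f y * φ y|
      ≤ M * c * ‖gradL Ω w‖ ^ 2 * ‖h‖ ^ 2 := by
    intro h hh
    have hA1 := hsweep h hh
    have e0 := integral_translate (f := f) hφA (h := 0) (fun x hx => by simpa using hAΩ hx)
    simp only [sub_zero, add_zero] at e0
    have m0 : MemLp f 2 (vol A) := hf.mono_measure (Measure.restrict_mono hAΩ le_rfl)
    have m1 : MemLp (fun x => f (x + h)) 2 (vol A) := memLp_translate hf hA1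
    have mφ : MemLp φ 2 (vol A) :=
      (hφ.smooth.continuous.memLp_of_hasCompactSupport hφ.compact).restrict A
    have i1 : Integrable (fun x => f (x + h) * φ x) (vol A) := m1.integrable_mul mφ
    have i0 : Integrable (fun x => f x * φ x) (vol A) := m0.integrable_mul mφ
    rw [e0, integral_translate hφA hA1, ← integral_sub i1 i0]
    have mw := (memLp_translate_sub hAΩ hA1 w).integrable_sq
    have h2 := integral_translate_sub_sq_le hb hAo (h := h) (fun x hx s hs => hsweep (s • h)
      (lt_of_le_of_lt (by
        rw [norm_smul, Real.norm_of_nonneg hs.1]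
        exact mul_le_of_le_one_left (norm_nonneg _) hs.2) hh) x hx) w
    have h3 : |∫ x in A, (f (x + h) * φ x - f x * φ x)|
        ≤ ∫ x in A, (M * c) * (fn w (x + h) - fn w x) ^ 2 := by
      refine abs_integral_le_integral_abs.trans (integral_mono_ae
        (i1.sub i0).abs (mw.const_mul _) ?_)
      filter_upwards [ae_translate hN hA1, ae_restrict_of_ae_restrict_of_subset hAΩ hN]
        with x hx1 hx2
      rw [← sub_mul, abs_mul, mul_assoc M, mul_comm M]
      have h5 := hM x
      rw [Real.norm_eq_abs] at h5
      have := hfw _ hx1 _ hx2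
      gcongr
    rw [integral_const_mul] at h3
    refine h3.trans ((mul_le_mul_of_nonneg_left h2 (by positivity)).trans_eq ?_)
    ring
  have hder := (hasDerivAt_integral_translate hfi hφ.smooth hφ.compact e 0).sub_const
    (∫ y in Ω, f y * φ y)
  have hder0 : HasDerivAt (fun s : ℝ => (∫ y in Ω, f y * φ (y - s • e)) - ∫ y in Ω, f y * φ y)
      0 0 := by
    have hO : (fun s : ℝ => (∫ y in Ω, f y * φ (y - s • e)) - ∫ y in Ω, f y * φ y)
        =O[𝓝 0] fun s => ‖s - 0‖ ^ 2 := by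
      refine Asymptotics.IsBigO.of_bound (M * c * ‖gradL Ω w‖ ^ 2 * ‖e‖ ^ 2) ?_
      have h1 : Tendsto (fun s : ℝ => ‖s • e‖) (𝓝 0) (𝓝 0) := by
        have : Continuous fun s : ℝ => ‖s • e‖ := by fun_prop
        simpa using this.tendsto 0
      filter_upwards [h1.eventually_lt_const (show 0 < δ / 2 by positivity)] with s hs
      refine (key _ hs).trans_eq ?_
      rw [norm_smul, sub_zero, norm_pow, norm_norm]; ring
    simpa using (hO.hasFDerivAt one_lt_two).hasDerivAt
  have h0 := hder.unique hder0
  simpa using h0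

theorem l1norm_add_smul_eq {w k : H1 Ω} (hk : fn k =ᵐ[vol Ω] fun _ => 1) (c : ℝ) :
    l1norm (w + c • k) = ∫ x in Ω, |fn w x + c| := by
  have : fn (w + c • k) =ᵐ[vol Ω] fun x => fn w x + c := by
    rw [fn_eq, map_add, map_smul]
    filter_upwards [Lp.coeFn_add (fnL Ω w) (c • fnL Ω k), Lp.coeFn_smul c (fnL Ω k), hk]
      with x h1 h2 h3
    rw [fn_eq] at h3
    rw [h1, Pi.add_apply, h2, Pi.smul_apply, h3, fn_eq]; simp
  rw [l1norm]
  apply integral_congr_ae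
  filter_upwards [this] with x hx
  rw [hx]

/-- Two minimizing shifts would leave a gap `(-c, 0)` in the values of `w`. An `H¹` function cannot
jump, so `w` stays on one side of the gap, and there shifting changes the `L¹` norm strictly. -/
theorem not_le_of_isMedian (ho : IsOpen Ω) (hb : Bornology.IsBounded Ω) (hne : Ω.Nonempty)
    {k : H1 Ω} (hk : fn k =ᵐ[vol Ω] fun _ => 1)
    (hker : ∀ w : H1 Ω, gradL Ω w = 0 → ∃ c : ℝ, w = c • k) {w : H1 Ω} {c : ℝ} (hc : 0 < c)
    (hw : ∀ c' : ℝ, l1norm w ≤ l1norm (w + c' • k)) : ¬ l1norm (w + c • k) ≤ l1norm w := by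
  intro hle
  have := isFiniteMeasure_vol hb
  have hwi : Integrable (fn w) (vol Ω) := (Lp.memLp (fnL Ω w)).integrable one_le_two
  have hi : ∀ c : ℝ, Integrable (fun x => |fn w x + c|) (vol Ω) := fun c =>
    (hwi.add (integrable_const c)).abs
  have h0 : l1norm w = ∫ x in Ω, |fn w x + 0| := by
    rw [← l1norm_add_smul_eq hk, zero_smul, add_zero]
  have hi2 : Integrable (fun x => |fn w x + 0| + |fn w x + c|) (vol Ω) := (hi 0).add (hi c)
  have h1 : ∫ x in Ω, (|fn w x + 0| + |fn w x + c| - 2 * |fn w x + c / 2|) ≤ 0 := by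
    rw [integral_sub hi2 ((hi _).const_mul 2), integral_add (hi 0) (hi c),
      integral_const_mul, ← h0, ← l1norm_add_smul_eq hk, ← l1norm_add_smul_eq hk]
    have := hw (c / 2)
    linarith
  have hnn : ∀ x, 0 ≤ |fn w x + 0| + |fn w x + c| - 2 * |fn w x + c / 2| := fun x => by
    have h2 := abs_add_le (fn w x + 0) (fn w x + c)
    rw [show fn w x + 0 + (fn w x + c) = 2 * (fn w x + c / 2) by ring, abs_mul, abs_two] at h2
    linarith
  have h2 := (integral_eq_zero_iff_of_nonneg hnn
    (hi2.sub ((hi _).const_mul 2))).1 (le_antisymm h1 (integral_nonneg hnn))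
  -- Equality in the triangle inequality at the midpoint shift excludes a sign change between `w`
  -- and `w + c`.
  have h3 : ∀ᵐ x ∂(vol Ω), x ∈ {x | 0 ≤ fn w x ∨ fn w x ≤ -c} := by
    filter_upwards [h2] with x hx
    by_contra! h
    simp only [Pi.zero_apply, add_zero] at hx
    rw [abs_of_neg h.1, abs_of_pos (by linarith : 0 < fn w x + c)] at hx
    rcases abs_cases (fn w x + c / 2) with ⟨h4, -⟩ | ⟨h4, -⟩ <;> rw [h4] at hx <;> linarith
  have hS : MeasurableSet {x | 0 ≤ fn w x} := measurableSet_le measurable_const (measurable_fn w)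
  have hm : MemLp ({x | 0 ≤ fn w x}.indicator fun _ => (1 : ℝ)) 2 (vol Ω) :=
    (memLp_const 1).indicator hS
  -- The indicator of `{0 ≤ w}` jumps only across the gap, where `w` changes by at least `c`.
  have hgrad := isWeakGrad_zero_of_abs_sub_le ho hb w hm (c := (c ^ 2)⁻¹) (by positivity) h3 (by
    intro x hx y hy
    rw [inv_mul_eq_div]
    have hp : 0 ≤ (fn w x - fn w y) ^ 2 / c ^ 2 := by positivity
    rw [mem_ofPred_eq] at hx hy
    by_cases h4 : 0 ≤ fn w x <;> by_cases h5 : 0 ≤ fn w y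
    · simpa [indicator, h4, h5] using hp
    · have : fn w y ≤ -c := hy.resolve_left h5
      simp only [indicator, mem_ofPred_eq, h4, h5, if_true, if_false, sub_zero, abs_one]
      rw [le_div_iff₀ (by positivity)]
      nlinarith
    · have : fn w x ≤ -c := hx.resolve_left h4
      simp only [indicator, mem_ofPred_eq, h4, h5, if_true, if_false, zero_sub, abs_neg, abs_one]
      rw [le_div_iff₀ (by positivity)]
      nlinarith
    · simpa [indicator, h4, h5] using hp)
  obtain ⟨z, hz, hz'⟩ := exists_fn_eq_of_isWeakGrad_zero hm hgrad
  obtain ⟨a, rfl⟩ := hker z hz'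
  have hind : ∀ᵐ x ∂(vol Ω), {x | 0 ≤ fn w x}.indicator (fun _ => (1 : ℝ)) x = a := by
    have h4 := Lp.coeFn_smul a (fnL Ω k)
    rw [fn_eq, map_smul] at hz
    filter_upwards [hz, h4, hk] with x h5 h6 h7
    rw [← h5, h6, Pi.smul_apply, ← fn_eq, h7]; simp
  have hvol : 0 < ∫ x in Ω, c := by
    rw [setIntegral_const, smul_eq_mul]
    refine mul_pos (ENNReal.toReal_pos (ho.measure_pos volume hne).ne' ?_) hc
    exact hb.measure_lt_top.ne
  -- If `w ≥ 0`, the shift by `c` increases the norm by `c |Ω|`, against `hle`; if `w ≤ -c`, it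
  -- decreases it by `c |Ω|`, against minimality.
  by_cases ha : a = 1
  · have h4 : ∫ x in Ω, |fn w x + c| = ∫ x in Ω, (|fn w x + 0| + c) := by
      apply integral_congr_ae
      filter_upwards [hind] with x hx
      have h5 : 0 ≤ fn w x := by
        by_contra h
        rw [indicator_of_notMem (by exact h), ha] at hx
        exact zero_ne_one hx
      rw [add_zero, abs_of_nonneg h5, abs_of_nonneg (by positivity)]
    rw [integral_add (hi 0) (integrable_const c), ← h0, ← l1norm_add_smul_eq hk] at h4
    linarith
  · have h4 : ∫ x in Ω, |fn w x + c| = ∫ x in Ω, (|fn w x + 0| - c) := by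
      apply integral_congr_ae
      filter_upwards [hind, h3] with x hx hx'
      have h5 : fn w x ≤ -c := by
        refine hx'.resolve_left fun h => ha ?_
        rw [indicator_of_mem (by exact h)] at hx
        exact hx.symm
      rw [add_zero, abs_of_nonpos (by linarith), abs_of_nonpos (by linarith)]
      ring
    rw [integral_sub (hi 0) (integrable_const c), ← h0, ← l1norm_add_smul_eq hk] at h4
    have := hw c
    linarith

/-- A negative shift is reversed: `w + c • k` is then also a minimizer, and `w` is its positive
shift. -/
theorem eq_zero_of_isMedian (ho : IsOpen Ω) (hb : Bornology.IsBounded Ω) (hne : Ω.Nonempty)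
    {k : H1 Ω} (hk : fn k =ᵐ[vol Ω] fun _ => 1)
    (hker : ∀ w : H1 Ω, gradL Ω w = 0 → ∃ c : ℝ, w = c • k) {w : H1 Ω} {c : ℝ}
    (hw : ∀ c' : ℝ, l1norm w ≤ l1norm (w + c' • k)) (hle : l1norm (w + c • k) ≤ l1norm w) :
    c = 0 := by
  rcases lt_trichotomy c 0 with h | h | h
  · refine absurd ?_ (not_le_of_isMedian ho hb hne hk hker (w := w + c • k) (neg_pos.2 h)
      fun c' => ?_)
    · rw [neg_smul, add_neg_cancel_right]; exact hw c
    · rw [add_assoc, ← add_smul]; exact hle.trans (hw _)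
  · exact h
  · exact absurd hle (not_le_of_isMedian ho hb hne hk hker h hw)

theorem exists_constant (ho : IsOpen Ω) (hb : Bornology.IsBounded Ω) (hc : IsConnected Ω)
    (hL : HasLipschitzBoundary Ω) :
    ∃ k : H1 Ω, (∀ c : ℝ, gradL Ω (c • k) = 0) ∧
      (∀ w : H1 Ω, gradL Ω w = 0 → ∃ c : ℝ, w = c • k) ∧
      (∃ C, ∀ w : H1 Ω, ∃ c : ℝ, ‖w - c • k‖ ≤ C * ‖gradL Ω w‖) ∧
      ∀ (w : H1 Ω) (c : ℝ), (∀ c' : ℝ, l1norm w ≤ l1norm (w + c' • k)) →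
        l1norm (w + c • k) ≤ l1norm w → c = 0 := by
  obtain ⟨k, hk, hk'⟩ := exists_one hb
  obtain ⟨C, hC0, hC⟩ := exists_norm_fnL_sub_le ho hb hc hL hk hk'
  have hker : ∀ w : H1 Ω, gradL Ω w = 0 → ∃ c : ℝ, w = c • k := fun w hw => by
    obtain ⟨c, h⟩ := hC w
    rw [hw, norm_zero, mul_zero, norm_le_zero_iff, map_sub, sub_eq_zero] at h
    exact ⟨c, ext_of_fnL ho h⟩
  have hgc : ∀ c : ℝ, gradL Ω (c • k) = 0 := fun c => by rw [map_smul, hk', smul_zero]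
  refine ⟨k, hgc, hker, ⟨C + 1, fun w => ?_⟩,
    fun w c => eq_zero_of_isMedian ho hb hc.nonempty hk hker⟩
  obtain ⟨c, h⟩ := hC w
  refine ⟨c, ?_⟩
  have h2 : gradL Ω (w - c • k) = gradL Ω w := by rw [map_sub, hgc, sub_zero]
  have h1 := norm_le_of_norm_fnL_le hC0 (h2.symm ▸ h)
  rwa [h2] at h1

theorem finiteDimensional_ker {N : Submodule ℝ (H1 Ω)} {k : N}
    (hker : ∀ w : H1 Ω, gradL Ω w = 0 → ∃ c : ℝ, w = c • (k : H1 Ω)) :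
    FiniteDimensional ℝ (LinearMap.ker ((gradL Ω).comp N.subtypeL).toLinearMap) := by
  refine Submodule.finiteDimensional_of_le (S₂ := Submodule.span ℝ {k}) fun w hw => ?_
  obtain ⟨c, h⟩ := hker w hw
  exact Submodule.mem_span_singleton.2 ⟨c, Subtype.ext h.symm⟩

theorem exists_mem_ker_norm_sub_le {N : Submodule ℝ (H1 Ω)} {k : N}
    (hk : ∀ c : ℝ, gradL Ω (c • (k : H1 Ω)) = 0)
    (h : ∃ C, ∀ w : H1 Ω, ∃ c : ℝ, ‖w - c • (k : H1 Ω)‖ ≤ C * ‖gradL Ω w‖) :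
    ∃ C, ∀ w : N, ∃ z : N, gradL Ω z = 0 ∧ ‖w - z‖ ≤ C * ‖gradL Ω w‖ := by
  obtain ⟨C, hC⟩ := h
  refine ⟨C, fun w => ?_⟩
  obtain ⟨c, h⟩ := hC w
  exact ⟨c • k, hk c, h⟩

theorem eq_zero_of_isMedian_of_mem {N : Submodule ℝ (H1 Ω)} {k : N}
    (hk : ∀ c : ℝ, gradL Ω (c • (k : H1 Ω)) = 0)
    (hker : ∀ w : H1 Ω, gradL Ω w = 0 → ∃ c : ℝ, w = c • (k : H1 Ω))
    (h : ∀ (w : H1 Ω) (c : ℝ), (∀ c' : ℝ, l1norm w ≤ l1norm (w + c' • (k : H1 Ω))) →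
        l1norm (w + c • (k : H1 Ω)) ≤ l1norm w → c = 0) (w z : N) (hz : gradL Ω z = 0)
    (hw : ∀ k' : N, gradL Ω k' = 0 → l1norm (w : H1 Ω) ≤ l1norm ((w : H1 Ω) + (k' : H1 Ω)))
    (hle : l1norm ((w : H1 Ω) + (z : H1 Ω)) ≤ l1norm (w : H1 Ω)) : z = 0 := by
  obtain ⟨c, hc⟩ := hker z hz
  rw [hc] at hle
  have hc0 : c = 0 := h w c (fun c' => hw (c' • k) (hk c')) hle
  rw [hc0, zero_smul] at hc
  exact Subtype.ext hc

theorem exists_neumann_setting (ho : IsOpen Ω) (hb : Bornology.IsBounded Ω) (hc : IsConnected Ω)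
    (hL : HasLipschitzBoundary Ω) :
    ∃ S : Setting (BC.neumann.space Ω) (Lp (Eu d) 2 (vol Ω)),
      (∀ w : BC.neumann.space Ω, S.D w = gradL Ω w) ∧
      ∀ w : BC.neumann.space Ω, S.p w = l1 hb w := by
  obtain ⟨k, hk, hker, hC, hmed⟩ := exists_constant ho hb hc hL
  have hkN : k ∈ BC.neumann.space Ω := Submodule.mem_top
  exact ⟨setting .neumann ho hb (finiteDimensional_ker (k := ⟨k, hkN⟩) hker)
    (exists_mem_ker_norm_sub_le (k := ⟨k, hkN⟩) hk hC)
    (eq_zero_of_isMedian_of_mem (k := ⟨k, hkN⟩) hk hker hmed), fun _ => rfl, fun _ => rfl⟩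

end L1Flow

/-! ### The theorem for both boundary conditions. -/

theorem mainTheorem5 {d : ℕ} (hd : 1 ≤ d) (Ω : Set (L1Flow.Eu d)) (hopen : IsOpen Ω)
    (hbdd : Bornology.IsBounded Ω) (hconn : IsConnected Ω) (bc : L1Flow.BC)
    (hLip : bc = L1Flow.BC.neumann → L1Flow.HasLipschitzBoundary Ω) (u₀ : L1Flow.H1 Ω) :
    ∃ u v : ℝ → L1Flow.H1 Ω,
      -- existence
      (L1Flow.IsFlow bc u₀ u v ∧ ∀ t > 0, MemLp v 2 (volume.restrict (Ioi t))) ∧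
      -- uniqueness
      (∀ u' v' : ℝ → L1Flow.H1 Ω, L1Flow.IsFlow bc u₀ u' v' → EqOn u' u (Ici 0)) ∧
      -- convergence of the minimizing movements
      (∀ τ > 0, ∃ U : ℕ → L1Flow.H1 Ω, L1Flow.IsMinMov bc u₀ τ U) ∧
      (∀ U : ℝ → ℕ → L1Flow.H1 Ω, (∀ τ > 0, L1Flow.IsMinMov bc u₀ τ (U τ)) →
        TendstoLocallyUniformlyOn (fun τ t => L1Flow.interp τ (U τ) t) u (𝓝[>] 0) (Ioi 0)) ∧
      -- the speed is non-increasing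
      (∃ N : Set ℝ, volume N = 0 ∧
        AntitoneOn (fun t => L1Flow.gradNorm (v t)) (Ioi 0 \ N)) := by
  cases bc with
  | neumann =>
    obtain ⟨S, hD, hp⟩ := L1Flow.exists_neumann_setting hopen hbdd hconn (hLip rfl)
    exact L1Flow.exists_flow hopen hbdd hD hp u₀
  | dirichlet =>
    obtain ⟨S, hD, hp⟩ := L1Flow.exists_dirichlet_setting hd hopen hbdd
    exact L1Flow.exists_flow hopen hbdd hD hp u₀
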